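/- **Setting.** Let $n+d=26$, let $G_{ij}=\eta_{\mu\nu}\oplus g_{ab}$ with $\eta=\mathrm{diag}(-1,1,\dots,1)$ on $\mathbb R^n$ and $g$ a positive definite symmetric $d\times d$ matrix. Let $\mathcal F$ be the closed bosonic string Fock space on $\mathbb R^{1,n-1}\times T^d$: the space of finite complex linear combinations of the states obtained by applying creation oscillators to vacua $|{\bf 0};\mathrm p,\mathrm w\rangle$ (all $\mathrm p_\mu\in\mathbb R$, $\mathrm p_a,\mathrm w^a\in\mathbb Z$), with oscillators $[\alpha_k^i,\alpha_l^j]=kG^{ij}\delta_{k+l}$, $\{b_k,c_l\}=\delta_{k+l}$ and their barred copies, where $\alpha^i_k$ $(k>0)$, $b_k$ $(k\ge-1)$, $c_k$ $(k\geq 2)$ annihilate the vacua, and zero modes $\alpha_0^\mu=\bar\alpha_0^\mu=\eta^{\mu\nu}\mathrm p_\nu$, $\alpha_0^a=g^{ab}\mathrm p_b-\frac12\mathrm w^a$, $\bar\alpha_0^a=g^{ab}\mathrm p_b+\frac12\mathrm w^a$. With conformal normal ordering, put $$L_k^{\rm m}=\sum_m\tfrac12{:}\alpha^i_{k-m}G_{ij}\alpha^j_m{:},\quad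 L_k^{\rm gh}=\sum_m(k+m){:}b_{k-m}c_m{:},\quad L_k=L_k^{\rm m}+L_k^{\rm gh},$$ $$Q_B=\sum_k{:}c_{-k}(L_k^{\rm m}+\tfrac12L_k^{\rm gh}){:}+\text{(barred)},$$ $L_0^\pm=L_0\pm\bar L_0$, $b_0^\pm=b_0\pm\bar b_0$, $c_0^\pm=\frac12(c_0\pm\bar c_0)$. Let $X=\ker L_0^-\cap\ker b_0^-\subset\mathcal F$, graded by $\deg=2-(\text{ghost number})$, where the vacua have ghost number $0$, and let $\partial=Q_B$. Let $\kappa(x,y)=R(x,c_0^-y)$, where the reflector $R(x,y)=x^Ty$ is determined by the BPZ rules $(\alpha^i_k)^T=(-1)^{k+1}\alpha^i_{-k}$, $(b_k)^T=(-1)^kb_{-k}$, $(c_k)^T=(-1)^{k+1}c_{-k}$ (same for barred oscillators), $|{\bf 0};\mathrm p,\mathrm w\rangle^T=(-1)^{\mathrm p_a\mathrm w^a}\langle{\bf 0};-\mathrm p,-\mathrm w|$ and the overlap $\langle{\bf 0};\mathrm p',\mathrm w'|c_{-1}\bar c_{-1}c_0^+c_0^-c_1\bar c_1|{\bf 0};\mathrm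 p,\mathrm w\rangle=(2\pi)^{n+2d}\delta_{\mathrm p,\mathrm p'}\delta_{\mathrm w,\mathrm w'}$ (Kronecker deltas). Let $\Pi$ be the projector, diagonal in the Fock basis, that keeps the basis states annihilated by $L_0^+$ and kills the others, and let $G=b_0^+(L_0^+)^{-1}({\bf 1}-\Pi)$ be the Siegel gauge propagator. **Theorem.** 1. $L_0^+$ is diagonal in the Fock basis, $\{b_0^+,Q_B\}=L_0^+$, $(b_0^+)^2=0$ and $(Q_B)^2=0$. The spaces $X$ and $Y=X\cap\ker L_0^+$ are graded; $\partial$ has degree $-1$ and $G$ has degree $+1$. 2. $\partial$ and $G$ map $X$ to $X$, $\Pi$ restricts to a projector of $X$ onto $Y$, and $-G$ is a homotopy on $X$: $\Pi={\bf 1}+\partial(-G)+(-G)\partial$. 3. With $h=-G$, the side conditions $h^2=h\Pi=\Pi h=0$ hold on $X$, and $\kappa(\Pi x,({\bf 1}-\Pi)y)=0$, $\kappa(hx,hy)=0$ for all $x,y\in X$. 4. Let $(b_m)_{m\ge1}$ be any brackets on $X$, with $b_1=Q_B$, that make $(X,\{b_m\},\kappa)$ a cyclic $L_\infty$-algebra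 (all $b_m$ graded symmetric of degree $-1$; $\kappa$ nondegenerate, graded symmetric and supported in total degree $-1$; $\kappa(b_m(x_1,\dots,x_m),x_{m+1})$ graded symmetric in all arguments). Then there are graded symmetric maps $E_m:Y^m\to X$ of degree $0$ and brackets $\bar b_m$ on $Y$ with $E_1$ the inclusion, $\bar b_1=Q_B|_Y$ and, for $m\ge2$, $E_m=hF_m$ and $\bar b_m=\Pi F_m$, where $$F_m(y_1,\dots,y_m)=\sum_{k\ge2}\frac1{k!}\sum_{A_1\sqcup\dots\sqcup A_k=\{1,\dots,m\},\ A_i\ne\emptyset}\pm\, b_k\big(E_{|A_1|}(y_{A_1}),\dots,E_{|A_k|}(y_{A_k})\big)$$ (Koszul signs); $(Y,\{\bar b_m\},\kappa|_Y)$ is a cyclic $L_\infty$-algebra, and $E$ is an $L_\infty$-morphism from $Y$ to $X$. -/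

import Mathlib

/-! ## The closed bosonic string on `ℝ^{1,n-1} × T^d`: Fock space and oscillators -/

namespace ClosedString

noncomputable section

/-- The Minkowski metric `η = diag(-1, 1, …, 1)` on `ℝⁿ`. -/
def minkowski (n : ℕ) : Matrix (Fin n) (Fin n) ℝ :=
  Matrix.diagonal fun μ => if μ.val = 0 then -1 else 1

/-- The target space metric `G_{ij}`: Minkowski on the noncompact directions, `g` on the torus. -/
def metric (n : ℕ) {d : ℕ} (g : Matrix (Fin d) (Fin d) ℝ) :
    Matrix (Fin n ⊕ Fin d) (Fin n ⊕ Fin d) ℝ :=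
  Matrix.fromBlocks (minkowski n) 0 0 g

/-- Labels of the Fock space basis.  The chirality is `false` for the holomorphic and `true` for
the antiholomorphic oscillators.

* `mom`, `tmom`, `wind`: noncompact momentum `p_μ`, torus momentum `p_a`, winding `w^a`;
* `bos (χ, m, i)`: the number of creation oscillators `α_{-m}^i` of chirality `χ`;
* `gh`: the set of occupied ghost modes.  The element `(k, χ)` stands for the creation oscillator
  `c_k` if `k ≤ 1`, and for the creation oscillator `b_{-k}` if `2 ≤ k` (these are the ghost
  oscillators that do not annihilate the `SL(2,ℂ)`-invariant vacuum).

The label stands for the ghost oscillators in increasing order, times the matter oscillators,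
applied to the `SL(2,ℂ)`-invariant vacuum `|0; p, w⟩`. -/
@[ext] structure FockLabel (n d : ℕ) where
  mom : Fin n → ℝ
  tmom : Fin d → ℤ
  wind : Fin d → ℤ
  bos : (Bool × ℕ+ × (Fin n ⊕ Fin d)) →₀ ℕ
  gh : Finset (ℤ ×ₗ Bool)

/-- The Fock space: finite complex linear combinations of the basis states. -/
abbrev Fock (n d : ℕ) : Type := FockLabel n d →₀ ℂ

variable {n d : ℕ}

/-- The basis state with label `s`. -/
def ket (s : FockLabel n d) : Fock n d := Finsupp.single s 1

/-- The linear operator with prescribed values on the basis states. -/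
def ofKet {W : Type*} [AddCommGroup W] [Module ℂ W] (f : FockLabel n d → W) : Fock n d →ₗ[ℂ] W :=
  Finsupp.linearCombination ℂ f

/-- The sum of a family of operators of which only finitely many act nontrivially on any given
basis state. -/
def opSum (T : ℤ → (Fock n d →ₗ[ℂ] Fock n d)) : Fock n d →ₗ[ℂ] Fock n d :=
  ofKet fun s => ∑ᶠ m : ℤ, T m (ket s)

/-- The eigenvalue of the zero mode `α_0^i` (`ᾱ_0^i` for `χ = true`) on a basis state:
`α_0^μ = ᾱ_0^μ = η^{μν} p_ν`, `α_0^a = G^{ab} p_b - w^a / 2`, `ᾱ_0^a = G^{ab} p_b + w^a / 2`. -/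
def zeroMode (g : Matrix (Fin d) (Fin d) ℝ) (χ : Bool) (s : FockLabel n d) : Fin n ⊕ Fin d → ℝ
  | Sum.inl μ => ∑ ν, (minkowski n)⁻¹ μ ν * s.mom ν
  | Sum.inr a => ∑ b, g⁻¹ a b * (s.tmom b : ℝ) + (if χ then 1 else -1) * (s.wind a : ℝ) / 2

/-- The matter oscillator `α_k^i` (`ᾱ_k^i` for `χ = true`). -/
def alpha (g : Matrix (Fin d) (Fin d) ℝ) (χ : Bool) (k : ℤ) (i : Fin n ⊕ Fin d) :
    Fock n d →ₗ[ℂ] Fock n d :=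
  ofKet fun s =>
    if k < 0 then
      ket { s with bos := s.bos + Finsupp.single (χ, k.natAbs.toPNat', i) 1 }
    else if k = 0 then
      (zeroMode g χ s i : ℂ) • ket s
    else
      ∑ j, ((k : ℂ) * ((metric n g)⁻¹ i j : ℂ) * (s.bos (χ, k.natAbs.toPNat', j) : ℂ)) •
        ket { s with bos := s.bos - Finsupp.single (χ, k.natAbs.toPNat', j) 1 }

/-- The sign picked up when an oscillator is moved into position `e`. -/
def ghSign (S : Finset (ℤ ×ₗ Bool)) (e : ℤ ×ₗ Bool) : ℂ := (-1) ^ (S.filter (· < e)).card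

/-- Creation of the ghost excitation `e`. -/
def ghCreate (e : ℤ ×ₗ Bool) : Fock n d →ₗ[ℂ] Fock n d :=
  ofKet fun s => if e ∈ s.gh then 0 else ghSign s.gh e • ket { s with gh := insert e s.gh }

/-- Annihilation of the ghost excitation `e`. -/
def ghAnnihilate (e : ℤ ×ₗ Bool) : Fock n d →ₗ[ℂ] Fock n d :=
  ofKet fun s => if e ∈ s.gh then ghSign s.gh e • ket { s with gh := s.gh.erase e } else 0

/-- The ghost oscillator `c_k` (`c̄_k` for `χ = true`). -/
def cOsc (χ : Bool) (k : ℤ) : Fock n d →ₗ[ℂ] Fock n d :=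
  if k ≤ 1 then ghCreate (toLex (k, χ)) else ghAnnihilate (toLex (k, χ))

/-- The antighost oscillator `b_k` (`b̄_k` for `χ = true`). -/
def bOsc (χ : Bool) (k : ℤ) : Fock n d →ₗ[ℂ] Fock n d :=
  if -1 ≤ k then ghAnnihilate (toLex (-k, χ)) else ghCreate (toLex (-k, χ))

/-! ## Virasoro generators and BRST charge -/

/-- The normal ordered product `:α_r^i α_s^j:`. -/
def normalAlphaAlpha (g : Matrix (Fin d) (Fin d) ℝ) (χ : Bool) (r s : ℤ) (i j : Fin n ⊕ Fin d) :
    Fock n d →ₗ[ℂ] Fock n d :=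
  if r ≤ s then alpha g χ r i ∘ₗ alpha g χ s j else alpha g χ s j ∘ₗ alpha g χ r i

/-- `L_k^matter = ∑_m ½ :α_{k-m}^i G_{ij} α_m^j:`. -/
def LMatter (g : Matrix (Fin d) (Fin d) ℝ) (χ : Bool) (k : ℤ) : Fock n d →ₗ[ℂ] Fock n d :=
  opSum fun m => (1 / 2 : ℂ) •
    ∑ i, ∑ j, (metric n g i j : ℂ) • normalAlphaAlpha g χ (k - m) m i j

/-- The conformal normal ordered product `:b_r c_s:` (`c_s` is an annihilation oscillator for
`2 ≤ s`). -/
def normalBC (χ : Bool) (r s : ℤ) : Fock n d →ₗ[ℂ] Fock n d :=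
  if 2 ≤ s then bOsc χ r ∘ₗ cOsc χ s else -(cOsc χ s ∘ₗ bOsc χ r)

/-- `L_k^ghost = ∑_m (k + m) :b_{k-m} c_m:`. -/
def LGhost (χ : Bool) (k : ℤ) : Fock n d →ₗ[ℂ] Fock n d :=
  opSum fun m => ((k + m : ℤ) : ℂ) • normalBC χ (k - m) m

/-- The Virasoro generator `L_k` (`L̄_k` for `χ = true`). -/
def Vir (g : Matrix (Fin d) (Fin d) ℝ) (χ : Bool) (k : ℤ) : Fock n d →ₗ[ℂ] Fock n d :=
  LMatter g χ k + LGhost χ k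

/-- The conformal normal ordered product `:c_r Y:`, where `Y` is an even normal ordered operator. -/
def normalC (χ : Bool) (r : ℤ) (Y : Fock n d →ₗ[ℂ] Fock n d) : Fock n d →ₗ[ℂ] Fock n d :=
  if 2 ≤ r then Y ∘ₗ cOsc χ r else cOsc χ r ∘ₗ Y

/-- One chiral half `∑_k :c_{-k} (L_k^matter + ½ L_k^ghost):` of the BRST charge. -/
def chiralBRST (g : Matrix (Fin d) (Fin d) ℝ) (χ : Bool) : Fock n d →ₗ[ℂ] Fock n d :=
  opSum fun k => normalC χ (-k) (LMatter g χ k + (1 / 2 : ℂ) • LGhost χ k)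

/-- The worldsheet BRST charge `Q_B`. -/
def QB (n : ℕ) {d : ℕ} (g : Matrix (Fin d) (Fin d) ℝ) : Fock n d →ₗ[ℂ] Fock n d :=
  chiralBRST g false + chiralBRST g true

/-- `L_0^+ = L_0 + L̄_0`. -/
def LPlus (n : ℕ) {d : ℕ} (g : Matrix (Fin d) (Fin d) ℝ) : Fock n d →ₗ[ℂ] Fock n d := Vir g false 0 + Vir g true 0

/-- `L_0^- = L_0 - L̄_0`. -/
def LMinus (n : ℕ) {d : ℕ} (g : Matrix (Fin d) (Fin d) ℝ) : Fock n d →ₗ[ℂ] Fock n d :=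
  Vir g false 0 - Vir g true 0

/-- `b_0^+ = b_0 + b̄_0`. -/
def bPlus (n d : ℕ) : Fock n d →ₗ[ℂ] Fock n d := bOsc false 0 + bOsc true 0

/-- `b_0^- = b_0 - b̄_0`. -/
def bMinus (n d : ℕ) : Fock n d →ₗ[ℂ] Fock n d := bOsc false 0 - bOsc true 0

/-- `c_0^- = ½ (c_0 - c̄_0)`. -/
def cMinus (n d : ℕ) : Fock n d →ₗ[ℂ] Fock n d := (1 / 2 : ℂ) • (cOsc false 0 - cOsc true 0)

/-- The space `X` of closed string fields: the states with `(L_0 - L̄_0) x = (b_0 - b̄_0) x = 0`. -/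
def StringFields (n : ℕ) {d : ℕ} (g : Matrix (Fin d) (Fin d) ℝ) : Submodule ℂ (Fock n d) :=
  LinearMap.ker (LMinus n g) ⊓ LinearMap.ker (bMinus n d)

/-- The kernel of `L_0^+` on `X`. -/
def kerLPlus (n : ℕ) {d : ℕ} (g : Matrix (Fin d) (Fin d) ℝ) : Submodule ℂ (Fock n d) :=
  StringFields n g ⊓ LinearMap.ker (LPlus n g)

/-- The ghost number of a basis state; the vacuum `|0; p, w⟩` has ghost number `0`. -/
def ghostNumber (s : FockLabel n d) : ℤ := ∑ e ∈ s.gh, if (ofLex e).1 ≤ 1 then 1 else -1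

/-- The states of degree `k`, where the degree is `2 - (ghost number)`. -/
def degPart (n d : ℕ) (k : ℤ) : Submodule ℂ (Fock n d) :=
  Finsupp.supported ℂ ℂ {s | 2 - ghostNumber s = k}

/-- The grading by degree that a subspace inherits. -/
def gradingOn (U : Submodule ℂ (Fock n d)) (k : ℤ) : Submodule ℂ U :=
  (degPart n d k).comap U.subtype

/-! ## The Siegel gauge propagator -/

/-- The diagonal matrix element of `L_0^+` at a basis state. -/
def LPlusEntry (n : ℕ) {d : ℕ} (g : Matrix (Fin d) (Fin d) ℝ) (s : FockLabel n d) : ℂ := LPlus n g (ket s) s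

open scoped Classical in
/-- The projector `Π` that is diagonal in the Fock space basis: it keeps the basis states that
`L_0^+` annihilates and kills all others. -/
def projKer (n : ℕ) {d : ℕ} (g : Matrix (Fin d) (Fin d) ℝ) : Fock n d →ₗ[ℂ] Fock n d :=
  ofKet fun s => if LPlus n g (ket s) = 0 then ket s else 0

/-- `(L_0^+)⁻¹`, diagonal in the Fock space basis.  It is only applied to the span of the basis
states with nonzero eigenvalue. -/
def LPlusInv (n : ℕ) {d : ℕ} (g : Matrix (Fin d) (Fin d) ℝ) : Fock n d →ₗ[ℂ] Fock n d :=
  ofKet fun s => (LPlusEntry n g s)⁻¹ • ket s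

/-- The Siegel gauge propagator `G = b_0^+ (L_0^+)⁻¹ (1 - Π)`. -/
def siegelG (n : ℕ) {d : ℕ} (g : Matrix (Fin d) (Fin d) ℝ) : Fock n d →ₗ[ℂ] Fock n d :=
  bPlus n d ∘ₗ LPlusInv n g ∘ₗ (LinearMap.id - projKer n g)

/-! ## BPZ conjugation, reflector and cyclic inner product -/

/-- The BPZ conjugate of the ghost creation oscillator with label `(k, χ)`:
`(c_k)^T = (-1)^{k+1} c_{-k}` and `(b_k)^T = (-1)^k b_{-k}`. -/
def ghTranspose (e : ℤ ×ₗ Bool) : Module.End ℂ (Fock n d) :=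
  if (ofLex e).1 ≤ 1 then (-1 : ℂ) ^ ((ofLex e).1 + 1) • cOsc (ofLex e).2 (-(ofLex e).1)
  else (-1 : ℂ) ^ (ofLex e).1 • bOsc (ofLex e).2 (ofLex e).1

/-- The BPZ conjugate `(α_{-m}^i)^T = (-1)^{m+1} α_m^i` of a matter creation oscillator. -/
def bosTranspose (g : Matrix (Fin d) (Fin d) ℝ) (v : Bool × ℕ+ × (Fin n ⊕ Fin d)) :
    Module.End ℂ (Fock n d) :=
  (-1 : ℂ) ^ ((v.2.1 : ℕ) + 1) • alpha g v.1 (v.2.1 : ℤ) v.2.2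

/-- The product of the BPZ conjugates of the creation oscillators that make up a basis state.  The
matter factors commute with each other, so the order of that list does not matter. -/
def labelTranspose (g : Matrix (Fin d) (Fin d) ℝ) (s : FockLabel n d) : Module.End ℂ (Fock n d) :=
  (s.gh.sort.map ghTranspose).prod *
    (s.bos.support.toList.map fun v => bosTranspose g v ^ s.bos v).prod

/-- The dual vacuum `⟨0; p', w'|` as a linear functional.  It is normalised by
`⟨0; p', w'| c_{-1} c̄_{-1} c_0^+ c_0^- c_1 c̄_1 |0; p, w⟩ = (2π)^{n+2d} δ_{p,p'} δ_{w,w'}`, with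
`c_0^+ = ½ (c_0 + c̄_0)`; since `c_0^+ c_0^- = -½ c_0 c̄_0`, the ket in this formula is `-½` times
the basis state in which exactly `c_k, c̄_k` with `-1 ≤ k ≤ 1` are occupied. -/
def bra (p : Fin n → ℝ) (q w : Fin d → ℤ) : Fock n d →ₗ[ℂ] ℂ :=
  (-2 * (2 * (Real.pi : ℂ)) ^ (n + 2 * d)) •
    Finsupp.lapply
      { mom := p, tmom := q, wind := w, bos := 0,
        gh := ((Finset.Icc (-1 : ℤ) 1) ×ˢ (Finset.univ : Finset Bool)).map toLex.toEmbedding }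

/-- The reflector `R(x, y) = x^T y`, where the BPZ conjugate of a state is obtained from
`|0; p, w⟩^T = (-1)^{p_a w^a} ⟨0; -p, -w|` and from the BPZ conjugates of the oscillators. -/
def reflector (n : ℕ) {d : ℕ} (g : Matrix (Fin d) (Fin d) ℝ) : Fock n d →ₗ[ℂ] Fock n d →ₗ[ℂ] ℂ :=
  ofKet fun s => (-1 : ℂ) ^ (∑ a, s.tmom a * s.wind a) •
    (bra (-s.mom) (-s.tmom) (-s.wind) ∘ₗ labelTranspose g s)

/-- The cyclic inner product `κ(x, y) = R(x, c_0^- y)`. -/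
def kappa (n : ℕ) {d : ℕ} (g : Matrix (Fin d) (Fin d) ℝ) : Fock n d →ₗ[ℂ] Fock n d →ₗ[ℂ] ℂ :=
  (reflector n g).compl₂ (cMinus n d)

end

end ClosedString

/-! ## Cyclic `L∞`-algebras and homotopy transfer -/

namespace LInfty

noncomputable section

variable {V W : Type*} [AddCommGroup V] [Module ℂ V] [AddCommGroup W] [Module ℂ W]

/-- A family of `m`-linear maps from `V` to `W`, one for each `m`. -/
abbrev Multi (V W : Type*) [AddCommGroup V] [Module ℂ V] [AddCommGroup W] [Module ℂ W] : Type _ :=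
  (m : ℕ) → MultilinearMap ℂ (fun _ : Fin m => V) W

/-- The Koszul sign of the stable rearrangement of elements of degrees `p i` that puts them in
increasing order of `f i`. -/
def koszul {m : ℕ} {ι : Type*} [LinearOrder ι] (f : Fin m → ι) (p : Fin m → ℤ) : ℤ :=
  ∏ i, ∏ j, if i < j ∧ f j < f i then ((p i * p j).negOnePow : ℤ) else 1

/-- The subsequence of `x` with positions in `A`. -/
def sub {m : ℕ} (x : Fin m → V) (A : Finset (Fin m)) : Fin A.card → V :=
  fun i => x (A.orderEmbOfFin rfl i)

/-- `x` is a sequence of homogeneous elements, of degrees `p`. -/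
def Homog (𝒱 : ℤ → Submodule ℂ V) {m : ℕ} (p : Fin m → ℤ) (x : Fin m → V) : Prop :=
  ∀ i, x i ∈ 𝒱 (p i)

/-- `∑_A ± E_{m-|A|+1}(b_{|A|}(x_A), x_{Aᶜ})`, the sum over all subsets `A` of the arguments, i.e.
over all unshuffles. -/
def insertSum (E : Multi V W) (b : Multi V V) {m : ℕ} (p : Fin m → ℤ) (x : Fin m → V) : W :=
  ∑ A : Finset (Fin m), koszul (fun i => if i ∈ A then (0 : ℕ) else 1) p •
    E (Aᶜ.card + 1) (Fin.cons (b A.card (sub x A)) (sub x Aᶜ))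

/-- `∑_{k ≥ r} 1/k! ∑ ± b_k(E(x_{A_1}), …, E(x_{A_k}))`, the inner sum over all decompositions of
the arguments into `k` nonempty blocks `A_1, …, A_k`. -/
def blockSum (b : Multi W W) (E : Multi V W) (r : ℕ) {m : ℕ} (p : Fin m → ℤ) (x : Fin m → V) : W :=
  ∑ k ∈ Finset.Icc r m, ((k.factorial : ℂ)⁻¹) •
    ∑ f : Fin m → Fin k with Function.Surjective f, koszul f p •
      b k fun a => E (Finset.univ.filter (f · = a)).card (sub x (Finset.univ.filter (f · = a)))

/-- `L∞`-algebras in the convention in which all brackets are graded symmetric of degree `-1`. -/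
structure IsLInfty (𝒱 : ℤ → Submodule ℂ V) (b : Multi V V) : Prop where
  uncurved : b 0 = 0
  degree : ∀ (m : ℕ) (p : Fin m → ℤ) (x : Fin m → V), Homog 𝒱 p x → b m x ∈ 𝒱 (∑ i, p i - 1)
  symm : ∀ (m : ℕ) (p : Fin m → ℤ) (x : Fin m → V) (σ : Equiv.Perm (Fin m)), Homog 𝒱 p x →
    b m (x ∘ σ) = koszul σ.symm p • b m x
  jacobi : ∀ (m : ℕ) (p : Fin m → ℤ) (x : Fin m → V), Homog 𝒱 p x → insertSum b b p x = 0

/-- Cyclic `L∞`-algebras: there is a nondegenerate inner product `κ`, graded symmetric and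
supported in total degree `-1`, such that `κ(b_m(x_1, …, x_m), x_{m+1})` is graded symmetric in all
its arguments. -/
structure IsCyclicLInfty (𝒱 : ℤ → Submodule ℂ V) (κ : V →ₗ[ℂ] V →ₗ[ℂ] ℂ) (b : Multi V V) : Prop
    extends IsLInfty 𝒱 b where
  nondegenerate : κ.Nondegenerate
  kappa_degree : ∀ (p q : ℤ) (x y : V), x ∈ 𝒱 p → y ∈ 𝒱 q → p + q ≠ -1 → κ x y = 0
  kappa_symm : ∀ (p q : ℤ) (x y : V), x ∈ 𝒱 p → y ∈ 𝒱 q →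
    κ x y = ((p * q).negOnePow : ℤ) • κ y x
  cyclic : ∀ (m : ℕ) (p : Fin (m + 1) → ℤ) (x : Fin (m + 1) → V) (σ : Equiv.Perm (Fin (m + 1))),
    Homog 𝒱 p x →
    κ (b m fun i => x (σ i.castSucc)) (x (σ (Fin.last m))) =
      koszul σ.symm p • κ (b m fun i => x i.castSucc) (x (Fin.last m))

/-- `L∞`-morphisms `E` from `(V, bV)` to `(W, bW)`. -/
structure IsMorphism (𝒱 : ℤ → Submodule ℂ V) (bV : Multi V V) (𝒲 : ℤ → Submodule ℂ W)
    (bW : Multi W W) (E : Multi V W) : Prop where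
  zero : E 0 = 0
  degree : ∀ (m : ℕ) (p : Fin m → ℤ) (x : Fin m → V), Homog 𝒱 p x → E m x ∈ 𝒲 (∑ i, p i)
  symm : ∀ (m : ℕ) (p : Fin m → ℤ) (x : Fin m → V) (σ : Equiv.Perm (Fin m)), Homog 𝒱 p x →
    E m (x ∘ σ) = koszul σ.symm p • E m x
  comm : ∀ (m : ℕ) (p : Fin m → ℤ) (x : Fin m → V), Homog 𝒱 p x →
    insertSum E bV p x = blockSum bW E 1 p x

variable {H : Type*} [AddCommGroup H] [Module ℂ H]

/-- The homotopy relation `P = 1 + h ∂ + ∂ h` on the subspace `X`, where `P` is a projector of `X`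
onto `Y`. -/
structure IsHomotopy (X Y : Submodule ℂ H) (D P h : H →ₗ[ℂ] H) : Prop where
  mapsTo_D : ∀ x ∈ X, D x ∈ X
  mapsTo_h : ∀ x ∈ X, h x ∈ X
  range_P : X.map P = Y
  idem : ∀ x ∈ X, P (P x) = P x
  homotopy : ∀ x ∈ X, P x = x + h (D x) + D (h x)

/-- The side conditions `h² = h P = P h = 0` on the subspace `X`. -/
structure SideConditions (X : Submodule ℂ H) (P h : H →ₗ[ℂ] H) : Prop where
  hh : ∀ x ∈ X, h (h x) = 0
  hP : ∀ x ∈ X, h (P x) = 0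
  Ph : ∀ x ∈ X, P (h x) = 0

/-- The orthogonality conditions `κ(P x, (1 - P) y) = 0` and `κ(h x, h y) = 0` on `X`. -/
structure Orthogonality (X : Submodule ℂ H) (κ : H →ₗ[ℂ] H →ₗ[ℂ] ℂ) (P h : H →ₗ[ℂ] H) : Prop where
  proj : ∀ x ∈ X, ∀ y ∈ X, κ (P x) (y - P y) = 0
  homotopy : ∀ x ∈ X, ∀ y ∈ X, κ (h x) (h y) = 0

/-- The brackets `bY` on `Y` and the maps `E` from `Y` to `X` are the ones that homotopy transfer
along `P` and `h` produces from the brackets `b` on `X`: `E_1` is the inclusion, `bY_1` is the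
restriction of `b_1`, and for `m ≥ 2`, with `F_m = ∑_{k ≥ 2} 1/k! ∑ ± b_k(E, …, E)`, one has
`E_m = h F_m` and `bY_m = P F_m`. -/
structure IsTransfer {X Y : Submodule ℂ H} (𝒴 : ℤ → Submodule ℂ Y) (P h : H →ₗ[ℂ] H)
    (b : Multi X X) (bY : Multi Y Y) (E : Multi Y X) : Prop where
  incl : ∀ y : Y, (E 1 ![y] : H) = y
  unary : ∀ y : Y, (bY 1 ![y] : H) = b 1 ![E 1 ![y]]
  map : ∀ (m : ℕ) (p : Fin m → ℤ) (y : Fin m → Y), 2 ≤ m → Homog 𝒴 p y →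
    (E m y : H) = h (blockSum b E 2 p y : X)
  bracket : ∀ (m : ℕ) (p : Fin m → ℤ) (y : Fin m → Y), 2 ≤ m → Homog 𝒴 p y →
    (bY m y : H) = P (blockSum b E 2 p y : X)

end

end LInfty

open ClosedString LInfty

namespace LInfty

/-! ### Signs -/

/-! The theorem joins a purely algebraic transfer theorem, valid for any contraction of a cyclic
L∞-algebra that is compatible with the pairing, with the verification that the Siegel gauge
propagator supplies such a contraction.

Algebra. The maps `E` solve `E = ι + h F₂(E)`, where `F₂` collects the brackets `b_k(E, …, E)` with
`k ≥ 2`. Every block in `F₂` is proper, so the equation is a recursion on the arity. Let `F = D E +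
F₂` be the sum of all `b(E, …, E)` (`curv`), and let `twist` be the operator `x ↦ ∑ b(x, E, …, E)`.
Summing the Jacobi identity of `b` over all partitions gives a Bianchi identity, `twist` applied to
`F` vanishes (`split_twisted_curvature`), and the homotopy relation gives `ι b̄ = F + h D F`
(`incl_bracket`). When `b̄` is inserted into the first slot of the recursion for `E`,
coassociativity and induction on the number of arguments leave `F + h D F - h D F = F`, which is the
morphism equation (`split_map_bracket`). Projecting with `π` in place of `h` yields the Jacobi
identity of `b̄` (`split_bracket_bracket`). For cyclicity (`kappa_bracket`), the sum of all `κ(F₂(z,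
…), E(w, …))` is graded symmetric in `z` and `w` because `b` is cyclic. Substituting `E = ι + h F₂`
in the second slot, the part with `h` is symmetric by itself because `h` is graded self-adjoint, so
the part with `ι` is symmetric too.

The bookkeeping is done on lists. `split` is the signed unshuffle coproduct, and `partSum` sums over
partitions whose blocks are ordered by their first elements, so that factorials enter only in the
comparison `partSum_eq_sum_blocks`.

String. The deviation of the `L_k` from the Witt algebra commutes with all oscillators, hence is
determined by its values on vacua. An `L_0` weight argument leaves only `k + l = 0`, and there 26
matter fields cancel the ghosts (`anomaly_eq_zero`). The charge is never squared by hand. From `{Q,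
b_l} = L_l` and the Witt algebra, `[Q, L_l]` anticommutes with all `b`'s, and an operator that does
so and raises the ghost number is zero (`eq_zero_of_commute_bOsc`). Then `Q²` commutes with all
`b`'s and vanishes for the same reason. Since `L_0^+` is diagonal and commutes with `Q`, `b_0^±` and
`c_0^-`, the operator `-b_0^+ / L_0^+` contracts everything outside its kernel. The reflector pairs
only basis states of equal `L_0^+` eigenvalue, so `Π` is self-adjoint. Finally `b_0^+` moves across
the reflector up to sign, anticommutes with `c_0^-` and squares to zero, so that `κ(G x, G y) = 0`.
-/

/-- The sign `(-1)^n` as an integer. -/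
def sg (n : ℤ) : ℤ := (n.negOnePow : ℤ)

lemma sg_def (n : ℤ) : (n.negOnePow : ℤ) = sg n := rfl

@[simp] lemma sg_zero : sg 0 = 1 := by simp [sg]

lemma sg_add (a b : ℤ) : sg (a + b) = sg a * sg b := by simp [sg, Int.negOnePow_add]

lemma sg_congr {a b : ℤ} (h : Even (a - b)) : sg a = sg b := by
  unfold sg; rw [(Int.negOnePow_eq_iff a b).2 h]

lemma sg_mul_self (a : ℤ) : sg a * sg a = 1 := by
  rw [← sg_add, sg_congr (b := 0) (by simp), sg_zero]

lemma sg_sum {ι : Type*} (s : Finset ι) (f : ι → ℤ) : sg (∑ i ∈ s, f i) = ∏ i ∈ s, sg (f i) := by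
  classical
  induction s using Finset.induction_on with
  | empty => simp
  | insert a s ha ih => rw [Finset.sum_insert ha, Finset.prod_insert ha, sg_add, ih]

/-! ### Signed sums over unshuffles of a list -/

section Split

variable {T M N : Type*} [AddCommGroup M] [AddCommGroup N]

/-- The total degree of a list. -/
def tdeg (d : T → ℤ) (l : List T) : ℤ := (l.map d).sum

@[simp] lemma tdeg_nil (d : T → ℤ) : tdeg d [] = 0 := rfl

@[simp] lemma tdeg_cons (d : T → ℤ) (x : T) (l : List T) : tdeg d (x :: l) = d x + tdeg d l := by
  simp [tdeg]

@[simp] lemma tdeg_append (d : T → ℤ) (l l' : List T) :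
    tdeg d (l ++ l') = tdeg d l + tdeg d l' := by
  simp [tdeg]

lemma tdeg_perm (d : T → ℤ) {l l' : List T} (h : l.Perm l') : tdeg d l = tdeg d l' :=
  (h.map d).sum_eq

/-- The sum of `± g a c` over all unshuffles of a list into two sublists `a`, `c`. -/
def split (d : T → ℤ) : List T → (List T → List T → M) → M
  | [], g => g [] []
  | x :: l, g => split d l fun a c => g (x :: a) c + sg (d x * tdeg d a) • g a (x :: c)

variable (d : T → ℤ)

/-- The hypothesis that `a ++ c` permutes `l` carries what later arguments need: total degrees for
the signs and lengths for inductions. -/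
lemma split_congr {l : List T} {g g' : List T → List T → M}
    (h : ∀ a c, (a ++ c).Perm l → g a c = g' a c) : split d l g = split d l g' := by
  induction l generalizing g g' with
  | nil => exact h [] [] (by simp)
  | cons x l ih =>
    refine ih fun a c hac => ?_
    rw [h (x :: a) c (by simpa using hac), h a (x :: c)]
    exact List.perm_middle.trans (hac.cons x)

lemma split_add (l : List T) (g g' : List T → List T → M) :
    split d l (fun a c => g a c + g' a c) = split d l g + split d l g' := by
  induction l generalizing g g' with
  | nil => rfl
  | cons x l ih =>
    simp only [split]
    rw [← ih]
    refine split_congr d fun a c _ => ?_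
    rw [smul_add]; abel

lemma map_split {F : Type*} [FunLike F M N] [AddMonoidHomClass F M N] (φ : F) (l : List T)
    (g : List T → List T → M) : φ (split d l g) = split d l fun a c => φ (g a c) := by
  induction l generalizing g with
  | nil => rfl
  | cons x l ih => simp only [split, ih, map_add, map_zsmul]

lemma split_zsmul (l : List T) (n : ℤ) (g : List T → List T → M) :
    split d l (fun a c => n • g a c) = n • split d l g :=
  (map_split d (DistribSMul.toAddMonoidHom M n) l g).symm

lemma split_nsmul (l : List T) (n : ℕ) (g : List T → List T → M) :
    split d l (fun a c => n • g a c) = n • split d l g :=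
  (map_split d (DistribSMul.toAddMonoidHom M n) l g).symm

lemma split_zero (l : List T) : split d l (fun _ _ => (0 : M)) = 0 := by
  induction l with
  | nil => rfl
  | cons x l ih => simpa [split] using ih

lemma split_sum {κ : Type*} (s : Finset κ) (l : List T) (G : κ → List T → List T → M) :
    (split d l fun a c => ∑ k ∈ s, G k a c) = ∑ k ∈ s, split d l (G k) := by
  classical
  induction s using Finset.induction_on with
  | empty => simp [split_zero]
  | insert k s hk ihs => simp only [Finset.sum_insert hk, split_add, ihs]

/-- Coassociativity of the unshuffle coproduct. -/
lemma split_assoc (l : List T) (g : List T → List T → List T → M) :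
    split d l (fun a r => split d r fun b c => g a b c) =
      split d l fun r c => split d r fun a b => g a b c := by
  induction l generalizing g with
  | nil => rfl
  | cons x l ih =>
    simp only [split, split_add, ← split_zsmul, smul_add]
    rw [ih, ih, ih, add_assoc, ← split_add, ← split_add, ← split_add]
    simp only [← split_add]
    refine split_congr d fun a c _ => split_congr d fun a' c' hp => ?_
    simp only [smul_smul, ← sg_add, ← tdeg_perm d hp, tdeg_append, mul_add]

/-- Graded cocommutativity of the unshuffle coproduct. -/
lemma split_comm (l : List T) (g : List T → List T → M) :
    split d l g = split d l fun a c => sg (tdeg d a * tdeg d c) • g c a := by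
  induction l generalizing g with
  | nil => simp [split]
  | cons x l ih =>
    simp only [split]
    rw [ih]
    refine split_congr d fun a c _ => ?_
    simp only [smul_add, smul_smul, ← sg_add, tdeg_cons]
    rw [add_comm]
    congr 2
    · congr 1; ring
    · exact sg_congr ⟨-(d x * tdeg d a), by ring⟩

/-- Exchanging the first two factors of the iterated unshuffle coproduct. -/
lemma split_left_comm (l : List T) (g : List T → List T → List T → M) :
    split d l (fun a r => split d r fun b c => g a b c) =
      split d l fun b r => split d r fun a c => sg (tdeg d a * tdeg d b) • g a b c := by
  rw [split_assoc, split_assoc]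
  refine split_congr d fun r c _ => ?_
  rw [split_comm]
  exact split_congr d fun a b _ => by rw [mul_comm]

/-- Exchanging the outer two factors of the iterated unshuffle coproduct. -/
lemma split_outer_comm (l : List T) (g : List T → List T → List T → M) :
    split d l (fun u c => split d u fun a r => g a r c) =
      split d l fun u c => split d u fun a r =>
        sg (tdeg d a * tdeg d c + tdeg d a * tdeg d r + tdeg d r * tdeg d c) • g c r a := by
  rw [split_comm]
  have h : ∀ c u, (sg (tdeg d c * tdeg d u) • split d u fun a r => g a r c) =
      split d u fun r a => sg (tdeg d c * tdeg d a + tdeg d c * tdeg d r + tdeg d r * tdeg d a) •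
        g a r c := by
    intro c u
    rw [split_comm, ← split_zsmul]
    refine split_congr d fun r a hp => ?_
    rw [smul_smul, ← sg_add, ← tdeg_perm d hp, tdeg_append]
    congr 2; ring
  simp only [h]
  rw [split_assoc]

/-- Isolates the unshuffle with empty second part. It later separates the one-bracket from the
higher brackets. -/
lemma split_eq_add (l : List T) (g : List T → List T → M) :
    split d l g = g l [] + split d l fun a c => if c = [] then 0 else g a c := by
  induction l generalizing g with
  | nil => simp [split]
  | cons x l ih =>
    simp only [split]
    rw [split_add, ih, split_add, add_assoc]
    simp

lemma split_ite_nil (l : List T) (g : List T → List T → M) :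
    (split d l fun a c => if c = [] then g a c else 0) = g l [] := by
  rw [split_eq_add, if_pos rfl]
  have : (fun a c => if c = [] then (0 : M) else if c = [] then g a c else 0) = fun _ _ => 0 := by
    funext a c; split_ifs <;> rfl
  rw [this, split_zero, add_zero]

/-- Graded symmetry of a function of lists. -/
def GSymm (g : List T → M) : Prop :=
  ∀ l₁ u v l₂, g (l₁ ++ u :: v :: l₂) = sg (d u * d v) • g (l₁ ++ v :: u :: l₂)

variable {d}

lemma GSymm.cons {g : List T → M} (h : GSymm d g) (x : T) : GSymm d fun l => g (x :: l) :=
  fun l₁ u v l₂ => h (x :: l₁) u v l₂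

lemma GSymm.move {g : List T → M} (h : GSymm d g) (z : T) (l l' : List T) :
    g (l ++ z :: l') = sg (d z * tdeg d l) • g (z :: (l ++ l')) := by
  induction l generalizing g with
  | nil => simp
  | cons x l ih =>
    have := ih (h.cons x)
    simp only [List.cons_append] at this ⊢
    rw [this, show x :: z :: (l ++ l') = [] ++ x :: z :: (l ++ l') from rfl, h [], smul_smul,
      ← sg_add, tdeg_cons, mul_add, add_comm, mul_comm (d x)]
    rfl

/-- A graded symmetric pairing of sublists gives a graded symmetric sum over unshuffles. -/
lemma gsymm_split {g : List T → List T → M} (h₁ : ∀ c, GSymm d fun a => g a c)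
    (h₂ : ∀ a, GSymm d fun c => g a c) : GSymm d fun l => split d l g := by
  intro l₁
  induction l₁ generalizing g with
  | nil =>
    intro u v l₂
    simp only [List.nil_append, split, tdeg_cons]
    rw [← split_zsmul]
    refine split_congr d fun a c _ => ?_
    have e1 := h₁ c [] u v a
    have e2 := h₂ a [] u v c
    simp only [List.nil_append] at e1 e2
    -- Of the four placements of `u` and `v`, the two that keep them together use the symmetry of
    -- `g`, and the two that separate them trade places.
    simp only [e1, e2, smul_add, smul_smul, ← sg_add]
    have r1 : sg (d u * (d v + tdeg d a)) = sg (d u * d v + d u * tdeg d a) := by congr 1; ring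
    have r2 : sg (d u * d v + d v * (d u + tdeg d a)) = sg (d v * tdeg d a) :=
      sg_congr ⟨d u * d v, by ring⟩
    have r3 : sg (d v * tdeg d a + (d u * tdeg d a + d u * d v)) =
      sg (d u * d v + (d u * tdeg d a + d v * tdeg d a)) := by congr 1; ring
    rw [r1, r2, r3]; abel
  | cons x l₁ ih =>
    intro u v l₂
    simp only [List.cons_append, split]
    refine ih (g := fun a c => g (x :: a) c + sg (d x * tdeg d a) • g a (x :: c)) ?_ ?_ u v l₂
    · intro c l u v l'
      simp only
      have e1 := h₁ c (x :: l) u v l'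
      have e2 := h₁ (x :: c) l u v l'
      have e3 : tdeg d (l ++ u :: v :: l') = tdeg d (l ++ v :: u :: l') := by simp; ring
      simp only [List.cons_append] at e1 e2
      rw [e1, e2, e3, smul_add, smul_comm]
    · intro a l u v l'
      simp only
      have e1 := h₂ (x :: a) l u v l'
      have e2 := h₂ a (x :: l) u v l'
      simp only [List.cons_append] at e1 e2
      rw [e1, e2, smul_add, smul_comm]

end Split


/-! ### Signed sums over partitions of a list -/

section Partition

variable {T S M N : Type*} [AddCommGroup M] [AddCommGroup N]

/-- Sum over the set partitions of a list, with recursion depth bounded by the first argument. -/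
def partAux (d : T → ℤ) (e : List T → S) : ℕ → List T → (List S → M) → M
  | _, [], g => g []
  | 0, _ :: _, _ => 0
  | n + 1, x :: l, g => split d l fun a c => partAux d e n c fun v => g (e (x :: a) :: v)

/-- The sum of `± g [e l₁, …, e l_k]` over all partitions of a list into nonempty sublists, where
the blocks are ordered by their first elements. -/
def partSum (d : T → ℤ) (e : List T → S) (l : List T) (g : List S → M) : M :=
  partAux d e l.length l g

/-- The sum of `± g [e l₁, …, e l_k]` over all decompositions of a list into `k` sublists. -/
def blocks (d : T → ℤ) (e : List T → S) : ℕ → List T → (List S → M) → M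
  | 0, [], g => g []
  | 0, _ :: _, _ => 0
  | k + 1, l, g => split d l fun a c => blocks d e k c fun v => g (e a :: v)

variable (d : T → ℤ) (e : List T → S)

lemma length_le_of_perm_append {a c l : List T} (h : (a ++ c).Perm l) : c.length ≤ l.length := by
  have := h.length_eq
  rw [List.length_append] at this; omega

lemma partAux_stable {n m : ℕ} {l : List T} (hn : l.length ≤ n) (hm : l.length ≤ m)
    (g : List S → M) : partAux d e n l g = partAux d e m l g := by
  induction n generalizing m l g with
  | zero =>
    obtain rfl : l = [] := List.length_eq_zero_iff.1 (by omega)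
    cases m <;> rfl
  | succ n ih =>
    cases l with
    | nil => cases m <;> rfl
    | cons x l =>
      cases m with
      | zero => simp at hm
      | succ m =>
        simp only [List.length_cons, add_le_add_iff_right] at hn hm
        refine split_congr d fun a c hp => ih ?_ ?_ _
        · exact (length_le_of_perm_append hp).trans hn
        · exact (length_le_of_perm_append hp).trans hm

@[simp] lemma partSum_nil (g : List S → M) : partSum d e [] g = g [] := rfl

lemma partSum_cons (x : T) (l : List T) (g : List S → M) :
    partSum d e (x :: l) g =
      split d l fun a c => partSum d e c fun v => g (e (x :: a) :: v) := by
  refine split_congr d fun a c hp => ?_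
  exact partAux_stable d e (length_le_of_perm_append hp) le_rfl _

/-- Induction principle for statements about lists that recurse on unshuffled sublists. -/
lemma list_length_induction {p : List T → Prop}
    (h : ∀ l, (∀ l' : List T, l'.length < l.length → p l') → p l) (l : List T) : p l := by
  induction hn : l.length using Nat.strong_induction_on generalizing l with
  | _ n ih => exact h l fun l' hl' => ih _ (hn ▸ hl') l' rfl

lemma partSum_congr {d' : S → ℤ} (he : ∀ l, d' (e l) = tdeg d l) {l : List T} {g g' : List S → M}
    (h : ∀ v, tdeg d' v = tdeg d l → g v = g' v) : partSum d e l g = partSum d e l g' := by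
  induction l using list_length_induction generalizing g g' with
  | _ l ih =>
    cases l with
    | nil => exact h [] rfl
    | cons x l =>
      rw [partSum_cons, partSum_cons]
      refine split_congr d fun a c hp => ih c ?_ fun v hv => h _ ?_
      · exact Nat.lt_succ_of_le (length_le_of_perm_append hp)
      · rw [tdeg_cons, he, hv, tdeg_cons, tdeg_cons, ← tdeg_perm d hp, tdeg_append, add_assoc]

lemma map_partSum {F : Type*} [FunLike F M N] [AddMonoidHomClass F M N] (φ : F) (l : List T)
    (g : List S → M) : φ (partSum d e l g) = partSum d e l fun v => φ (g v) := by
  induction l using list_length_induction generalizing g with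
  | _ l ih =>
    cases l with
    | nil => rfl
    | cons x l =>
      rw [partSum_cons, partSum_cons, map_split]
      refine split_congr d fun a c hp => ih c ?_ _
      exact Nat.lt_succ_of_le (length_le_of_perm_append hp)

lemma partSum_zsmul (l : List T) (n : ℤ) (g : List S → M) :
    partSum d e l (fun v => n • g v) = n • partSum d e l g :=
  (map_partSum d e (DistribSMul.toAddMonoidHom M n) l g).symm

lemma partSum_add (l : List T) (g g' : List S → M) :
    partSum d e l (fun v => g v + g' v) = partSum d e l g + partSum d e l g' := by
  induction l using list_length_induction generalizing g g' with
  | _ l ih =>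
    cases l with
    | nil => rfl
    | cons x l =>
      rw [partSum_cons, partSum_cons, partSum_cons, ← split_add]
      refine split_congr d fun a c hp => ih c ?_ _ _
      exact Nat.lt_succ_of_le (length_le_of_perm_append hp)

lemma partSum_split_comm {T' : Type*} (d' : T' → ℤ) (l : List T) (l' : List T')
    (g : List S → List T' → List T' → M) :
    (partSum d e l fun v => split d' l' fun a c => g v a c) =
      split d' l' fun a c => partSum d e l fun v => g v a c := by
  induction l' generalizing g with
  | nil => rfl
  | cons x l' ih =>
    simp only [split, ih, partSum_add, partSum_zsmul]

/-- The sum over partitions is compatible with the unshuffle coproduct. -/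
lemma partSum_split {d' : S → ℤ} (he : ∀ l, d' (e l) = tdeg d l) (l : List T)
    (G : List S → List S → M) :
    partSum d e l (fun v => split d' v G) =
      split d l fun a c => partSum d e a fun v => partSum d e c fun w => G v w := by
  induction l using list_length_induction generalizing G with
  | _ l ih =>
    cases l with
    | nil => rfl
    | cons x l =>
      have h1 : partSum d e (x :: l) (fun v => split d' v G) =
          split d l fun a r => split d r fun b c =>
            (partSum d e b fun v => partSum d e c fun w => G (e (x :: a) :: v) w) +
            sg ((d x + tdeg d a) * tdeg d b) •
              (partSum d e b fun v => partSum d e c fun w => G v (e (x :: a) :: w)) := by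
        rw [partSum_cons]
        refine split_congr d fun a r hp => ?_
        simp only [split]
        rw [ih r (Nat.lt_succ_of_le (length_le_of_perm_append hp))]
        refine split_congr d fun b c _ => ?_
        have : (partSum d e b fun v => partSum d e c fun w => G (e (x :: a) :: v) w +
            sg (d' (e (x :: a)) * tdeg d' v) • G v (e (x :: a) :: w)) =
            partSum d e b fun v => (partSum d e c fun w => G (e (x :: a) :: v) w) +
              sg ((d x + tdeg d a) * tdeg d b) • partSum d e c fun w => G v (e (x :: a) :: w) :=
          partSum_congr d e he fun v hv => by
            rw [partSum_add, partSum_zsmul, hv, he, tdeg_cons]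
        rw [this, partSum_add, partSum_zsmul]
      rw [h1]
      simp only [split_add]
      -- The block of the first element lies in the left or in the right half. Coassociativity
      -- handles the former, exchanging the first two factors the latter.
      rw [split, split_add, split_assoc, split_left_comm]
      congr 1
      · refine split_congr d fun a c hp => ?_
        rw [partSum_cons]
      · refine split_congr d fun a c hp => ?_
        have : ∀ v, (partSum d e (x :: c) fun w => G v w) = split d c fun b r =>
          partSum d e r fun w => G v (e (x :: b) :: w) := fun v => partSum_cons d e x c _
        simp only [this]
        rw [partSum_split_comm, ← split_zsmul]
        refine split_congr d fun b r _ => ?_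
        rw [smul_smul, ← sg_add]
        congr 1
        exact sg_congr ⟨tdeg d a * tdeg d b, by ring⟩

end Partition

end LInfty

namespace LInfty

/-! ### Unordered partitions versus ordered decompositions -/

section Blocks

variable {T S M : Type*} [AddCommGroup M] (d : T → ℤ) (e : List T → S)

lemma map_blocks {N F : Type*} [AddCommGroup N] [FunLike F M N] [AddMonoidHomClass F M N] (φ : F)
    (k : ℕ) (l : List T) (g : List S → M) :
    φ (blocks d e k l g) = blocks d e k l fun v => φ (g v) := by
  induction k generalizing l g with
  | zero => cases l <;> simp [blocks]
  | succ k ih => simp only [blocks, map_split, ih]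

lemma blocks_zsmul (k : ℕ) (l : List T) (n : ℤ) (g : List S → M) :
    blocks d e k l (fun v => n • g v) = n • blocks d e k l g :=
  (map_blocks d e (DistribSMul.toAddMonoidHom M n) k l g).symm

lemma blocks_zero (k : ℕ) (l : List T) : blocks d e k l (fun _ => (0 : M)) = 0 := by
  induction k generalizing l with
  | zero => cases l <;> rfl
  | succ k ih => simp only [blocks, ih, split_zero]

/-- Pigeonhole: with more blocks than elements, some block is empty. -/
lemma blocks_eq_zero {g : List S → M} (hg : ∀ v w, g (v ++ e [] :: w) = 0) {k : ℕ} {l : List T}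
    (h : l.length < k) : blocks d e k l g = 0 := by
  induction k generalizing l g with
  | zero => simp at h
  | succ k ih =>
    rw [blocks, ← split_zero d l]
    refine split_congr d fun a c hp => ?_
    cases a with
    | nil =>
      rw [← blocks_zero d e k c]
      congr 1
      funext v
      exact hg [] v
    | cons x a =>
      refine ih (fun v w => hg (e (x :: a) :: v) w) ?_
      have := hp.length_eq
      simp only [List.length_append, List.length_cons] at this
      omega

/-- For graded symmetric summands, the block that contains the first element can be moved to the
first place. -/
lemma blocks_succ_cons {d' : S → ℤ} (he : ∀ l, d' (e l) = tdeg d l) {g : List S → M}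
    (hg : GSymm d' g) (k : ℕ) (z : T) (l : List T) :
    blocks d e (k + 1) (z :: l) g =
      (k + 1) • split d l fun a c => blocks d e k c fun v => g (e (z :: a) :: v) := by
  induction k generalizing l g with
  | zero =>
    simp [blocks, split]
  | succ k ih =>
    -- The factor `k + 2` splits as `1 + (k + 1)`: either `z` lies in the first block, or one of the
    -- other `k + 1` blocks contains it and is then commuted past the first.
    rw [blocks, split, split_add, add_smul, one_smul, add_comm]
    congr 1
    have h1 : ∀ a c, blocks d e (k + 1) (z :: c) (fun v => g (e a :: v)) =
        (k + 1) • sg (tdeg d a * d z) • split d c fun b c => sg (tdeg d a * tdeg d b) •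
          blocks d e k c fun v => g (e (z :: b) :: e a :: v) := by
      intro a c
      rw [ih (hg.cons (e a)), ← split_zsmul]
      congr 1
      refine split_congr d fun b c _ => ?_
      rw [smul_smul, ← sg_add, ← blocks_zsmul]
      congr 1
      funext v
      rw [← List.nil_append (e a :: _), hg, he, he, tdeg_cons, mul_add]
      rfl
    simp only [h1]
    have h2 : ∀ a c, (sg (d z * tdeg d a) • (k + 1) • sg (tdeg d a * d z) • split d c fun b c =>
        sg (tdeg d a * tdeg d b) • blocks d e k c fun v => g (e (z :: b) :: e a :: v)) =
        (k + 1) • split d c fun b c => sg (tdeg d a * tdeg d b) •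
          blocks d e k c fun v => g (e (z :: b) :: e a :: v) := by
      intro a c
      rw [smul_comm, smul_smul (sg _) (sg _), mul_comm (d z), sg_mul_self, one_smul]
    simp only [h2]
    rw [split_nsmul, split_left_comm]
    simp only [smul_smul, sg_mul_self, one_smul, blocks]

variable [Module ℂ M]

/-- The sum over all partitions in terms of ordered decompositions. -/
lemma partSum_eq_sum_blocks {d' : S → ℤ} (he : ∀ l, d' (e l) = tdeg d l) {g : List S → M}
    (hg : GSymm d' g) (hg0 : ∀ v w, g (v ++ e [] :: w) = 0) {n : ℕ} {l : List T}
    (hn : l.length ≤ n) :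
    partSum d e l g = ∑ k ∈ Finset.range (n + 1), ((k.factorial : ℂ)⁻¹) • blocks d e k l g := by
  induction n generalizing l g with
  | zero =>
    obtain rfl : l = [] := List.length_eq_zero_iff.1 (by omega)
    simp [blocks]
  | succ n ih =>
    cases l with
    | nil =>
      rw [Finset.sum_range_succ', Finset.sum_eq_zero]
      · simp [blocks]
      · intro k _
        rw [blocks_eq_zero d e hg0 (by simp), smul_zero]
    | cons z l =>
      rw [Finset.sum_range_succ', partSum_cons]
      simp only [blocks, smul_zero, add_zero]
      simp only [List.length_cons, add_le_add_iff_right] at hn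
      have : ∀ a c, (a ++ c).Perm l → (partSum d e c fun v => g (e (z :: a) :: v)) =
          ∑ k ∈ Finset.range (n + 1), ((k.factorial : ℂ)⁻¹) •
            blocks d e k c fun v => g (e (z :: a) :: v) := fun a c hp =>
        ih (hg.cons _) (fun v w => hg0 (_ :: v) w) ((length_le_of_perm_append hp).trans hn)
      rw [split_congr d this]
      rw [split_sum]
      refine Finset.sum_congr rfl fun k _ => ?_
      have h3 := blocks_succ_cons d e he hg k z l
      rw [blocks] at h3
      -- The `k + 1` possible positions of the block of `z` turn `1/(k+1)!` into `1/k!`.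
      rw [h3, ← Nat.cast_smul_eq_nsmul ℂ, smul_smul, Nat.factorial_succ]
      have h4 := map_split d (DistribSMul.toAddMonoidHom M ((k.factorial : ℂ)⁻¹)) l
        fun a c => blocks d e k c fun v => g (e (z :: a) :: v)
      simp only [DistribSMul.toAddMonoidHom_apply] at h4
      rw [← h4]
      congr 1
      have : (k : ℂ) + 1 ≠ 0 := by exact_mod_cast Nat.succ_ne_zero k
      have h5 : (k.factorial : ℂ) ≠ 0 := by exact_mod_cast k.factorial_ne_zero
      push_cast
      field_simp

end Blocks

/-! ### Lists and finite sequences -/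

section Lists

/-- The sublist of a sequence with positions in a finite set. -/
def sublist {T : Type*} {m : ℕ} (x : Fin m → T) (A : Finset (Fin m)) : List T :=
  ((List.finRange m).filter (· ∈ A)).map x

lemma sort_eq_filter {m : ℕ} (A : Finset (Fin m)) :
    A.sort = (List.finRange m).filter (· ∈ A) := by
  refine List.Perm.eq_of_pairwise (le := (· ≤ ·)) (fun a b _ _ h h' => le_antisymm h h')
    (Finset.pairwise_sort _ _) ?_ ?_
  · exact (List.pairwise_le_finRange m).filter _
  · rw [List.perm_ext_iff_of_nodup (Finset.sort_nodup _ _) ((List.nodup_finRange m).filter _)]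
    simp

lemma sublist_eq_ofFn {T : Type*} {m : ℕ} (x : Fin m → T) (A : Finset (Fin m)) :
    sublist x A = List.ofFn (sub x A) := by
  rw [sublist, ← sort_eq_filter]
  refine List.ext_getElem (by simp) fun i h1 h2 => ?_
  simp [sub, Finset.orderEmbOfFin_apply]

variable {V W : Type*} [AddCommGroup V] [Module ℂ V] [AddCommGroup W] [Module ℂ W]

/-- Evaluation of a family of multilinear maps on a list. -/
def ev (E : Multi V W) (l : List V) : W := E l.length l.get

/-- Changes the arity along an equation of lengths without any transport of `E`. -/
lemma ev_eq (E : Multi V W) {n : ℕ} {l : List V} (h : l.length = n) {y : Fin n → V}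
    (hy : ∀ i : Fin n, l[i] = y i) : ev E l = E n y := by
  subst h
  exact congrArg _ (funext hy)

lemma ev_ofFn (E : Multi V W) {n : ℕ} (y : Fin n → V) : ev E (List.ofFn y) = E n y :=
  ev_eq E (by simp) (by simp)

lemma ev_eq_zero (E : Multi V W) {l : List V} (h : (0 : V) ∈ l) : ev E l = 0 := by
  obtain ⟨i, hi⟩ := List.get_of_mem h
  exact (E l.length).map_coord_zero i hi

lemma ev_cons_add (E : Multi V W) (x y : V) (l : List V) :
    ev E ((x + y) :: l) = ev E (x :: l) + ev E (y :: l) := by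
  have h : ∀ z, ev E (z :: l) = E (l.length + 1) (Fin.cons z l.get) := fun z =>
    ev_eq E rfl fun i => by refine Fin.cases ?_ (fun j => ?_) i <;> simp
  simp only [h, MultilinearMap.cons_add]

lemma ev_cons_smul (E : Multi V W) (c : ℂ) (x : V) (l : List V) :
    ev E ((c • x) :: l) = c • ev E (x :: l) := by
  have h : ∀ z, ev E (z :: l) = E (l.length + 1) (Fin.cons z l.get) := fun z =>
    ev_eq E rfl fun i => by refine Fin.cases ?_ (fun j => ?_) i <;> simp
  simp only [h, MultilinearMap.cons_smul]

lemma ev_sublist (E : Multi V W) {m : ℕ} (x : Fin m → V) (A : Finset (Fin m)) :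
    ev E (sublist x A) = E A.card (sub x A) := by
  rw [sublist_eq_ofFn, ev_ofFn]

end Lists

end LInfty

namespace LInfty

/-! ### Koszul-signed sums over functions as recursive sums over lists -/

section Fibers

variable {T M : Type*} [AddCommGroup M] {ι : Type*} [LinearOrder ι] [Fintype ι]

/-- The sum over all assignments of the elements of a list to blocks labelled by `ι`. -/
def fiberSum (d : T → ℤ) : List T → ((ι → List T) → M) → M
  | [], G => G fun _ => []
  | x :: l, G => ∑ a, fiberSum d l fun B =>
      sg (d x * ∑ b with b < a, tdeg d (B b)) • G (Function.update B a (x :: B a))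

/-- The sublist of a sequence where `f` takes the value `a`. -/
def fiberList {m : ℕ} (x : Fin m → T) (f : Fin m → ι) (a : ι) : List T :=
  sublist x (Finset.univ.filter (f · = a))

omit [Fintype ι] in
lemma koszul_succ {m : ℕ} (f : Fin (m + 1) → ι) (p : Fin (m + 1) → ℤ) :
    koszul f p = sg (p 0 * ∑ j with f (Fin.succ j) < f 0, p (Fin.succ j)) *
      koszul (fun i => f i.succ) (fun i => p i.succ) := by
  unfold koszul
  rw [Fin.prod_univ_succ]
  congr 1
  · rw [Fin.prod_univ_succ, Finset.mul_sum, sg_sum, Finset.prod_filter]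
    simp [sg]
  · refine Finset.prod_congr rfl fun i _ => ?_
    rw [Fin.prod_univ_succ]
    simp

omit [Fintype ι] in
lemma fiberList_succ {m : ℕ} (x : Fin (m + 1) → T) (f : Fin (m + 1) → ι) :
    fiberList x f = Function.update (fiberList (fun i => x i.succ) fun i => f i.succ) (f 0)
      (x 0 :: fiberList (fun i => x i.succ) (fun i => f i.succ) (f 0)) := by
  funext a
  have h : fiberList x f a = (if f 0 = a then [x 0] else []) ++
      fiberList (fun i => x i.succ) (fun i => f i.succ) a := by
    simp only [fiberList, sublist, List.finRange_succ, List.filter_cons, List.filter_map]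
    split_ifs with h1 h2 h2 <;> simp_all [Function.comp_def]
  rw [h]
  by_cases ha : f 0 = a
  · subst ha; simp
  · rw [Function.update_of_ne (Ne.symm ha)]; simp [ha]

lemma sum_tdeg_fiberList (d : T → ℤ) {m : ℕ} (x : Fin m → T) (f : Fin m → ι) (q : ι → Prop)
    [DecidablePred q] :
    ∑ b with q b, tdeg d (fiberList x f b) = ∑ j with q (f j), d (x j) := by
  have h : ∀ b, tdeg d (fiberList x f b) = ∑ j with f j = b, d (x j) := by
    intro b
    rw [fiberList, sublist, tdeg, ← sort_eq_filter, List.map_map, ← List.sum_toFinset]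
    · simp
    · exact Finset.sort_nodup _ _
  simp only [h]
  rw [Finset.sum_comm' (t' := Finset.univ.filter fun j => q (f j)) (s' := fun j => {f j})]
  · simp
  · intro b j; simp only [Finset.mem_filter, Finset.mem_univ, true_and, Finset.mem_singleton]
    constructor
    · rintro ⟨h1, rfl⟩; exact ⟨rfl, h1⟩
    · rintro ⟨rfl, h1⟩; exact ⟨h1, rfl⟩

lemma fiberSum_add (d : T → ℤ) (l : List T) (G G' : (ι → List T) → M) :
    fiberSum d l (fun B => G B + G' B) = fiberSum d l G + fiberSum d l G' := by
  induction l generalizing G G' with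
  | nil => rfl
  | cons x l ih => simp only [fiberSum, smul_add, ih, Finset.sum_add_distrib]

lemma fiberSum_zsmul (d : T → ℤ) (l : List T) (n : ℤ) (G : (ι → List T) → M) :
    fiberSum d l (fun B => n • G B) = n • fiberSum d l G := by
  induction l generalizing G with
  | nil => rfl
  | cons x l ih =>
    simp only [fiberSum, Finset.smul_sum]
    refine Finset.sum_congr rfl fun a _ => ?_
    rw [← ih]
    simp only [smul_comm n]

/-- The inversions that involve position `0` split off from the Koszul sign, and this factor is the
one in the recursion for `fiberSum`. -/
lemma sum_koszul_eq_fiberSum (d : T → ℤ) {m : ℕ} (x : Fin m → T) (G : (ι → List T) → M) :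
    ∑ f : Fin m → ι, koszul f (fun i => d (x i)) • G (fiberList x f) =
      fiberSum d (List.ofFn x) G := by
  induction m generalizing G with
  | zero =>
    rw [Fintype.sum_unique]
    simp only [koszul, fiberSum, Finset.univ_eq_empty, Finset.prod_empty, one_smul, List.ofFn_zero]
    rfl
  | succ m ih =>
    rw [List.ofFn_succ, fiberSum, ← (Fin.consEquiv fun _ => ι).sum_comp, Fintype.sum_prod_type]
    refine Finset.sum_congr rfl fun a _ => ?_
    rw [← ih]
    refine Finset.sum_congr rfl fun f _ => ?_
    change koszul (Fin.cons a f : Fin (m + 1) → ι) _ • G (fiberList x (Fin.cons a f)) = _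
    rw [koszul_succ, fiberList_succ, mul_comm, mul_smul]
    simp only [Fin.cons_zero, Fin.cons_succ]
    rw [sum_tdeg_fiberList d (fun i => x i.succ) f (· < a)]

/-- Sums over decompositions into two blocks are sums over unshuffles. -/
lemma fiberSum_bool (d : T → ℤ) (l : List T) (g : List T → List T → M) :
    fiberSum d l (fun B : Bool → List T => g (B false) (B true)) = split d l g := by
  induction l generalizing g with
  | nil => rfl
  | cons x l ih =>
    rw [fiberSum, split, ← ih, Fintype.sum_bool, ← fiberSum_add]
    congr 1
    funext B
    rw [add_comm]
    congr 1
    · have h : ¬true < false := by decide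
      simp [Finset.sum_filter, h]
    · simp [Finset.sum_filter]

/-- Splitting off the first block. -/
lemma fiberSum_succ (d : T → ℤ) (k : ℕ) (l : List T) (G : (Fin (k + 1) → List T) → M) :
    fiberSum d l G = split d l fun a c => fiberSum d c fun B => G (Fin.cons a B) := by
  induction l generalizing G with
  | nil =>
    simp only [fiberSum, split]
    congr 1
    funext i; refine Fin.cases ?_ (fun j => ?_) i <;> simp
  | cons x l ih =>
    rw [fiberSum, Fin.sum_univ_succ, split, split_add]
    congr 1
    · rw [ih]
      simp
    · simp only [ih, fiberSum, Finset.smul_sum]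
      rw [split_sum]
      refine Finset.sum_congr rfl fun a _ => ?_
      refine split_congr d fun b c _ => ?_
      rw [← fiberSum_zsmul]
      congr 1
      funext B
      have h1 : (∑ i with i < a.succ, tdeg d ((Fin.cons b B : Fin (k + 1) → List T) i)) =
          tdeg d b + ∑ i with i < a, tdeg d (B i) := by
        rw [Finset.sum_filter, Fin.sum_univ_succ, Finset.sum_filter]
        simp
      rw [h1, smul_smul, ← sg_add, mul_add, Fin.cons_update]
      simp

end Fibers

/-! ### Translation of `insertSum` and `blockSum` into list sums -/

section Conversions

variable {T : Type*} (d : T → ℤ) {V W : Type*} [AddCommGroup V] [Module ℂ V] [AddCommGroup W]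
  [Module ℂ W]

lemma insertSum_eq_split (E : Multi V W) (b : Multi V V) (v : T → V) {m : ℕ} (x : Fin m → T) :
    insertSum E b (fun i => d (x i)) (fun i => v (x i)) =
      split d (List.ofFn x) fun a c => ev E (ev b (a.map v) :: c.map v) := by
  rw [← fiberSum_bool, ← sum_koszul_eq_fiberSum, insertSum]
  -- Members of `A` get the smaller label `false`, because the arguments of the inner bracket come
  -- first.
  let eqv : Finset (Fin m) ≃ (Fin m → Bool) :=
    { toFun := fun A i => decide (i ∉ A)
      invFun := fun f => Finset.univ.filter fun i => f i = false
      left_inv := fun A => by ext i; simp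
      right_inv := fun f => by funext i; simp }
  refine Fintype.sum_equiv eqv _ _ fun A => ?_
  congr 1
  · unfold koszul
    refine Finset.prod_congr rfl fun i _ => Finset.prod_congr rfl fun j _ => ?_
    congr 1
    simp only [eqv, Equiv.coe_fn_mk]
    by_cases hi : i ∈ A <;> by_cases hj : j ∈ A <;> simp [hi, hj]
  · have h1 : (fiberList x (eqv A) false).map v = sublist (fun i => v (x i)) A := by
      simp [fiberList, sublist, eqv, Function.comp_def]
    have h2 : (fiberList x (eqv A) true).map v = sublist (fun i => v (x i)) Aᶜ := by
      simp [fiberList, sublist, eqv, Function.comp_def]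
    rw [h1, h2, ev_sublist]
    symm
    refine ev_eq E (by simp [sublist_eq_ofFn]) fun i => ?_
    refine Fin.cases ?_ (fun j => ?_) i
    · simp
    · simp [sublist_eq_ofFn]

lemma fiberSum_eq_blocks {M : Type*} [AddCommGroup M] {S : Type*} (e : List T → S) (k : ℕ)
    (l : List T) (g : List S → M) :
    (fiberSum d l fun B : Fin k → List T => g (List.ofFn fun a => e (B a))) =
      blocks d e k l g := by
  induction k generalizing l g with
  | zero => cases l <;> simp [fiberSum, blocks]
  | succ k ih =>
    rw [fiberSum_succ, blocks]
    refine split_congr d fun a c _ => ?_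
    rw [← ih]
    simp

lemma blockSum_eq_blocks (b : Multi W W) (E : Multi V W) (hE : E 0 = 0) (v : T → V) {S : Type*}
    (s : S → W) (e : List T → S) (r : ℕ) {m : ℕ} (x : Fin m → T)
    (he : ∀ l, s (e l) = ev E (l.map v)) :
    blockSum b E r (fun i => d (x i)) (fun i => v (x i)) =
      ∑ k ∈ Finset.Icc r m, ((k.factorial : ℂ)⁻¹) •
        blocks d e k (List.ofFn x) fun w => ev b (w.map s) := by
  refine Finset.sum_congr rfl fun k _ => ?_
  congr 1
  rw [← fiberSum_eq_blocks, ← sum_koszul_eq_fiberSum, Finset.sum_filter]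
  refine Finset.sum_congr rfl fun f _ => ?_
  have h1 : ∀ a, s (e (fiberList x f a)) =
      E (Finset.univ.filter (f · = a)).card (sub (fun i => v (x i)) (Finset.univ.filter (f · = a))) := by
    intro a
    rw [he, ← ev_sublist]
    simp [fiberList, sublist, Function.comp_def]
  have h2 : ev b ((List.ofFn fun a => e (fiberList x f a)).map s) =
      b k fun a => s (e (fiberList x f a)) := by
    rw [List.map_ofFn, ev_ofFn]; rfl
  rw [h2]
  split_ifs with hf
  · simp only [h1]
  -- A decomposition that misses a label has an empty block, on which `E` vanishes, so the
  -- restriction to surjections can be dropped.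
  · obtain ⟨a, ha⟩ := not_forall.1 hf
    rw [(b k).map_coord_zero a, smul_zero]
    have : fiberList x f a = [] := by
      simp only [fiberList, sublist, List.map_eq_nil_iff, List.filter_eq_nil_iff]
      intro i _
      have := not_exists.1 ha i
      simpa using this
    rw [he, this]
    exact DFunLike.congr_fun hE _

end Conversions

end LInfty

namespace LInfty

/-! ### Koszul signs of permutations -/

section Koszul

lemma prod_prod_eq_prod_lt {m : ℕ} (F : Fin m → Fin m → ℤ) (h : ∀ i, F i i = 1) :
    ∏ i, ∏ j, F i j = ∏ i, ∏ j, if i < j then F i j * F j i else 1 := by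
  have h1 : ∀ i j, F i j = (if i < j then F i j else 1) * if j < i then F i j else 1 := by
    intro i j
    rcases lt_trichotomy i j with hij | rfl | hij
    · simp [hij, hij.not_gt]
    · simp [h]
    · simp [hij, hij.not_gt]
  calc ∏ i, ∏ j, F i j
      = (∏ i, ∏ j, if i < j then F i j else 1) * ∏ i, ∏ j, if j < i then F i j else 1 := by
        rw [← Finset.prod_mul_distrib]
        refine Finset.prod_congr rfl fun i _ => ?_
        rw [← Finset.prod_mul_distrib]
        exact Finset.prod_congr rfl fun j _ => h1 i j
    _ = (∏ i, ∏ j, if i < j then F i j else 1) * ∏ i, ∏ j, if i < j then F j i else 1 := by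
        rw [Finset.prod_comm (f := fun i j => if j < i then F i j else 1)]
    _ = _ := by
        rw [← Finset.prod_mul_distrib]
        refine Finset.prod_congr rfl fun i _ => ?_
        rw [← Finset.prod_mul_distrib]
        refine Finset.prod_congr rfl fun j _ => ?_
        split_ifs <;> simp

/-- The cocycle property holds separately for each unordered pair: a composite inverts the pair
exactly when one of its factors does and the other does not, and two inversions cancel since signs
square to one. -/
lemma koszul_mul {m : ℕ} (σ τ : Equiv.Perm (Fin m)) (p : Fin m → ℤ) :
    koszul (σ * τ).symm p = koszul τ.symm (fun i => p (σ i)) * koszul σ.symm p := by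
  have h1 : koszul τ.symm (fun i => p (σ i)) = ∏ i, ∏ j,
      if σ.symm i < σ.symm j ∧ τ.symm (σ.symm j) < τ.symm (σ.symm i) then sg (p i * p j) else 1 := by
    rw [koszul, ← σ.symm.prod_comp]
    refine Finset.prod_congr rfl fun i _ => ?_
    rw [← σ.symm.prod_comp]
    simp [sg]
  rw [h1]
  unfold koszul
  rw [← Finset.prod_mul_distrib]
  simp only [← Finset.prod_mul_distrib, sg_def]
  rw [prod_prod_eq_prod_lt _ (by simp), prod_prod_eq_prod_lt (fun i j => _ * _) (by simp)]
  refine Finset.prod_congr rfl fun i _ => Finset.prod_congr rfl fun j _ => ?_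
  by_cases hij : i < j
  · rw [if_pos hij, if_pos hij]
    have e1 : ∀ k, (σ * τ).symm k = τ.symm (σ.symm k) := fun k => rfl
    have e2 := sg_mul_self (p i * p j)
    have hne : i ≠ j := hij.ne
    have hb : τ.symm (σ.symm i) ≠ τ.symm (σ.symm j) := by simpa using hne
    have ha : σ.symm i ≠ σ.symm j := by simpa using hne
    simp only [e1, hij, hij.not_gt, true_and, false_and, if_false, mul_one, mul_comm (p j)]
    rcases lt_or_gt_of_ne ha with ha | ha <;> rcases lt_or_gt_of_ne hb with hb | hb <;>
      simp [ha, hb, ha.not_gt, hb.not_gt, e2]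
  · rw [if_neg hij, if_neg hij]

lemma koszul_swap {m : ℕ} {i j : Fin m} (hij : (j : ℕ) = i + 1) (p : Fin m → ℤ) :
    koszul (Equiv.swap i j) p = sg (p i * p j) := by
  unfold koszul
  have h : ∀ a b, (a < b ∧ Equiv.swap i j b < Equiv.swap i j a) ↔ a = i ∧ b = j := by
    intro a b
    simp only [Equiv.swap_apply_def]
    split_ifs with h1 h2 h3 h4 h5 h6 h7 h8 <;> simp only [Fin.ext_iff, Fin.lt_def] at * <;> omega
  simp only [h]
  rw [Finset.prod_eq_single i, Finset.prod_eq_single j]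
  · simp [sg]
  · intro b _ hb; simp [hb]
  · simp
  · intro a _ ha; simp [ha]
  · simp

variable {T M : Type*} [AddCommGroup M] (d : T → ℤ)

/-- Graded symmetry under all permutations follows from graded symmetry under transpositions of
neighbours. -/
lemma GSymm.perm {d : T → ℤ} {g : List T → M} (hg : GSymm d g) {m : ℕ} (x : Fin m → T)
    (σ : Equiv.Perm (Fin m)) :
    g (List.ofFn fun i => x (σ i)) = koszul σ.symm (fun i => d (x i)) • g (List.ofFn x) := by
  cases m with
  | zero => simp [koszul]
  | succ m =>
    -- Transpositions of neighbours generate the symmetric group even as a monoid, so no inverses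
    -- have to be treated.
    have hσ : σ ∈ Submonoid.closure
        (Set.range fun i : Fin m => Equiv.swap i.castSucc i.succ) := by
      rw [Equiv.Perm.mclosure_swap_castSucc_succ]; trivial
    induction hσ using Submonoid.closure_induction generalizing x with
    | mem σ h =>
      obtain ⟨i, rfl⟩ := h
      rw [Equiv.symm_swap, koszul_swap (by simp)]
      have h1 : ∀ y : Fin (m + 1) → T, List.ofFn y = (List.ofFn y).take i ++
          y i.castSucc :: y i.succ :: (List.ofFn y).drop (i + 2) := by
        intro y
        conv_lhs => rw [← List.take_append_drop i (List.ofFn y)]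
        congr 1
        rw [List.drop_eq_getElem_cons (by simp), List.drop_eq_getElem_cons (by simp)]
        simp only [List.getElem_ofFn]
        rfl
      rw [h1 x, h1 fun k => x (Equiv.swap i.castSucc i.succ k), mul_comm, ← hg,
        Equiv.swap_apply_left, Equiv.swap_apply_right]
      have h2 : ∀ k : ℕ, ∀ hk : k < m + 1, k ≠ i → k ≠ i + 1 →
          Equiv.swap i.castSucc i.succ ⟨k, hk⟩ = ⟨k, hk⟩ := fun k hk h h' =>
        Equiv.swap_apply_of_ne_of_ne (by simpa [Fin.ext_iff] using h)
          (by simpa [Fin.ext_iff] using h')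
      congr 2
      · refine List.ext_getElem (by simp) fun k hk _ => ?_
        simp only [List.length_take, List.length_ofFn, lt_inf_iff] at hk
        simp only [List.getElem_take, List.getElem_ofFn]
        rw [h2 k _ (by omega) (by omega)]
      · congr 2
        refine List.ext_getElem (by simp) fun k hk _ => ?_
        simp only [List.getElem_drop, List.getElem_ofFn]
        rw [h2 _ _ (by omega) (by omega)]
    | one =>
      have : koszul (1 : Equiv.Perm (Fin (m + 1))).symm (fun i => d (x i)) = 1 := by
        unfold koszul
        refine Finset.prod_eq_one fun i _ => Finset.prod_eq_one fun j _ => ?_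
        rw [if_neg]
        rintro ⟨h1, h2⟩
        exact absurd h1 (not_lt.2 h2.le)
      rw [this, one_smul]; rfl
    | mul σ τ _ _ hσ hτ =>
      have h := hτ fun i => x (σ i)
      rw [hσ, smul_smul, ← koszul_mul σ τ fun i => d (x i)] at h
      exact h

lemma GSymm.of_perm {d : T → ℤ} {g : List T → M}
    (h : ∀ (m : ℕ) (x : Fin m → T) (σ : Equiv.Perm (Fin m)), g (List.ofFn fun i => x (σ i)) =
      koszul σ.symm (fun i => d (x i)) • g (List.ofFn x)) : GSymm d g := by
  intro l₁ u v l₂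
  have hi : l₁.length < (l₁ ++ v :: u :: l₂).length := by simp
  have hj : l₁.length + 1 < (l₁ ++ v :: u :: l₂).length := by simp
  have := h (l₁ ++ v :: u :: l₂).length (l₁ ++ v :: u :: l₂).get (Equiv.swap ⟨_, hi⟩ ⟨_, hj⟩)
  rw [Equiv.symm_swap, koszul_swap (by simp)] at this
  simp only [List.ofFn_get] at this
  rw [mul_comm]
  convert this using 2
  · refine List.ext_getElem (by simp; omega) fun k h1 h2 => ?_
    rw [List.getElem_ofFn]
    simp only [List.get_eq_getElem, Equiv.swap_apply_def, Fin.ext_iff]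
    split_ifs with h3 h4
    · subst h3; simp
    · subst h4; simp
    · simp only [List.getElem_append]
      split_ifs with h5
      · rfl
      · obtain ⟨n, rfl⟩ : ∃ n, k = l₁.length + (n + 2) := ⟨k - l₁.length - 2, by omega⟩
        simp
  · simp

end Koszul

/-! ### Homogeneous elements -/

/-- Homogeneous elements of a graded vector space. -/
structure HomogElem {V : Type*} [AddCommGroup V] [Module ℂ V] (𝒱 : ℤ → Submodule ℂ V) where
  deg : ℤ
  val : V
  mem : val ∈ 𝒱 deg

section Homog

variable {V W : Type*} [AddCommGroup V] [Module ℂ V] [AddCommGroup W] [Module ℂ W]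
  {𝒱 : ℤ → Submodule ℂ V} {𝒲 : ℤ → Submodule ℂ W}

/-- A homogeneous sequence as a sequence of homogeneous elements. -/
def Homog.elem {m : ℕ} {p : Fin m → ℤ} {x : Fin m → V} (h : Homog 𝒱 p x) (i : Fin m) :
    HomogElem 𝒱 := ⟨p i, x i, h i⟩

/-- The family `E` is graded symmetric and vanishes without arguments. -/
def IsGSymm (𝒱 : ℤ → Submodule ℂ V) (E : Multi V W) : Prop :=
  GSymm (HomogElem.deg (𝒱 := 𝒱)) fun l => ev E (l.map HomogElem.val)

lemma isGSymm_iff {E : Multi V W} : IsGSymm 𝒱 E ↔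
    ∀ (m : ℕ) (p : Fin m → ℤ) (x : Fin m → V) (σ : Equiv.Perm (Fin m)), Homog 𝒱 p x →
      E m (x ∘ σ) = koszul σ.symm p • E m x := by
  constructor
  · intro h m p x σ hx
    have := GSymm.perm h hx.elem σ
    simp only [List.map_ofFn, ev_ofFn] at this
    exact this
  · intro h
    refine GSymm.of_perm fun m x σ => ?_
    simp only [List.map_ofFn, ev_ofFn]
    exact h m (fun i => (x i).deg) (fun i => (x i).val) σ fun i => (x i).mem

/-- The family `E` shifts the total degree by `c`. -/
def HasDegree (𝒱 : ℤ → Submodule ℂ V) (𝒲 : ℤ → Submodule ℂ W) (c : ℤ) (E : Multi V W) : Prop :=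
  ∀ l : List (HomogElem 𝒱), ev E (l.map HomogElem.val) ∈ 𝒲 (tdeg HomogElem.deg l + c)

lemma hasDegree_iff {c : ℤ} {E : Multi V W} : HasDegree 𝒱 𝒲 c E ↔
    ∀ (m : ℕ) (p : Fin m → ℤ) (x : Fin m → V), Homog 𝒱 p x → E m x ∈ 𝒲 (∑ i, p i + c) := by
  constructor
  · intro h m p x hx
    have := h (List.ofFn hx.elem)
    rw [List.map_ofFn, ev_ofFn, tdeg, List.map_ofFn, List.sum_ofFn] at this
    exact this
  · intro h l
    have := h l.length (fun i => (l.get i).deg) (fun i => (l.get i).val) fun i => (l.get i).mem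
    rw [ev_eq E (l := l.map HomogElem.val) (n := l.length) (y := fun i => (l.get i).val) (by simp)
      (by simp)]
    convert this using 3
    rw [tdeg, ← Fin.sum_univ_fun_getElem]
    rfl

/-- A family of maps of degree `0`, evaluated on a list of homogeneous elements. -/
def HasDegree.elem {E : Multi V W} (h : HasDegree 𝒱 𝒲 0 E) (l : List (HomogElem 𝒱)) :
    HomogElem 𝒲 :=
  ⟨tdeg HomogElem.deg l, ev E (l.map HomogElem.val), by simpa using h l⟩

end Homog

end LInfty

namespace LInfty

/-! ### Multilinear solution of the transfer recursion -/

noncomputable section Multilinear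

variable {V W Z : Type*} [AddCommGroup V] [Module ℂ V] [AddCommGroup W] [Module ℂ W]
  [AddCommGroup Z] [Module ℂ Z]

omit [AddCommGroup V] [Module ℂ V] in
lemma sub_update {m : ℕ} (x : Fin m → V) (A : Finset (Fin m)) (j : Fin A.card) (v : V) :
    sub (Function.update x (A.orderEmbOfFin rfl j) v) A = Function.update (sub x A) j v := by
  have := Function.update_comp_eq_of_injective x (A.orderEmbOfFin rfl).injective j v
  exact this

omit [AddCommGroup V] [Module ℂ V] in
lemma sub_update_of_notMem {m : ℕ} (x : Fin m → V) {A : Finset (Fin m)} {i : Fin m} (hi : i ∉ A)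
    (v : V) : sub (Function.update x i v) A = sub x A := by
  funext j
  refine Function.update_of_ne ?_ _ _
  rintro rfl
  exact hi (Finset.orderEmbOfFin_mem A rfl j)

/-- Each argument occurs in one slot of one block, which is what makes a single term of `blockSum`
multilinear. -/
lemma fiberEval_update (E : Multi V W) {m k : ℕ} (f : Fin m → Fin k) (x : Fin m → V) (i : Fin m) :
    ∃ j : Fin (Finset.univ.filter (f · = f i)).card, ∀ v,
      (fun a => E (Finset.univ.filter (f · = a)).card
        (sub (Function.update x i v) (Finset.univ.filter (f · = a)))) =
      Function.update
        (fun a => E (Finset.univ.filter (f · = a)).card (sub x (Finset.univ.filter (f · = a))))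
        (f i) (E _ (Function.update (sub x (Finset.univ.filter (f · = f i))) j v)) := by
  have hi : i ∈ Finset.univ.filter (f · = f i) := by simp
  obtain ⟨j, hj⟩ : ∃ j, (Finset.univ.filter (f · = f i)).orderEmbOfFin rfl j = i := by
    have := Finset.range_orderEmbOfFin (Finset.univ.filter (f · = f i)) rfl
    have h2 : i ∈ Set.range _ := this.symm ▸ Finset.mem_coe.2 hi
    exact h2
  refine ⟨j, fun v => funext fun a => ?_⟩
  by_cases ha : a = f i
  · subst ha
    rw [Function.update_self, ← sub_update, hj]
  · rw [Function.update_of_ne ha, sub_update_of_notMem]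
    simpa using Ne.symm ha

/-- The term of `blockSum` that belongs to one decomposition, as a multilinear map. -/
def fiberMulti (b : Multi W W) (E : Multi V W) {m k : ℕ} (f : Fin m → Fin k) :
    MultilinearMap ℂ (fun _ : Fin m => V) W where
  toFun x := b k fun a =>
    E (Finset.univ.filter (f · = a)).card (sub x (Finset.univ.filter (f · = a)))
  map_update_add' := by
    intro inst x i v w
    obtain rfl : inst = instDecidableEqFin m := Subsingleton.elim _ _
    obtain ⟨j, hj⟩ := fiberEval_update E f x i
    simp only [hj, MultilinearMap.map_update_add]
  map_update_smul' := by
    intro inst x i c v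
    obtain rfl : inst = instDecidableEqFin m := Subsingleton.elim _ _
    obtain ⟨j, hj⟩ := fiberEval_update E f x i
    simp only [hj, MultilinearMap.map_update_smul]

/-- `blockSum` as a multilinear map. -/
def blockMulti (b : Multi W W) (E : Multi V W) (r : ℕ) {m : ℕ} (p : Fin m → ℤ) :
    MultilinearMap ℂ (fun _ : Fin m => V) W :=
  ∑ k ∈ Finset.Icc r m, ((k.factorial : ℂ)⁻¹) •
    ∑ f : Fin m → Fin k with Function.Surjective f, koszul f p • fiberMulti b E f

lemma blockMulti_apply (b : Multi W W) (E : Multi V W) (r : ℕ) {m : ℕ} (p : Fin m → ℤ)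
    (x : Fin m → V) : blockMulti b E r p x = blockSum b E r p x := by
  simp only [blockMulti, blockSum, _root_.sum_apply, _root_.smul_apply]
  rfl

/-- With at least two nonempty blocks every block is proper, so only arities below `m` enter. This
makes the equation for `E` a recursion. -/
lemma blockSum_congr (b : Multi W W) {E E' : Multi V W} {r m : ℕ} (hr : 2 ≤ r)
    (h : ∀ j < m, E j = E' j) (p : Fin m → ℤ) (x : Fin m → V) :
    blockSum b E r p x = blockSum b E' r p x := by
  unfold blockSum
  refine Finset.sum_congr rfl fun k hk => ?_
  congr 1
  refine Finset.sum_congr rfl fun f hf => ?_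
  congr 2
  funext a
  rw [h]
  have hf' : Function.Surjective f := by simpa using hf
  have hk' : 2 ≤ k := hr.trans (Finset.mem_Icc.1 hk).1
  obtain ⟨c, hc⟩ : ∃ c : Fin k, c ≠ a := by
    have : Nontrivial (Fin k) := Fin.nontrivial_iff_two_le.2 hk'
    exact exists_ne a
  obtain ⟨i, rfl⟩ := hf' c
  have : (Finset.univ.filter (f · = a)).card < (Finset.univ : Finset (Fin m)).card := by
    refine Finset.card_lt_card (Finset.filter_ssubset.2 ⟨i, by simp, hc⟩)
  simpa using this

lemma koszul_congr {m : ℕ} {ι : Type*} [LinearOrder ι] (f : Fin m → ι) {p q : Fin m → ℤ}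
    (h : ∀ i, Even (p i - q i)) : koszul f p = koszul f q := by
  unfold koszul
  refine Finset.prod_congr rfl fun i _ => Finset.prod_congr rfl fun j _ => ?_
  simp only [sg_def]
  split_ifs
  · refine sg_congr ?_
    have : p i * p j - q i * q j = (p i - q i) * p j + q i * (p j - q j) := by ring
    rw [this]
    exact ((h i).mul_right _).add ((h j).mul_left _)
  · rfl

/-- A degree that represents a parity. -/
def parDeg (ε : Bool) : ℤ := if ε then 1 else 0

/-- A family of projectors onto the even and the odd part. -/
def IsParityProj (𝒱 : ℤ → Submodule ℂ V) (pr : Bool → V →ₗ[ℂ] V) : Prop :=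
  ∀ p, ∀ x ∈ 𝒱 p, ∀ ε, pr ε x = if Even (p - parDeg ε) then x else 0

/-- `blockSum` needs degrees for its signs, whereas a multilinear map takes arbitrary vectors. Since
the signs see only parities, it suffices to split each argument into an even and an odd part, and
the extension is a finite sum. -/
lemma exists_isParityProj {𝒱 : ℤ → Submodule ℂ V} (h : DirectSum.IsInternal 𝒱) :
    ∃ pr : Bool → V →ₗ[ℂ] V, IsParityProj 𝒱 pr := by
  classical
  let e := LinearEquiv.ofBijective (DirectSum.coeLinearMap 𝒱) h
  refine ⟨fun ε => (DirectSum.toModule ℂ ℤ V fun p =>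
    if Even (p - parDeg ε) then (𝒱 p).subtype else 0) ∘ₗ e.symm.toLinearMap, ?_⟩
  intro p x hx ε
  have : e.symm x = DirectSum.lof ℂ ℤ (fun p => 𝒱 p) p ⟨x, hx⟩ := by
    rw [LinearEquiv.symm_apply_eq]
    exact (DirectSum.coeLinearMap_lof 𝒱 p ⟨x, hx⟩).symm
  simp only [LinearMap.comp_apply, LinearEquiv.coe_coe, this, DirectSum.toModule_lof]
  split_ifs <;> simp

/-- The multilinear extension of `φ ∘ blockSum` from homogeneous arguments. -/
def extMulti (pr : Bool → V →ₗ[ℂ] V) (b : Multi W W) (E : Multi V W) (φ : W →ₗ[ℂ] Z) (m : ℕ) :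
    MultilinearMap ℂ (fun _ : Fin m => V) Z :=
  ∑ ε : Fin m → Bool, φ.compMultilinearMap
    ((blockMulti b E 2 fun i => parDeg (ε i)).compLinearMap fun i => pr (ε i))

lemma extMulti_apply {𝒱 : ℤ → Submodule ℂ V} {pr : Bool → V →ₗ[ℂ] V} (hpr : IsParityProj 𝒱 pr)
    (b : Multi W W) (E : Multi V W) (φ : W →ₗ[ℂ] Z) {m : ℕ} {p : Fin m → ℤ} {x : Fin m → V}
    (hx : Homog 𝒱 p x) : extMulti pr b E φ m x = φ (blockSum b E 2 p x) := by
  -- A homogeneous vector is fixed by the projector of its own parity and killed by the other one,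
  -- so one of the `2 ^ m` terms survives.
  rw [extMulti, _root_.sum_apply, Finset.sum_eq_single fun i => decide (Odd (p i))]
  · rw [LinearMap.compMultilinearMap_apply, MultilinearMap.compLinearMap_apply]
    have hpar : ∀ i, Even (p i - parDeg (decide (Odd (p i)))) := by
      intro i
      by_cases h : Odd (p i)
      · simp [parDeg, h, h.sub_odd odd_one]
      · simpa [parDeg, h] using Int.not_odd_iff_even.1 h
    have h1 : (fun i => pr (decide (Odd (p i))) (x i)) = x := by
      funext i
      rw [hpr _ _ (hx i), if_pos (hpar i)]
    rw [h1, blockMulti_apply]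
    congr 1
    unfold blockSum
    simp only [koszul_congr _ hpar]
  · intro ε _ hε
    obtain ⟨i, hi⟩ := Function.ne_iff.1 hε
    rw [LinearMap.compMultilinearMap_apply, MultilinearMap.compLinearMap_apply,
      MultilinearMap.map_coord_zero _ i, map_zero]
    rw [hpr _ _ (hx i), if_neg]
    intro h
    apply hi
    cases h' : ε i <;> rw [h'] at h
    · have : Even (p i) := by simpa [parDeg] using h
      simpa using this
    · have : Even (p i - 1) := by simpa [parDeg] using h
      simpa [Int.even_sub_one] using this
  · simp

lemma extMulti_congr (pr : Bool → V →ₗ[ℂ] V) (b : Multi W W) {E E' : Multi V W} (φ : W →ₗ[ℂ] Z)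
    {m : ℕ} (h : ∀ j < m, E j = E' j) : extMulti pr b E φ m = extMulti pr b E' φ m := by
  refine Finset.sum_congr rfl fun ε _ => ?_
  ext x
  simp only [LinearMap.compMultilinearMap_apply, MultilinearMap.compLinearMap_apply,
    blockMulti_apply]
  rw [blockSum_congr b le_rfl h]

lemma extMulti_zero (pr : Bool → V →ₗ[ℂ] V) (b : Multi W W) (E : Multi V W) (φ : W →ₗ[ℂ] Z) :
    extMulti pr b E φ 0 = 0 := by
  ext x
  simp [extMulti, blockMulti]

/-- The family of multilinear maps with only a linear term. -/
def linMulti (φ : V →ₗ[ℂ] W) : Multi V W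
  | 0 => 0
  | 1 => MultilinearMap.ofSubsingleton ℂ V W (0 : Fin 1) φ
  | _ + 2 => 0

/-- Approximations to the solution of `E = ι + h ∘ blockSum b E 2`. -/
def transferStage (pr : Bool → V →ₗ[ℂ] V) (b : Multi W W) (ι : V →ₗ[ℂ] W) (h : W →ₗ[ℂ] W) :
    ℕ → Multi V W
  | 0 => linMulti ι
  | n + 1 => fun m => linMulti ι m + extMulti pr b (transferStage pr b ι h n) h m

/-- The solution of `E = ι + h ∘ blockSum b E 2`. -/
def transferMap (pr : Bool → V →ₗ[ℂ] V) (b : Multi W W) (ι : V →ₗ[ℂ] W) (h : W →ₗ[ℂ] W) :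
    Multi V W := fun m => transferStage pr b ι h m m

/-- The transferred brackets, with one-bracket `D`. -/
def transferBracket (pr : Bool → V →ₗ[ℂ] V) (b : Multi W W) (ι : V →ₗ[ℂ] W) (π : W →ₗ[ℂ] V)
    (h : W →ₗ[ℂ] W) (D : V →ₗ[ℂ] V) : Multi V V :=
  fun m => linMulti D m + extMulti pr b (transferMap pr b ι h) π m

variable (pr : Bool → V →ₗ[ℂ] V) (b : Multi W W) (ι : V →ₗ[ℂ] W) (h : W →ₗ[ℂ] W)

/-- Iteration stabilises: arity `m` of the next stage uses only arities below `m` of the previous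
one, so stage `n` is final up to arity `n`. -/
lemma transferStage_succ_of_le {n m : ℕ} (hm : m ≤ n) :
    transferStage pr b ι h (n + 1) m = transferStage pr b ι h n m := by
  induction n generalizing m with
  | zero =>
    obtain rfl : m = 0 := by omega
    simp [transferStage, extMulti_zero]
  | succ n ih =>
    change linMulti ι m + extMulti pr b (transferStage pr b ι h (n + 1)) h m =
      linMulti ι m + extMulti pr b (transferStage pr b ι h n) h m
    rw [extMulti_congr pr b h (m := m) fun j hj => ih (by omega)]

lemma transferStage_of_le {n m : ℕ} (hm : m ≤ n) :
    transferStage pr b ι h n m = transferMap pr b ι h m := by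
  induction n, hm using Nat.le_induction with
  | base => rfl
  | succ n hn ih => rw [transferStage_succ_of_le pr b ι h hn, ih]

lemma transferMap_eq (m : ℕ) : transferMap pr b ι h m =
    linMulti ι m + extMulti pr b (transferMap pr b ι h) h m := by
  have h1 := transferStage_of_le pr b ι h (Nat.le_succ m)
  have h2 : transferStage pr b ι h (m + 1) m =
    linMulti ι m + extMulti pr b (transferStage pr b ι h m) h m := rfl
  rw [← h1, h2, extMulti_congr pr b h (m := m) fun j hj => transferStage_of_le pr b ι h hj.le]

end Multilinear

end LInfty

namespace LInfty

/-! ### Degree and graded symmetry of the transferred maps -/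

section BlockSymm

variable {T S M : Type*} [AddCommGroup M] {d : T → ℤ} {e : List T → S}

/-- Exchanging neighbours that lie in different blocks merely permutes the decompositions, so only
an exchange within one block has to be assumed. -/
lemma gsymm_blocks {g : List S → M} (H : ∀ v w l₁ u u' l₂, g (v ++ e (l₁ ++ u :: u' :: l₂) :: w) =
    sg (d u * d u') • g (v ++ e (l₁ ++ u' :: u :: l₂) :: w)) (k : ℕ) :
    GSymm d fun l => blocks d e k l g := by
  induction k generalizing g with
  | zero => intro l₁ u v l₂; cases l₁ <;> simp [blocks]
  | succ k ih =>
    simp only [blocks]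
    refine gsymm_split (fun c l₁ u u' l₂ => ?_) fun a => ?_
    · simp only
      rw [← blocks_zsmul]
      congr 1
      funext v
      exact H [] v l₁ u u' l₂
    · exact ih fun v w => H (e a :: v) w

lemma split_mem {P : AddSubgroup M} {l : List T} {g : List T → List T → M}
    (h : ∀ a c, (a ++ c).Perm l → g a c ∈ P) : split d l g ∈ P := by
  induction l generalizing g with
  | nil => exact h [] [] (by simp)
  | cons x l ih =>
    refine ih fun a c hac => ?_
    refine P.add_mem (h (x :: a) c (by simpa using hac)) (P.zsmul_mem (h a (x :: c) ?_) _)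
    exact List.perm_middle.trans (hac.cons x)

lemma blocks_mem {d' : S → ℤ} (he : ∀ l, d' (e l) = tdeg d l) {P : AddSubgroup M} {k : ℕ}
    {l : List T} {g : List S → M} (h : ∀ v, tdeg d' v = tdeg d l → g v ∈ P) :
    blocks d e k l g ∈ P := by
  induction k generalizing l g with
  | zero =>
    cases l with
    | nil => exact h [] rfl
    | cons x l => exact P.zero_mem
  | succ k ih =>
    refine split_mem fun a c hp => ih fun v hv => h _ ?_
    rw [tdeg_cons, he, hv, ← tdeg_perm d hp, tdeg_append]

end BlockSymm

section Ev

variable {V W : Type*} [AddCommGroup V] [Module ℂ V] [AddCommGroup W] [Module ℂ W]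

lemma ev_zsmul (E : Multi V W) (l l' : List V) (n : ℤ) (x : V) :
    ev E (l ++ (n • x) :: l') = n • ev E (l ++ x :: l') := by
  have hi : l.length < (l ++ x :: l').length := by simp
  have h : ∀ z, ev E (l ++ z :: l') = E _ (Function.update (l ++ x :: l').get ⟨_, hi⟩ z) := by
    intro z
    refine ev_eq E (by simp) fun i => ?_
    by_cases h : i = ⟨_, hi⟩
    · subst h; simp
    · rw [Function.update_of_ne h]
      have h' : (i : ℕ) ≠ l.length := fun hh => h (Fin.ext hh)
      simp only [Fin.getElem_fin, List.get_eq_getElem, List.getElem_append]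
      split_ifs with h1
      · rfl
      · obtain ⟨j, hj⟩ : ∃ j, (i : ℕ) - l.length = j + 1 := ⟨i - l.length - 1, by omega⟩
        simp [hj]
  rw [h, h x, ← Int.cast_smul_eq_zsmul ℂ, MultilinearMap.map_update_smul, Int.cast_smul_eq_zsmul]

lemma ev_linMulti_singleton (φ : V →ₗ[ℂ] W) (x : V) : ev (linMulti φ) [x] = φ x := rfl

lemma ev_linMulti_nil (φ : V →ₗ[ℂ] W) : ev (linMulti φ) [] = 0 := rfl

lemma ev_linMulti_cons_cons (φ : V →ₗ[ℂ] W) (x y : V) (l : List V) :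
    ev (linMulti φ) (x :: y :: l) = 0 := rfl

lemma ev_linMulti (φ : V →ₗ[ℂ] W) (l : List V) :
    ev (linMulti φ) l = φ (ev (linMulti LinearMap.id) l) := by
  match l with
  | [] => simp [ev_linMulti_nil]
  | [x] => simp [ev_linMulti_singleton]
  | x :: y :: l => simp [ev_linMulti_cons_cons]

variable {𝒱 : ℤ → Submodule ℂ V} {𝒲 : ℤ → Submodule ℂ W}

lemma isGSymm_linMulti (φ : V →ₗ[ℂ] W) : IsGSymm 𝒱 (linMulti φ) := by
  intro l₁ u v l₂
  rcases l₁ with _ | ⟨x, _ | ⟨y, l₁⟩⟩ <;> simp [ev_linMulti_cons_cons]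

lemma hasDegree_linMulti {φ : V →ₗ[ℂ] W} {c : ℤ} (h : ∀ p, ∀ x ∈ 𝒱 p, φ x ∈ 𝒲 (p + c)) :
    HasDegree 𝒱 𝒲 c (linMulti φ) := by
  intro l
  match l with
  | [] => exact Submodule.zero_mem _
  | [x] => simpa [ev_linMulti_singleton] using h _ _ x.mem
  | x :: y :: l => simp [ev_linMulti_cons_cons]

/-- The graded symmetric families of degree `0` without constant term. -/
structure IsPreMorphism (𝒱 : ℤ → Submodule ℂ V) (𝒲 : ℤ → Submodule ℂ W) (E : Multi V W) :
    Prop where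
  zero : E 0 = 0
  degree : HasDegree 𝒱 𝒲 0 E
  symm : IsGSymm 𝒱 E

variable {b : Multi W W} {E : Multi V W} (hE : IsPreMorphism 𝒱 𝒲 E)

include hE

lemma blockSum_eq (r : ℕ) {m : ℕ} (x : Fin m → HomogElem 𝒱) :
    blockSum b E r (fun i => (x i).deg) (fun i => (x i).val) =
      ∑ k ∈ Finset.Icc r m, ((k.factorial : ℂ)⁻¹) •
        blocks HomogElem.deg hE.degree.elem k (List.ofFn x)
          fun w => ev b (w.map HomogElem.val) :=
  blockSum_eq_blocks _ b E hE.zero _ HomogElem.val _ r x fun _ => rfl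

lemma blockSum_mem (hb : HasDegree 𝒲 𝒲 (-1) b) (r : ℕ) {m : ℕ} {p : Fin m → ℤ} {x : Fin m → V}
    (hx : Homog 𝒱 p x) : blockSum b E r p x ∈ 𝒲 (∑ i, p i - 1) := by
  have := blockSum_eq (b := b) hE r hx.elem
  change blockSum b E r p x = _ at this
  rw [this]
  refine Submodule.sum_mem _ fun k _ => Submodule.smul_mem _ _ ?_
  refine blocks_mem (P := (𝒲 (∑ i, p i - 1)).toAddSubgroup) (d' := HomogElem.deg)
    (fun l => rfl) fun v hv => ?_
  have h1 := hb v
  rw [hv, tdeg, List.map_ofFn, List.sum_ofFn] at h1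
  exact h1

lemma blockSum_symm (r : ℕ) {m : ℕ} {p : Fin m → ℤ} {x : Fin m → V} (σ : Equiv.Perm (Fin m))
    (hx : Homog 𝒱 p x) :
    blockSum b E r (p ∘ σ) (x ∘ σ) = koszul σ.symm p • blockSum b E r p x := by
  have h1 := blockSum_eq (b := b) hE r hx.elem
  have h2 := blockSum_eq (b := b) hE r fun i => hx.elem (σ i)
  change blockSum b E r p x = _ at h1
  change blockSum b E r (p ∘ σ) (x ∘ σ) = _ at h2
  rw [h1, h2, Finset.smul_sum]
  refine Finset.sum_congr rfl fun k _ => ?_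
  rw [smul_comm (koszul _ _)]
  congr 1
  refine GSymm.perm (g := fun l => blocks HomogElem.deg hE.degree.elem k l
          fun w => ev b (w.map HomogElem.val)) (gsymm_blocks ?_ k) hx.elem σ
  intro v w l₁ u u' l₂
  have h3 : (hE.degree.elem (l₁ ++ u :: u' :: l₂)).val =
    sg (u.deg * u'.deg) • (hE.degree.elem (l₁ ++ u' :: u :: l₂)).val := hE.symm l₁ u u' l₂
  simp only [List.map_append, List.map_cons, h3]
  rw [ev_zsmul]

variable {Z : Type*} [AddCommGroup Z] [Module ℂ Z] {𝒵 : ℤ → Submodule ℂ Z}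

lemma hasDegree_extMulti (hb : HasDegree 𝒲 𝒲 (-1) b) {pr : Bool → V →ₗ[ℂ] V}
    (hpr : IsParityProj 𝒱 pr) {φ : W →ₗ[ℂ] Z} {c : ℤ}
    (hφ : ∀ p, ∀ x ∈ 𝒲 p, φ x ∈ 𝒵 (p + (1 + c))) :
    HasDegree 𝒱 𝒵 c (extMulti pr b E φ) := by
  rw [hasDegree_iff]
  intro m p x hx
  rw [extMulti_apply hpr _ _ _ hx]
  have := hφ _ _ (blockSum_mem hE hb 2 hx)
  rwa [show ∑ i, p i - 1 + (1 + c) = ∑ i, p i + c by ring] at this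

lemma isGSymm_extMulti {pr : Bool → V →ₗ[ℂ] V}
    (hpr : IsParityProj 𝒱 pr) (φ : W →ₗ[ℂ] Z) :
    IsGSymm 𝒱 (extMulti pr b E φ) := by
  rw [isGSymm_iff]
  intro m p x σ hx
  have hx' : Homog 𝒱 (p ∘ σ) (x ∘ σ) := fun i => hx (σ i)
  rw [extMulti_apply hpr _ _ _ hx, extMulti_apply hpr _ _ _ hx', blockSum_symm hE _ _ hx, map_zsmul]

end Ev

section Add

variable {V W : Type*} [AddCommGroup V] [Module ℂ V] [AddCommGroup W] [Module ℂ W]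
  {𝒱 : ℤ → Submodule ℂ V} {𝒲 : ℤ → Submodule ℂ W} {E E' : Multi V W}

lemma ev_add (l : List V) : ev (fun m => E m + E' m) l = ev E l + ev E' l := rfl

lemma IsGSymm.add (h : IsGSymm 𝒱 E) (h' : IsGSymm 𝒱 E') : IsGSymm 𝒱 fun m => E m + E' m := by
  intro l₁ u v l₂
  simp only [ev_add, smul_add]
  exact congrArg₂ _ (h l₁ u v l₂) (h' l₁ u v l₂)

lemma HasDegree.add {c : ℤ} (h : HasDegree 𝒱 𝒲 c E) (h' : HasDegree 𝒱 𝒲 c E') :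
    HasDegree 𝒱 𝒲 c fun m => E m + E' m := fun l => Submodule.add_mem _ (h l) (h' l)

variable {b : Multi W W} {pr : Bool → V →ₗ[ℂ] V} {ι : V →ₗ[ℂ] W} {h : W →ₗ[ℂ] W}

lemma isPreMorphism_transferMap (hb : HasDegree 𝒲 𝒲 (-1) b) (hpr : IsParityProj 𝒱 pr)
    (hι : ∀ p, ∀ x ∈ 𝒱 p, ι x ∈ 𝒲 p) (hh : ∀ p, ∀ x ∈ 𝒲 p, h x ∈ 𝒲 (p + 1)) :
    IsPreMorphism 𝒱 𝒲 (transferMap pr b ι h) := by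
  have hlin : IsPreMorphism 𝒱 𝒲 (linMulti ι) :=
    ⟨rfl, hasDegree_linMulti (by simpa using hι), isGSymm_linMulti ι⟩
  have hs : ∀ n, IsPreMorphism 𝒱 𝒲 (transferStage pr b ι h n) := by
    intro n
    induction n with
    | zero => exact hlin
    | succ n ih =>
      refine ⟨?_, hlin.degree.add (hasDegree_extMulti ih hb hpr (by simpa using hh)),
        hlin.symm.add (isGSymm_extMulti ih hpr h)⟩
      change linMulti ι 0 + extMulti pr b (transferStage pr b ι h n) h 0 = 0
      rw [extMulti_zero, hlin.zero, add_zero]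
  refine ⟨(hs 0).zero, ?_, ?_⟩
  · rw [hasDegree_iff]
    intro m
    exact hasDegree_iff.1 (hs m).degree m
  · rw [isGSymm_iff]
    intro m
    exact isGSymm_iff.1 (hs m).symm m

end Add

end LInfty

namespace LInfty

/-! ### The L∞ relations of the transferred structure -/

noncomputable section Transfer

variable {V W : Type*} [AddCommGroup V] [Module ℂ V] [AddCommGroup W] [Module ℂ W]
  {𝒱 : ℤ → Submodule ℂ V} {𝒲 : ℤ → Submodule ℂ W}

section Twisted

variable {T : Type*} (d : T → ℤ) (e : List T → HomogElem 𝒱) (b : Multi V V)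

/-- The sum of all terms `b(e l₁, …, e l_k)` over the partitions of a list. -/
def curvature (l : List T) : V := partSum d e l fun v => ev b (v.map HomogElem.val)

/-- The sum of all terms `b(x, e l₁, …, e l_k)` over the partitions of a list. -/
def twisted (l : List T) : V →ₗ[ℂ] V where
  toFun x := partSum d e l fun v => ev b (x :: v.map HomogElem.val)
  map_add' x y := by simp only [ev_cons_add, partSum_add]
  map_smul' c x := by
    simp only [ev_cons_smul, RingHom.id_apply]
    exact (map_partSum d e (DistribSMul.toAddMonoidHom V c) l _).symm

lemma curvature_cons (x : T) (l : List T) :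
    curvature d e b (x :: l) =
      split d l fun a c => twisted d e b c (e (x :: a)).val := by
  rw [curvature, partSum_cons]; rfl

lemma twisted_nil (x : V) : twisted d e b [] x = ev b [x] := rfl

variable {d e b}

/-- The Bianchi identity. The Jacobi identity of `b` holds on the list of blocks of each partition.
Summed over all partitions, `partSum_split` lets one choose first which arguments go into the inner
bracket. -/
lemma split_twisted_curvature (he : ∀ l, (e l).deg = tdeg d l)
    (hj : ∀ v : List (HomogElem 𝒱), split HomogElem.deg v (fun a c =>
      ev b (ev b (a.map HomogElem.val) :: c.map HomogElem.val)) = 0) (l : List T) :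
    split d l (fun a c => twisted d e b c (curvature d e b a)) = 0 := by
  have h1 := partSum_split d e he l fun a c =>
    ev b (ev b (a.map HomogElem.val) :: c.map HomogElem.val)
  simp only [hj] at h1
  have h2 : partSum d e l (fun _ => (0 : V)) = 0 := by
    simpa using (map_partSum d e (0 : V →+ V) l fun _ => (0 : V)).symm
  rw [h2] at h1
  rw [h1]
  refine split_congr d fun a c _ => ?_
  rw [curvature, map_partSum]
  rfl

end Twisted

lemma jacobi_split {b : Multi V V} (hb : IsLInfty 𝒱 b) (v : List (HomogElem 𝒱)) :
    split HomogElem.deg v (fun a c =>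
      ev b (ev b (a.map HomogElem.val) :: c.map HomogElem.val)) = 0 := by
  have := hb.jacobi v.length (fun i => (v.get i).deg) (fun i => (v.get i).val)
    fun i => (v.get i).mem
  rw [insertSum_eq_split HomogElem.deg b b HomogElem.val v.get, List.ofFn_get] at this
  exact this

section BlockSums

variable {b : Multi V V} {E : Multi W V} (hE : IsPreMorphism 𝒲 𝒱 E) (hb0 : b 0 = 0)
  (hb : IsGSymm 𝒱 b)

include hb0 hb

lemma blockSum_one_eq {m : ℕ} (x : Fin m → HomogElem 𝒲) :
    blockSum b E 1 (fun i => (x i).deg) (fun i => (x i).val) =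
      curvature HomogElem.deg hE.degree.elem b (List.ofFn x) := by
  rw [blockSum_eq hE, curvature, partSum_eq_sum_blocks (d' := HomogElem.deg) _ _ (fun l => rfl) hb
    (n := m) _ (by simp)]
  · refine Finset.sum_subset (fun k hk => ?_) fun k hk hk' => ?_
    · simp only [Finset.mem_Icc, Finset.mem_range] at hk ⊢; omega
    · obtain rfl : k = 0 := by simp only [Finset.mem_Icc, Finset.mem_range] at hk hk'; omega
      have : ∀ l : List (HomogElem 𝒲), blocks HomogElem.deg hE.degree.elem 0 l
          (fun w => ev b (w.map HomogElem.val)) = 0 := by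
        intro l
        cases l with
        | nil => exact DFunLike.congr_fun hb0 _
        | cons x l => rfl
      rw [this, smul_zero]
  · intro v w
    refine ev_eq_zero b ?_
    simp only [List.map_append, List.map_cons, List.mem_append, List.mem_cons]
    exact Or.inr (Or.inl (DFunLike.congr_fun hE.zero _).symm)

lemma blockSum_two_eq {m : ℕ} (x : Fin m → HomogElem 𝒲) :
    blockSum b E 2 (fun i => (x i).deg) (fun i => (x i).val) =
      curvature HomogElem.deg hE.degree.elem b (List.ofFn x) -
        ev b [E m fun i => (x i).val] := by
  rw [← blockSum_one_eq hE hb0 hb, blockSum_eq hE, blockSum_eq hE]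
  cases m with
  | zero =>
    have : ev b [E 0 fun i => (x i).val] = 0 := by
      refine ev_eq_zero b ?_
      simp [hE.zero]
    simp [this]
  | succ m =>
    rw [← Finset.add_sum_Ioc_eq_sum_Icc (show 1 ≤ m + 1 by omega), ← Finset.Icc_succ_left_eq_Ioc]
    -- The term `k = 1` is the difference between the two sums: a single block must contain every
    -- argument.
    have : blocks HomogElem.deg hE.degree.elem 1 (List.ofFn x)
        (fun w => ev b (w.map HomogElem.val)) = ev b [E (m + 1) fun i => (x i).val] := by
      have h1 : blocks HomogElem.deg hE.degree.elem 1 (List.ofFn x)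
        (fun w => ev b (w.map HomogElem.val)) = split HomogElem.deg (List.ofFn x) fun a c =>
          if c = [] then ev b [(hE.degree.elem a).val] else 0 := by
        refine split_congr _ fun a c _ => ?_
        cases c <;> rfl
      rw [h1, split_ite_nil]
      have h2 : (hE.degree.elem (List.ofFn x)).val = E (m + 1) fun i => (x i).val := by
        change ev E _ = _
        rw [List.map_ofFn, ev_ofFn]; rfl
      rw [h2]
    rw [this]
    simp

end BlockSums

/-- The data for the transfer of a cyclic `L∞`-structure from `V` to `W` along a contraction. -/
structure IsTransferDatum (𝒱 : ℤ → Submodule ℂ V) (𝒲 : ℤ → Submodule ℂ W)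
    (κ : V →ₗ[ℂ] V →ₗ[ℂ] ℂ) (b : Multi V V) (ι : W →ₗ[ℂ] V) (π : V →ₗ[ℂ] W) (h D : V →ₗ[ℂ] V) :
    Prop where
  cyc : IsCyclicLInfty 𝒱 κ b
  unary : ∀ x, b 1 ![x] = D x
  internal : DirectSum.IsInternal 𝒲
  proj_incl : ∀ y, π (ι y) = y
  DD : ∀ x, D (D x) = 0
  homotopy : ∀ x, ι (π x) = x + h (D x) + D (h x)
  hh : ∀ x, h (h x) = 0
  proj_h : ∀ x, π (h x) = 0
  incl_mem : ∀ p, ∀ y ∈ 𝒲 p, ι y ∈ 𝒱 p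
  proj_mem : ∀ p, ∀ x ∈ 𝒱 p, π x ∈ 𝒲 p
  h_mem : ∀ p, ∀ x ∈ 𝒱 p, h x ∈ 𝒱 (p + 1)
  orth : ∀ x y, κ (ι (π x)) (y - ι (π y)) = 0
  orth' : ∀ x y, κ (x - ι (π x)) (ι (π y)) = 0
  orth_h : ∀ x y, κ (h x) (h y) = 0

namespace IsTransferDatum

variable {κ : V →ₗ[ℂ] V →ₗ[ℂ] ℂ} {b : Multi V V} {ι : W →ₗ[ℂ] V} {π : V →ₗ[ℂ] W}
  {h D : V →ₗ[ℂ] V} (H : IsTransferDatum 𝒱 𝒲 κ b ι π h D) {pr : Bool → W →ₗ[ℂ] W}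
  (hpr : IsParityProj 𝒲 pr)

include H

lemma degree_b : HasDegree 𝒱 𝒱 (-1) b := hasDegree_iff.2 H.cyc.degree

lemma symm_b : IsGSymm 𝒱 b := isGSymm_iff.2 H.cyc.symm

lemma ev_singleton (x : V) : ev b [x] = D x := by
  rw [← H.unary, ← ev_ofFn]; rfl

lemma D_mem (p : ℤ) (x : V) (hx : x ∈ 𝒱 p) : D x ∈ 𝒱 (p - 1) := by
  have := H.degree_b [⟨p, x, hx⟩]
  simp only [List.map_cons, List.map_nil, H.ev_singleton, tdeg_cons, tdeg_nil] at this
  simpa [sub_eq_add_neg] using this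

lemma incl_injective : Function.Injective ι := fun x y hxy => by
  rw [← H.proj_incl x, hxy, H.proj_incl]

include hpr

lemma preMorphism : IsPreMorphism 𝒲 𝒱 (transferMap pr b ι h) :=
  isPreMorphism_transferMap H.degree_b hpr H.incl_mem H.h_mem

/-- The transferred brackets. -/
def bracket (_ : IsTransferDatum 𝒱 𝒲 κ b ι π h D) (pr : Bool → W →ₗ[ℂ] W) : Multi W W :=
  transferBracket pr b ι π h (π ∘ₗ D ∘ₗ ι)

lemma degree_bracket : HasDegree 𝒲 𝒲 (-1) (H.bracket pr) := by
  refine HasDegree.add (hasDegree_linMulti fun p y hy => ?_)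
    (hasDegree_extMulti (H.preMorphism hpr) H.degree_b hpr fun p x hx => ?_)
  · exact H.proj_mem _ _ (H.D_mem _ _ (H.incl_mem _ _ hy))
  · simpa using H.proj_mem _ _ hx

lemma symm_bracket : IsGSymm 𝒲 (H.bracket pr) :=
  (isGSymm_linMulti _).add (isGSymm_extMulti (H.preMorphism hpr) hpr _)

/-- The sum of all terms `b(E, …, E)` over the partitions of a list. -/
def curv (l : List (HomogElem 𝒲)) : V :=
  curvature HomogElem.deg (H.preMorphism hpr).degree.elem b l

/-- The sum of all terms `b(x, E, …, E)` over the partitions of a list. -/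
def twist (l : List (HomogElem 𝒲)) : V →ₗ[ℂ] V :=
  twisted HomogElem.deg (H.preMorphism hpr).degree.elem b l

/-- The transferred maps on a list of homogeneous elements. -/
def map (_ : IsTransferDatum 𝒱 𝒲 κ b ι π h D) (_ : IsParityProj 𝒲 pr)
    (l : List (HomogElem 𝒲)) : V :=
  ev (transferMap pr b ι h) (l.map HomogElem.val)

/-- The transferred brackets on a list of homogeneous elements. -/
def bracketElem (l : List (HomogElem 𝒲)) : HomogElem 𝒲 :=
  ⟨tdeg HomogElem.deg l - 1, ev (H.bracket pr) (l.map HomogElem.val),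
    by simpa [sub_eq_add_neg] using H.degree_bracket hpr l⟩

/-- The linear part of a list. -/
def linPart (_ : IsTransferDatum 𝒱 𝒲 κ b ι π h D) (l : List (HomogElem 𝒲)) : W :=
  ev (linMulti LinearMap.id) (l.map HomogElem.val)

/-- The part of `curv` of order at least two in `E`. -/
def curvTwo (l : List (HomogElem 𝒲)) : V := H.curv hpr l - D (H.map hpr l)

lemma blockSum_two_list (l : List (HomogElem 𝒲)) :
    blockSum b (transferMap pr b ι h) 2 (fun i => (l.get i).deg) (fun i => (l.get i).val) =
      H.curvTwo hpr l := by
  rw [blockSum_two_eq (H.preMorphism hpr) H.cyc.uncurved H.symm_b, List.ofFn_get, H.ev_singleton]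
  rw [curvTwo, map, ev_eq _ (n := l.length) (y := fun i => (l.get i).val) (by simp) (by simp)]
  rfl

lemma ev_extMulti {Z : Type*} [AddCommGroup Z] [Module ℂ Z] (φ : V →ₗ[ℂ] Z)
    (l : List (HomogElem 𝒲)) :
    ev (extMulti pr b (transferMap pr b ι h) φ) (l.map HomogElem.val) = φ (H.curvTwo hpr l) := by
  rw [ev_eq _ (n := l.length) (y := fun i => (l.get i).val) (by simp) (by simp),
    extMulti_apply hpr (p := fun i => (l.get i).deg) _ _ _ fun i => (l.get i).mem,
    H.blockSum_two_list hpr]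

lemma map_eq (l : List (HomogElem 𝒲)) :
    H.map hpr l = ι (H.linPart l) + h (H.curvTwo hpr l) := by
  have h1 : ∀ l, ev (transferMap pr b ι h) l =
      ev (fun m => linMulti ι m + extMulti pr b (transferMap pr b ι h) h m) l :=
    fun l => by rw [ev, transferMap_eq]; rfl
  rw [map, h1, ev_add, ev_linMulti]
  congr 1
  exact H.ev_extMulti hpr h l

lemma bracketElem_eq (l : List (HomogElem 𝒲)) :
    (H.bracketElem hpr l).val = π (D (ι (H.linPart l))) + π (H.curvTwo hpr l) := by
  have : (H.bracketElem hpr l).val = ev (linMulti (π ∘ₗ D ∘ₗ ι)) (l.map HomogElem.val) +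
    ev (extMulti pr b (transferMap pr b ι h) π) (l.map HomogElem.val) := rfl
  rw [this, ev_linMulti, H.ev_extMulti hpr]
  rfl

/-- Singles out the block that contains `z`. If there is no further block, the term is the `D (map
…)` that `curvTwo` subtracts. The resulting recursions in the first argument are the ones into which
a bracket is later inserted. -/
lemma curvTwo_cons (z : HomogElem 𝒲) (l : List (HomogElem 𝒲)) :
    H.curvTwo hpr (z :: l) = split HomogElem.deg l fun a r =>
      if r = [] then 0 else H.twist hpr r (H.map hpr (z :: a)) := by
  rw [curvTwo, curv, curvature_cons, split_eq_add, twisted_nil, H.ev_singleton]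
  change D (H.map hpr (z :: l)) + _ - _ = _
  rw [add_sub_cancel_left]
  rfl

lemma map_cons (z : HomogElem 𝒲) (l : List (HomogElem 𝒲)) :
    H.map hpr (z :: l) = (if l = [] then ι z.val else 0) + h (split HomogElem.deg l fun a r =>
      if r = [] then 0 else H.twist hpr r (H.map hpr (z :: a))) := by
  rw [H.map_eq hpr, H.curvTwo_cons hpr]
  cases l <;> simp [linPart, ev_linMulti_singleton, ev_linMulti_cons_cons]

lemma bracket_cons (z : HomogElem 𝒲) (l : List (HomogElem 𝒲)) :
    (H.bracketElem hpr (z :: l)).val = (if l = [] then π (D (ι z.val)) else 0) +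
      π (split HomogElem.deg l fun a r =>
        if r = [] then 0 else H.twist hpr r (H.map hpr (z :: a))) := by
  rw [H.bracketElem_eq hpr, H.curvTwo_cons hpr]
  cases l <;> simp [linPart, ev_linMulti_singleton, ev_linMulti_cons_cons]

lemma split_twist_curv (l : List (HomogElem 𝒲)) :
    split HomogElem.deg l (fun a c => H.twist hpr c (H.curv hpr a)) = 0 :=
  split_twisted_curvature (fun _ => rfl) (jacobi_split H.cyc.toIsLInfty) l

lemma split_twist_curv' (l : List (HomogElem 𝒲)) :
    (split HomogElem.deg l fun a c => if c = [] then 0 else H.twist hpr c (H.curv hpr a)) =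
      -D (H.curv hpr l) := by
  have := H.split_twist_curv hpr l
  rw [split_eq_add] at this
  rw [eq_neg_iff_add_eq_zero, add_comm, ← H.ev_singleton]
  exact this

lemma D_curv (l : List (HomogElem 𝒲)) : D (H.curv hpr l) = D (H.curvTwo hpr l) := by
  simp [curvTwo, H.DD]

omit hpr in
lemma D_incl_proj (x : V) : D (ι (π x)) = ι (π (D x)) := by
  simp [H.homotopy, H.DD]

/-- Expanding `ι π` on `curvTwo` by the homotopy relation produces a term `D h curvTwo`. Together
with `D ι` of the linear part it is `D` of `map`, which completes `curvTwo` to `curv`. -/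
lemma incl_bracket (l : List (HomogElem 𝒲)) :
    ι (H.bracketElem hpr l).val = H.curv hpr l + h (D (H.curv hpr l)) := by
  have h1 : H.curv hpr l = D (H.map hpr l) + H.curvTwo hpr l := by rw [curvTwo]; abel
  rw [H.D_curv hpr, H.bracketElem_eq hpr, h1, H.map_eq hpr, map_add, ← H.D_incl_proj, H.proj_incl,
    H.homotopy, map_add]
  abel

/-- The compatibility of the transferred maps with the brackets. -/
lemma split_map_bracket (l : List (HomogElem 𝒲)) :
    split HomogElem.deg l (fun a c => H.map hpr (H.bracketElem hpr a :: c)) = H.curv hpr l := by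
  induction l using list_length_induction with
  | _ l ih =>
    rw [show (fun a c => H.map hpr (H.bracketElem hpr a :: c)) = _ from
      funext₂ fun a c => H.map_cons hpr _ _]
    -- The linear term of the recursion contributes `ι` of the bracket of all of `l`. In the other
    -- terms coassociativity first splits off `r`, leaving an instance of the same sum on `u`.
    rw [split_add, split_ite_nil, ← map_split, split_assoc]
    have h1 : ∀ u r, (split HomogElem.deg u fun a d =>
        if r = [] then 0 else H.twist hpr r (H.map hpr (H.bracketElem hpr a :: d))) =
        if r = [] then 0 else H.twist hpr r (split HomogElem.deg u fun a d =>
          H.map hpr (H.bracketElem hpr a :: d)) := by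
      intro u r
      split_ifs
      · exact split_zero _ _
      · rw [map_split]
    simp only [h1]
    have h2 : (split HomogElem.deg l fun u r =>
        if r = [] then 0 else H.twist hpr r (split HomogElem.deg u fun a d =>
          H.map hpr (H.bracketElem hpr a :: d))) =
        split HomogElem.deg l fun u r =>
          if r = [] then 0 else H.twist hpr r (H.curv hpr u) := by
      -- Since `r` is nonempty, `u` is strictly shorter than `l` and the induction hypothesis
      -- applies.
      refine split_congr _ fun u r hp => ?_
      split_ifs with hr
      · rfl
      · rw [ih]
        have := hp.length_eq
        have h3 := List.length_pos_iff.2 hr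
        rw [List.length_append] at this
        omega
    -- The Bianchi identity yields `-h D F`, which cancels the excess `h D F` in `incl_bracket`.
    rw [h2, H.split_twist_curv' hpr, H.incl_bracket hpr, map_neg]
    abel

lemma split_bracket_bracket (l : List (HomogElem 𝒲)) :
    split HomogElem.deg l (fun a c => (H.bracketElem hpr (H.bracketElem hpr a :: c)).val) = 0 := by
  simp only [H.bracket_cons hpr]
  rw [split_add, split_ite_nil, ← map_split, split_assoc]
  have h1 : ∀ u r, (split HomogElem.deg u fun a d =>
      if r = [] then 0 else H.twist hpr r (H.map hpr (H.bracketElem hpr a :: d))) =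
      if r = [] then 0 else H.twist hpr r (H.curv hpr u) := by
    intro u r
    split_ifs
    · exact split_zero _ _
    · rw [← map_split, H.split_map_bracket hpr]
  simp only [h1]
  rw [H.split_twist_curv' hpr, H.incl_bracket hpr]
  apply H.incl_injective
  -- The side conditions imply `h D h = -h`: apply the homotopy relation to a vector in the image of
  -- `h`.
  have h2 : h (D (h (D (H.curv hpr l)))) = -h (D (H.curv hpr l)) := by
    have := H.homotopy (h (D (H.curv hpr l)))
    rw [H.proj_h, H.hh, map_zero, map_zero, add_zero, add_comm] at this
    exact eq_neg_of_add_eq_zero_left this.symm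
  simp only [map_add, map_neg, map_zero, H.homotopy, H.DD, add_zero, h2]
  abel

end IsTransferDatum

end Transfer

end LInfty

namespace LInfty

lemma sg_congr_zmod {a b : ℤ} (h : (a : ZMod 2) = b) : sg a = sg b :=
  sg_congr (even_iff_two_dvd.2 ((ZMod.intCast_zmod_eq_zero_iff_dvd _ 2).1 (by simp [h])))

/-! ### Cyclicity of the transferred brackets -/

noncomputable section Cyclic

variable {V W : Type*} [AddCommGroup V] [Module ℂ V] [AddCommGroup W] [Module ℂ W]
  {𝒱 : ℤ → Submodule ℂ V} {𝒲 : ℤ → Submodule ℂ W}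

/-- The function `κ(b_m(x_1, …, x_m), x_{m+1})` of a nonempty list. -/
def cyclicEv (κ : V →ₗ[ℂ] V →ₗ[ℂ] ℂ) (b : Multi V V) (l : List V) : ℂ :=
  if h : l ≠ [] then κ (ev b l.dropLast) (l.getLast h) else 0

lemma cyclicEv_concat (κ : V →ₗ[ℂ] V →ₗ[ℂ] ℂ) (b : Multi V V) (l : List V) (x : V) :
    cyclicEv κ b (l ++ [x]) = κ (ev b l) x := by
  simp [cyclicEv]

lemma cyclicEv_map_concat (κ : V →ₗ[ℂ] V →ₗ[ℂ] ℂ) (b : Multi V V) (l : List (HomogElem 𝒱))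
    (x : HomogElem 𝒱) : cyclicEv κ b ((l ++ [x]).map HomogElem.val) =
      κ (ev b (l.map HomogElem.val)) x.val := by
  rw [List.map_append, List.map_singleton, cyclicEv_concat]

lemma cyclicEv_ofFn (κ : V →ₗ[ℂ] V →ₗ[ℂ] ℂ) (b : Multi V V) {m : ℕ} (x : Fin (m + 1) → V) :
    cyclicEv κ b (List.ofFn x) = κ (b m fun i => x i.castSucc) (x (Fin.last m)) := by
  rw [List.ofFn_succ', List.concat_eq_append, cyclicEv_concat, ev_ofFn]

lemma gsymm_cyclicEv_iff {κ : V →ₗ[ℂ] V →ₗ[ℂ] ℂ} {b : Multi V V} :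
    GSymm (HomogElem.deg (𝒱 := 𝒱)) (fun l => cyclicEv κ b (l.map HomogElem.val)) ↔
    ∀ (m : ℕ) (p : Fin (m + 1) → ℤ) (x : Fin (m + 1) → V) (σ : Equiv.Perm (Fin (m + 1))),
      Homog 𝒱 p x → κ (b m fun i => x (σ i.castSucc)) (x (σ (Fin.last m))) =
        koszul σ.symm p • κ (b m fun i => x i.castSucc) (x (Fin.last m)) := by
  constructor
  · intro h m p x σ hx
    have := GSymm.perm h hx.elem σ
    simp only [List.map_ofFn] at this
    rw [cyclicEv_ofFn, cyclicEv_ofFn] at this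
    exact this
  · intro h
    refine GSymm.of_perm fun m x σ => ?_
    simp only [List.map_ofFn]
    cases m with
    | zero => simp [cyclicEv]
    | succ m =>
      rw [cyclicEv_ofFn, cyclicEv_ofFn]
      exact h m (fun i => (x i).deg) (fun i => (x i).val) σ fun i => (x i).mem

/-- Criterion for the cyclicity of graded symmetric brackets. -/
lemma gsymm_cyclicEv {κ : V →ₗ[ℂ] V →ₗ[ℂ] ℂ} {b : Multi V V} (hb : IsGSymm 𝒱 b)
    (h : ∀ (z w : HomogElem 𝒱) (l : List (HomogElem 𝒱)),
      κ (ev b (z.val :: l.map HomogElem.val)) w.val =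
        sg (z.deg * w.deg + (z.deg + w.deg) * tdeg HomogElem.deg l) •
          κ (ev b (w.val :: l.map HomogElem.val)) z.val) :
    GSymm (HomogElem.deg (𝒱 := 𝒱)) (fun l => cyclicEv κ b (l.map HomogElem.val)) := by
  intro l₁ u v l₂
  simp only
  -- Only a transposition that involves the last argument uses the hypothesis on `κ`. All others are
  -- covered by the symmetry of the bracket.
  rcases l₂.eq_nil_or_concat with rfl | ⟨l₂, w, rfl⟩
  · have h1 : ∀ u v : HomogElem 𝒱, (l₁ ++ [u, v]) = (l₁ ++ [u]) ++ [v] := by simp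
    rw [h1, h1, cyclicEv_map_concat, cyclicEv_map_concat]
    have h2 : ∀ z : HomogElem 𝒱, ev b ((l₁ ++ [z]).map HomogElem.val) =
        sg (z.deg * tdeg HomogElem.deg l₁) • ev b (z.val :: l₁.map HomogElem.val) := fun z => by
      have := GSymm.move hb z l₁ []
      simpa using this
    rw [h2, h2, map_zsmul, map_zsmul, LinearMap.smul_apply, LinearMap.smul_apply, h, smul_smul,
      smul_smul, ← sg_add, ← sg_add]
    congr 1
    exact sg_congr ⟨u.deg * tdeg HomogElem.deg l₁, by ring⟩
  · have h1 : ∀ u v : HomogElem 𝒱, l₁ ++ u :: v :: l₂.concat w = (l₁ ++ u :: v :: l₂) ++ [w] := by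
      simp
    rw [h1, h1, cyclicEv_map_concat, cyclicEv_map_concat]
    have := hb l₁ u v l₂
    simp only at this
    rw [this, map_zsmul, LinearMap.smul_apply]

lemma extMulti_one (pr : Bool → W →ₗ[ℂ] W) (b : Multi V V) (E : Multi W V) {Z : Type*}
    [AddCommGroup Z] [Module ℂ Z] (φ : V →ₗ[ℂ] Z) (y : Fin 1 → W) : extMulti pr b E φ 1 y = 0 := by
  simp [extMulti, blockMulti]

namespace IsTransferDatum

variable {κ : V →ₗ[ℂ] V →ₗ[ℂ] ℂ} {b : Multi V V} {ι : W →ₗ[ℂ] V} {π : V →ₗ[ℂ] W}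
  {h D : V →ₗ[ℂ] V} (H : IsTransferDatum 𝒱 𝒲 κ b ι π h D) {pr : Bool → W →ₗ[ℂ] W}
  (hpr : IsParityProj 𝒲 pr)

include H

lemma kappa_ev_cons (x y : HomogElem 𝒱) (v : List (HomogElem 𝒱)) :
    κ (ev b (x.val :: v.map HomogElem.val)) y.val =
      sg (x.deg * y.deg + (x.deg + y.deg) * tdeg HomogElem.deg v) •
        κ (ev b (y.val :: v.map HomogElem.val)) x.val := by
  have h1 := gsymm_cyclicEv_iff.2 H.cyc.cyclic v x y []
  have h2 : ∀ z : HomogElem 𝒱, ev b (v.map HomogElem.val ++ [z.val]) =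
      sg (z.deg * tdeg HomogElem.deg v) • ev b (z.val :: v.map HomogElem.val) := fun z => by
    have := GSymm.move H.symm_b z v []
    simpa using this
  have h3 : ∀ u w : HomogElem 𝒱, (v ++ [u, w]).map HomogElem.val =
    (v.map HomogElem.val ++ [u.val]) ++ [w.val] := by simp
  simp only [h3, cyclicEv_concat, h2, map_zsmul, LinearMap.smul_apply] at h1
  have h4 := congrArg (sg (x.deg * tdeg HomogElem.deg v) • ·) h1
  simp only [smul_smul, sg_mul_self, one_smul, ← sg_add] at h4
  rw [h4]
  congr 2
  ring

/-- Cyclicity holds term by term, and its sign depends on the blocks only through their total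
degree, which is the same for all partitions. -/
lemma kappa_twisted {T : Type*} {d : T → ℤ} {e : List T → HomogElem 𝒱}
    (he : ∀ l, (e l).deg = tdeg d l) (r : List T) {p q : ℤ} {x y : V} (hx : x ∈ 𝒱 p)
    (hy : y ∈ 𝒱 q) : κ (twisted d e b r x) y =
      sg (p * q + (p + q) * tdeg d r) • κ (twisted d e b r y) x := by
  have h1 : ∀ x y, κ (twisted d e b r x) y =
      partSum d e r fun v => κ (ev b (x :: v.map HomogElem.val)) y := fun x y =>
    map_partSum d e (κ.flip y) r _
  rw [h1, h1, ← partSum_zsmul]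
  refine partSum_congr d e he fun v hv => ?_
  rw [← hv]
  exact H.kappa_ev_cons ⟨p, x, hx⟩ ⟨q, y, hy⟩ v

lemma kappa_D {p q : ℤ} {x y : V} (hx : x ∈ 𝒱 p) (hy : y ∈ 𝒱 q) :
    κ (D x) y = sg (p * q) • κ (D y) x := by
  have := H.kappa_ev_cons ⟨p, x, hx⟩ ⟨q, y, hy⟩ []
  simpa [H.ev_singleton] using this

/-- Orthogonality, with `π h = 0` and `κ(h ·, h ·) = 0`, rewrites `κ(x, h y)` as `-κ(D h x, h y)`.
The symmetry of `h` is therefore inherited from that of `D`. -/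
lemma kappa_h {p q : ℤ} {x y : V} (hx : x ∈ 𝒱 p) (hy : y ∈ 𝒱 q) :
    κ x (h y) = sg ((p + 1) * (q + 1)) • κ y (h x) := by
  have h1 : ∀ x y, κ (D (h x)) (h y) = -κ x (h y) := by
    intro x y
    have h2 := H.orth x (h y)
    rw [H.proj_h, map_zero, sub_zero, H.homotopy, map_add, map_add, LinearMap.add_apply,
      LinearMap.add_apply, H.orth_h, add_zero] at h2
    exact eq_neg_of_add_eq_zero_right h2
  have h3 := H.kappa_D (H.h_mem _ _ hx) (H.h_mem _ _ hy)
  rw [h1, h1, smul_neg] at h3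
  exact neg_injective h3

lemma kappa_proj (x : V) (y : W) : κ (ι (π x)) (ι y) = κ x (ι y) := by
  have := H.orth' x (ι y)
  rw [H.proj_incl, map_sub, LinearMap.sub_apply, sub_eq_zero] at this
  exact this.symm

include hpr

lemma map_mem (l : List (HomogElem 𝒲)) : H.map hpr l ∈ 𝒱 (tdeg HomogElem.deg l) := by
  have := (H.preMorphism hpr).degree l
  rwa [add_zero] at this

lemma curvTwo_mem (l : List (HomogElem 𝒲)) :
    H.curvTwo hpr l ∈ 𝒱 (tdeg HomogElem.deg l - 1) := by
  rw [← H.blockSum_two_list hpr]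
  have := blockSum_mem (H.preMorphism hpr) H.degree_b 2
    (p := fun i => (l.get i).deg) (x := fun i => (l.get i).val) fun i => (l.get i).mem
  convert this using 3
  rw [tdeg, ← Fin.sum_univ_fun_getElem]
  rfl

/-- With the block of `z` singled out, both sides become sums over three parts `a`, `r`, `c` of
terms in which `b(·, E, …, E)` on `r` pairs `E(z, a)` with `E(w, c)`. Cyclicity of `b` exchanges the
outer two. The degree condition selects the only case in which `κ` can be nonzero. -/
lemma split_kappa_curvTwo_map (z w : HomogElem 𝒲) (l : List (HomogElem 𝒲))
    (hl : z.deg + w.deg + tdeg HomogElem.deg l = 0) :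
    (split HomogElem.deg l fun u c => sg (w.deg * tdeg HomogElem.deg c) •
      κ (H.curvTwo hpr (z :: u)) (H.map hpr (w :: c))) =
    sg (z.deg * w.deg + z.deg + w.deg) • split HomogElem.deg l fun u c =>
      sg (z.deg * tdeg HomogElem.deg c) •
        κ (H.curvTwo hpr (w :: u)) (H.map hpr (z :: c)) := by
  have h1 : ∀ (z w : HomogElem 𝒲) (u c : List (HomogElem 𝒲)),
      sg (w.deg * tdeg HomogElem.deg c) • κ (H.curvTwo hpr (z :: u)) (H.map hpr (w :: c)) =
      split HomogElem.deg u fun a r => sg (w.deg * tdeg HomogElem.deg c) •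
        if r = [] then 0 else κ (H.twist hpr r (H.map hpr (z :: a))) (H.map hpr (w :: c)) := by
    intro z w u c
    rw [H.curvTwo_cons hpr]
    have := map_split HomogElem.deg (κ.flip (H.map hpr (w :: c))) u fun a r =>
      if r = [] then 0 else H.twist hpr r (H.map hpr (z :: a))
    rw [LinearMap.flip_apply] at this
    rw [this, ← split_zsmul]
    refine split_congr _ fun a r _ => ?_
    split_ifs <;> simp
  simp only [h1]
  rw [split_outer_comm HomogElem.deg l fun a r c => sg (z.deg * tdeg HomogElem.deg c) •
    if r = [] then 0 else κ (H.twist hpr r (H.map hpr (w :: a))) (H.map hpr (z :: c)),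
    ← split_zsmul]
  refine split_congr _ fun u c huc => ?_
  rw [← split_zsmul]
  refine split_congr _ fun a r har => ?_
  split_ifs with hr
  · simp
  · have h2 := H.kappa_twisted (fun _ => rfl) r (e := (H.preMorphism hpr).degree.elem)
      (H.map_mem hpr (z :: a)) (H.map_mem hpr (w :: c))
    change κ (H.twist hpr r _) _ = _ • κ (H.twist hpr r _) _ at h2
    rw [h2]
    simp only [smul_smul, ← sg_add]
    congr 1
    have h3 := tdeg_perm HomogElem.deg huc
    have h4 := tdeg_perm HomogElem.deg har
    rw [tdeg_append] at h3 h4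
    simp only [tdeg_cons]
    generalize tdeg HomogElem.deg a = A at *
    generalize tdeg HomogElem.deg c = C at *
    -- Eliminating the degree of `r` leaves a sign identity in four free parities, which is checked
    -- over `ZMod 2`.
    obtain hR : tdeg HomogElem.deg r = - z.deg - w.deg - C - A := by omega
    rw [hR]
    refine sg_congr_zmod ?_
    push_cast
    generalize (z.deg : ZMod 2) = z'
    generalize (w.deg : ZMod 2) = w'
    generalize (A : ZMod 2) = A'
    generalize (C : ZMod 2) = C'
    clear * -
    revert z' w' A' C'
    decide

/-- In the symmetric sum of `split_kappa_curvTwo_map`, the second slot is `ι + h curvTwo`. The part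
with `h` is symmetric by `kappa_h`, so it can be subtracted. -/
lemma kappa_curvTwo_incl (z w : HomogElem 𝒲) (l : List (HomogElem 𝒲))
    (hl : z.deg + w.deg + tdeg HomogElem.deg l = 0) :
    κ (H.curvTwo hpr (z :: l)) (ι w.val) = sg (z.deg * w.deg + z.deg + w.deg) •
      κ (H.curvTwo hpr (w :: l)) (ι z.val) := by
  have h1 : ∀ z w : HomogElem 𝒲, (split HomogElem.deg l fun u c =>
      sg (w.deg * tdeg HomogElem.deg c) •
        κ (H.curvTwo hpr (z :: u)) (H.map hpr (w :: c))) =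
      κ (H.curvTwo hpr (z :: l)) (ι w.val) + split HomogElem.deg l fun u c =>
        sg (w.deg * tdeg HomogElem.deg c) •
          κ (H.curvTwo hpr (z :: u)) (h (H.curvTwo hpr (w :: c))) := by
    intro z w
    have h2 : ∀ u c, sg (w.deg * tdeg HomogElem.deg c) •
        κ (H.curvTwo hpr (z :: u)) (H.map hpr (w :: c)) =
        (if c = [] then κ (H.curvTwo hpr (z :: u)) (ι w.val) else 0) +
          sg (w.deg * tdeg HomogElem.deg c) •
            κ (H.curvTwo hpr (z :: u)) (h (H.curvTwo hpr (w :: c))) := by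
      intro u c
      rw [H.map_cons hpr, ← H.curvTwo_cons hpr, map_add, smul_add]
      congr 1
      split_ifs with hc <;> simp [hc]
    simp only [h2]
    rw [split_add, split_ite_nil]
  have h3 : (split HomogElem.deg l fun u c => sg (w.deg * tdeg HomogElem.deg c) •
      κ (H.curvTwo hpr (z :: u)) (h (H.curvTwo hpr (w :: c)))) =
      sg (z.deg * w.deg + z.deg + w.deg) • split HomogElem.deg l fun u c =>
      sg (z.deg * tdeg HomogElem.deg c) •
        κ (H.curvTwo hpr (w :: u)) (h (H.curvTwo hpr (z :: c))) := by
    rw [split_comm, ← split_zsmul]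
    refine split_congr _ fun c u hp => ?_
    rw [H.kappa_h (H.curvTwo_mem hpr (z :: u)) (H.curvTwo_mem hpr (w :: c))]
    simp only [smul_smul, ← sg_add]
    congr 1
    have h3 := tdeg_perm HomogElem.deg hp
    rw [tdeg_append] at h3
    simp only [tdeg_cons]
    obtain hC : tdeg HomogElem.deg c = - z.deg - w.deg - tdeg HomogElem.deg u := by omega
    rw [hC]
    refine sg_congr_zmod ?_
    push_cast
    generalize (z.deg : ZMod 2) = z'
    generalize (w.deg : ZMod 2) = w'
    generalize (tdeg HomogElem.deg u : ZMod 2) = u'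
    clear * -
    revert z' w' u'
    decide
  have h4 := H.split_kappa_curvTwo_map hpr z w l hl
  rw [h1, h1, h3, smul_add] at h4
  exact add_right_cancel h4

lemma kappa_bracket (z w : HomogElem 𝒲) (l : List (HomogElem 𝒲)) :
    κ (ι (H.bracketElem hpr (z :: l)).val) (ι w.val) =
      sg (z.deg * w.deg + (z.deg + w.deg) * tdeg HomogElem.deg l) •
        κ (ι (H.bracketElem hpr (w :: l)).val) (ι z.val) := by
  -- The bracket lowers the degree by one and `κ` lives in total degree `-1`, so otherwise both
  -- sides vanish.
  by_cases hl : z.deg + w.deg + tdeg HomogElem.deg l = 0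
  · have h1 : ∀ z w : HomogElem 𝒲, κ (ι (H.bracketElem hpr (z :: l)).val) (ι w.val) =
        (if l = [] then κ (D (ι z.val)) (ι w.val) else 0) +
          κ (H.curvTwo hpr (z :: l)) (ι w.val) := by
      intro z w
      rw [H.bracket_cons hpr, ← H.curvTwo_cons hpr, map_add, map_add, LinearMap.add_apply,
        H.kappa_proj]
      congr 1
      split_ifs
      · rw [H.kappa_proj]
      · simp
    rw [h1, h1, H.kappa_curvTwo_incl hpr z w l hl, smul_add]
    have hs : sg (z.deg * w.deg + (z.deg + w.deg) * tdeg HomogElem.deg l) =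
        sg (z.deg * w.deg + z.deg + w.deg) := by
      have : tdeg HomogElem.deg l = -z.deg - w.deg := by omega
      rw [this]
      refine sg_congr_zmod ?_
      push_cast
      generalize (z.deg : ZMod 2) = z'
      generalize (w.deg : ZMod 2) = w'
      clear * -
      revert z' w'
      decide
    rw [hs]
    congr 1
    split_ifs with hn
    · rw [H.kappa_D (H.incl_mem _ _ z.mem) (H.incl_mem _ _ w.mem)]
      congr 1
      refine sg_congr ?_
      subst hn
      have : z.deg = -w.deg := by simp at hl; omega
      rw [this]
      simp only [Int.even_add, Int.even_sub, Int.even_mul, even_neg]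
      tauto
    · simp
  · have h1 : ∀ z w : HomogElem 𝒲, z.deg + w.deg + tdeg HomogElem.deg l ≠ 0 →
        κ (ι (H.bracketElem hpr (z :: l)).val) (ι w.val) = 0 := by
      intro z w hzw
      refine H.cyc.kappa_degree _ _ _ _ (H.incl_mem _ _ (H.bracketElem hpr (z :: l)).mem)
        (H.incl_mem _ _ w.mem) ?_
      simp only [bracketElem, tdeg_cons]
      omega
    rw [h1 z w hl, h1 w z (by omega), smul_zero]

/-- The transferred brackets form a cyclic `L∞`-algebra. -/
theorem isCyclicLInfty {κ' : W →ₗ[ℂ] W →ₗ[ℂ] ℂ} (hκ : ∀ x y, κ' x y = κ (ι x) (ι y)) :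
    IsCyclicLInfty 𝒲 κ' (H.bracket pr) where
  uncurved := by
    change linMulti (π ∘ₗ D ∘ₗ ι) 0 + extMulti pr b (transferMap pr b ι h) π 0 = 0
    rw [extMulti_zero]
    exact add_zero _
  degree := hasDegree_iff.1 (H.degree_bracket hpr)
  symm := isGSymm_iff.1 (H.symm_bracket hpr)
  jacobi m p x hx := by
    have := insertSum_eq_split HomogElem.deg (H.bracket pr) (H.bracket pr) HomogElem.val hx.elem
    change insertSum (H.bracket pr) (H.bracket pr) p x = _ at this
    rw [this]
    exact H.split_bracket_bracket hpr _
  nondegenerate := by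
    -- The image of `ι` is orthogonal to that of `1 - ι π`, so a vector of `W` orthogonal to `W` is
    -- orthogonal to all of `V`.
    constructor
    · intro y hy
      apply H.incl_injective
      rw [map_zero]
      refine H.cyc.nondegenerate.1 _ fun x => ?_
      have h1 := H.orth (ι y) x
      rw [H.proj_incl, map_sub, ← hκ, hy, sub_zero] at h1
      exact h1
    · intro y hy
      apply H.incl_injective
      rw [map_zero]
      refine H.cyc.nondegenerate.2 _ fun x => ?_
      rw [← H.kappa_proj, ← hκ, hy]
  kappa_degree p q x y hx hy hpq := by
    rw [hκ]; exact H.cyc.kappa_degree p q _ _ (H.incl_mem _ _ hx) (H.incl_mem _ _ hy) hpq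
  kappa_symm p q x y hx hy := by
    rw [hκ, hκ]; exact H.cyc.kappa_symm p q _ _ (H.incl_mem _ _ hx) (H.incl_mem _ _ hy)
  cyclic := by
    refine gsymm_cyclicEv_iff.1 (gsymm_cyclicEv (H.symm_bracket hpr) fun z w l => ?_)
    rw [hκ, hκ]
    exact H.kappa_bracket hpr z w l

theorem isMorphism : IsMorphism 𝒲 (H.bracket pr) 𝒱 b (transferMap pr b ι h) where
  zero := (H.preMorphism hpr).zero
  degree m p x hx := by simpa using hasDegree_iff.1 (H.preMorphism hpr).degree m p x hx
  symm := isGSymm_iff.1 (H.preMorphism hpr).symm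
  comm m p x hx := by
    have h1 := insertSum_eq_split HomogElem.deg (transferMap pr b ι h) (H.bracket pr)
      HomogElem.val hx.elem
    have h2 := blockSum_one_eq (H.preMorphism hpr) H.cyc.uncurved H.symm_b hx.elem
    change insertSum _ _ p x = _ at h1
    change blockSum _ _ 1 p x = _ at h2
    rw [h1, h2]
    exact H.split_map_bracket hpr _

omit H in
lemma transferMap_apply_of_two_le {m : ℕ} {p : Fin m → ℤ} {y : Fin m → W} (hm : 2 ≤ m)
    (hy : Homog 𝒲 p y) :
    transferMap pr b ι h m y = h (blockSum b (transferMap pr b ι h) 2 p y) := by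
  rw [transferMap_eq, _root_.add_apply, extMulti_apply hpr _ _ _ hy]
  obtain ⟨m, rfl⟩ := Nat.exists_eq_add_of_le' hm
  exact zero_add _

lemma bracket_apply_of_two_le {m : ℕ} {p : Fin m → ℤ} {y : Fin m → W} (hm : 2 ≤ m)
    (hy : Homog 𝒲 p y) :
    H.bracket pr m y = π (blockSum b (transferMap pr b ι h) 2 p y) := by
  change linMulti (π ∘ₗ D ∘ₗ ι) m y + extMulti pr b (transferMap pr b ι h) π m y = _
  rw [extMulti_apply hpr _ _ _ hy]
  obtain ⟨m, rfl⟩ := Nat.exists_eq_add_of_le' hm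
  exact zero_add _

omit hpr H in
lemma transferMap_one (y : W) : transferMap pr b ι h 1 ![y] = ι y := by
  rw [transferMap_eq, _root_.add_apply, extMulti_one, add_zero]
  rfl

omit hpr in
lemma bracket_one (y : W) : H.bracket pr 1 ![y] = π (D (ι y)) := by
  change linMulti (π ∘ₗ D ∘ₗ ι) 1 ![y] + extMulti pr b (transferMap pr b ι h) π 1 ![y] = _
  rw [extMulti_one, add_zero]
  rfl

end IsTransferDatum

end Cyclic

end LInfty

namespace ClosedString

noncomputable section

variable {n d : ℕ}

/-! ### Operators on the Fock space -/

@[simp] lemma ofKet_ket {W : Type*} [AddCommGroup W] [Module ℂ W] (f : FockLabel n d → W)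
    (s : FockLabel n d) : ofKet f (ket s) = f s := by
  simp [ofKet, ket]

lemma hom_ext_ket {W : Type*} [AddCommGroup W] [Module ℂ W] {A B : Fock n d →ₗ[ℂ] W}
    (h : ∀ s, A (ket s) = B (ket s)) : A = B := by
  refine Finsupp.lhom_ext fun s c => ?_
  have : (Finsupp.single s c : Fock n d) = c • ket s := by simp [ket]
  rw [this, map_smul, map_smul, h]

lemma fock_induction {p : Fock n d → Prop} (x : Fock n d) (hk : ∀ s, p (ket s))
    (h0 : p 0) (ha : ∀ x y, p x → p y → p (x + y)) (hs : ∀ (c : ℂ) x, p x → p (c • x)) : p x := by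
  induction x using Finsupp.induction_linear with
  | zero => exact h0
  | add x y hx hy => exact ha x y hx hy
  | single s c =>
    have : (Finsupp.single s c : Fock n d) = c • ket s := by simp [ket]
    rw [this]
    exact hs c _ (hk s)

/-- Creation of a matter excitation. -/
def bosCreate (v : Bool × ℕ+ × (Fin n ⊕ Fin d)) : Module.End ℂ (Fock n d) :=
  ofKet fun s => ket { s with bos := s.bos + Finsupp.single v 1 }

/-- Annihilation of a matter excitation. -/
def bosAnnihilate (v : Bool × ℕ+ × (Fin n ⊕ Fin d)) : Module.End ℂ (Fock n d) :=
  ofKet fun s => (s.bos v : ℂ) • ket { s with bos := s.bos - Finsupp.single v 1 }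

variable (v w : Bool × ℕ+ × (Fin n ⊕ Fin d)) (s : FockLabel n d)

@[simp] lemma bosCreate_ket :
    bosCreate v (ket s) = ket { s with bos := s.bos + Finsupp.single v 1 } := ofKet_ket _ _

@[simp] lemma bosAnnihilate_ket : bosAnnihilate v (ket s) =
    (s.bos v : ℂ) • ket { s with bos := s.bos - Finsupp.single v 1 } := ofKet_ket _ _

lemma bosCreate_mul_comm : bosCreate v * bosCreate w = bosCreate w * bosCreate v := by
  refine hom_ext_ket fun s => ?_
  simp [Module.End.mul_apply, add_right_comm]

lemma bosAnnihilate_mul_comm :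
    bosAnnihilate v * bosAnnihilate w = bosAnnihilate w * bosAnnihilate v := by
  rcases eq_or_ne v w with rfl | hvw
  · rfl
  refine hom_ext_ket fun s => ?_
  simp only [Module.End.mul_apply, bosAnnihilate_ket, map_smul, Finsupp.tsub_apply,
    Finsupp.single_apply, if_neg hvw, if_neg hvw.symm, tsub_zero, smul_smul,
    tsub_right_comm (a := s.bos)]
  rw [mul_comm]

lemma bosAnnihilate_mul_bosCreate : bosAnnihilate v * bosCreate w =
    bosCreate w * bosAnnihilate v + if v = w then (1 : Module.End ℂ (Fock n d)) else 0 := by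
  refine hom_ext_ket fun s => ?_
  split_ifs with hvw
  · subst hvw
    simp only [Module.End.mul_apply, bosAnnihilate_ket, bosCreate_ket, map_smul,
      LinearMap.add_apply, Module.End.one_apply, Finsupp.add_apply, Finsupp.single_eq_same,
      Nat.cast_add, Nat.cast_one, add_smul, one_smul, add_tsub_cancel_right]
    congr 1
    -- On an unoccupied mode the subtraction of occupation numbers truncates, but the coefficient is
    -- then zero.
    rcases Nat.eq_zero_or_pos (s.bos v) with h0 | h0
    · simp [h0]
    · congr 2
      ext1 <;> try rfl
      refine (tsub_add_cancel_of_le ?_).symm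
      rw [Finsupp.single_le_iff]; exact h0
  · simp only [Module.End.mul_apply, bosAnnihilate_ket, bosCreate_ket, map_smul, add_zero,
      Finsupp.add_apply, Finsupp.single_apply, if_neg (Ne.symm hvw)]
    congr 2
    ext1 <;> try rfl
    ext u
    simp only [Finsupp.tsub_apply, Finsupp.add_apply, Finsupp.single_apply]
    split_ifs with h1 h2 <;> simp_all

variable (g : Matrix (Fin d) (Fin d) ℝ) (χ χ' : Bool) (i j : Fin n ⊕ Fin d)

/-- The inverse target space metric. -/
def invMetric (n : ℕ) {d : ℕ} (g : Matrix (Fin d) (Fin d) ℝ) (i j : Fin n ⊕ Fin d) : ℂ :=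
  ((metric n g)⁻¹ i j : ℂ)

lemma alpha_neg (m : ℕ+) : alpha g χ (-(m : ℤ)) i = bosCreate (n := n) (χ, m, i) := by
  refine hom_ext_ket fun s => ?_
  have : ((-(m : ℤ)).natAbs).toPNat' = m := by simp
  rw [alpha, ofKet_ket, if_pos (by simp), this, bosCreate_ket]

lemma alpha_pos (m : ℕ+) : alpha g χ (m : ℤ) i =
    ∑ j : Fin n ⊕ Fin d, ((m : ℂ) * invMetric n g i j) • bosAnnihilate (χ, m, j) := by
  refine hom_ext_ket fun s => ?_
  have h1 : ((m : ℤ).natAbs).toPNat' = m := by simp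
  have h2 : ¬(m : ℤ) < 0 := by simp
  rw [alpha, ofKet_ket, if_neg h2, if_neg (by simp), h1]
  simp [invMetric, smul_smul]

lemma alpha_zero_ket : alpha g χ 0 i (ket s) = (zeroMode g χ s i : ℂ) • ket s := by
  rw [alpha, ofKet_ket]; simp

lemma int_trichotomy (k : ℤ) : k = 0 ∨ (∃ m : ℕ+, k = m) ∨ ∃ m : ℕ+, k = -(m : ℤ) := by
  rcases lt_trichotomy k 0 with h | h | h
  · refine Or.inr (Or.inr ⟨⟨k.natAbs, by omega⟩, ?_⟩)
    change k = -((k.natAbs : ℕ) : ℤ)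
    omega
  · exact Or.inl h
  · refine Or.inr (Or.inl ⟨⟨k.natAbs, by omega⟩, ?_⟩)
    change k = ((k.natAbs : ℕ) : ℤ)
    omega

variable (e f : ℤ ×ₗ Bool)

lemma ghCreate_ket : ghCreate e (ket s) =
    if e ∈ s.gh then 0 else ghSign s.gh e • ket { s with gh := insert e s.gh } := ofKet_ket _ _

lemma ghAnnihilate_ket : ghAnnihilate e (ket s) =
    if e ∈ s.gh then ghSign s.gh e • ket { s with gh := s.gh.erase e } else 0 := ofKet_ket _ _

lemma ghSign_insert (S : Finset (ℤ ×ₗ Bool)) (h : e ∉ S) :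
    ghSign (insert e S) f = (if e < f then -1 else 1) * ghSign S f := by
  unfold ghSign
  rw [Finset.filter_insert]
  split_ifs
  · rw [Finset.card_insert_of_notMem (by simp [h]), pow_succ']
  · rw [one_mul]

lemma ghSign_erase (S : Finset (ℤ ×ₗ Bool)) (h : e ∈ S) :
    ghSign (S.erase e) f = (if e < f then -1 else 1) * ghSign S f := by
  have := ghSign_insert e f (S.erase e) (by simp)
  rw [Finset.insert_erase h] at this
  rw [this, ← mul_assoc]
  split_ifs <;> simp

lemma ghSign_mul_self (S : Finset (ℤ ×ₗ Bool)) : ghSign S e * ghSign S e = 1 := by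
  unfold ghSign
  rw [← mul_pow]; simp

lemma ghCreate_anticomm : (ghCreate e * ghCreate f : Module.End ℂ (Fock n d)) +
    ghCreate f * ghCreate e = 0 := by
  refine hom_ext_ket fun s => ?_
  simp only [LinearMap.add_apply, Module.End.mul_apply, ghCreate_ket, LinearMap.zero_apply]
  rcases eq_or_ne e f with rfl | hef
  · by_cases h : e ∈ s.gh <;> simp [h, ghCreate_ket]
  by_cases h : e ∈ s.gh <;> by_cases h' : f ∈ s.gh <;>
    simp only [h, h', if_true, if_false, map_zero, map_smul, ghCreate_ket, Finset.mem_insert,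
      hef, hef.symm, or_false, or_true, smul_zero, add_zero]
  rw [ghSign_insert _ _ _ h, ghSign_insert _ _ _ h', smul_smul, smul_smul, Finset.insert_comm,
    ← add_smul]
  -- Of two distinct excitations exactly one precedes the other, so exactly one of the two orders
  -- picks up an extra sign.
  rcases hef.lt_or_gt with hlt | hlt <;> simp [hlt, hlt.not_gt] <;> ring_nf <;> simp

lemma ghAnnihilate_anticomm : (ghAnnihilate e * ghAnnihilate f : Module.End ℂ (Fock n d)) +
    ghAnnihilate f * ghAnnihilate e = 0 := by
  refine hom_ext_ket fun s => ?_
  simp only [LinearMap.add_apply, Module.End.mul_apply, ghAnnihilate_ket, LinearMap.zero_apply]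
  rcases eq_or_ne e f with rfl | hef
  · by_cases h : e ∈ s.gh <;> simp [h, ghAnnihilate_ket]
  by_cases h : e ∈ s.gh <;> by_cases h' : f ∈ s.gh <;>
    simp only [h, h', if_true, if_false, map_zero, map_smul, ghAnnihilate_ket, Finset.mem_erase,
      hef, hef.symm, ne_eq, not_false_eq_true, and_self, and_false, smul_zero, add_zero]
  rw [ghSign_erase _ _ _ h, ghSign_erase _ _ _ h', smul_smul, smul_smul, Finset.erase_right_comm,
    ← add_smul]
  rcases hef.lt_or_gt with hlt | hlt <;> simp [hlt, hlt.not_gt] <;> ring_nf <;> simp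

lemma ghCreate_anticomm_ghAnnihilate : (ghCreate e * ghAnnihilate f : Module.End ℂ (Fock n d)) +
    ghAnnihilate f * ghCreate e = if e = f then 1 else 0 := by
  refine hom_ext_ket fun s => ?_
  simp only [LinearMap.add_apply, Module.End.mul_apply, ghAnnihilate_ket, ghCreate_ket]
  rcases eq_or_ne e f with rfl | hef
  · by_cases h : e ∈ s.gh
    · simp [h, ghCreate_ket, ghSign_erase, ghSign_mul_self, smul_smul]
    · simp [h, ghAnnihilate_ket, ghSign_insert, ghSign_mul_self, smul_smul]
  by_cases h : e ∈ s.gh <;> by_cases h' : f ∈ s.gh <;>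
    simp only [h, h', if_true, if_false, map_zero, map_smul, ghAnnihilate_ket, ghCreate_ket,
      Finset.mem_erase, Finset.mem_insert, or_false, or_true,
      hef, hef.symm, ne_eq, not_false_eq_true, and_self, and_false, smul_zero, add_zero,
      LinearMap.zero_apply]
  rw [ghSign_erase _ _ _ h', ghSign_insert _ _ _ h, smul_smul, smul_smul,
    Finset.erase_insert_of_ne hef, ← add_smul]
  rcases hef.lt_or_gt with hlt | hlt <;> simp [hlt, hlt.not_gt] <;> ring_nf <;> simp

/-! ### Commutators of the oscillators -/

lemma zeroMode_mk (B : (Bool × ℕ+ × (Fin n ⊕ Fin d)) →₀ ℕ) (S : Finset (ℤ ×ₗ Bool)) :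
    zeroMode g χ ⟨s.mom, s.tmom, s.wind, B, S⟩ i = zeroMode g χ s i := by
  cases i <;> simp [zeroMode]

lemma alpha_zero_commute_bosCreate :
    Commute (alpha g χ 0 i : Module.End ℂ (Fock n d)) (bosCreate v) := by
  refine hom_ext_ket fun s => ?_
  simp only [Module.End.mul_apply, alpha_zero_ket, bosCreate_ket, map_smul]
  rw [zeroMode_mk]

lemma alpha_zero_commute_bosAnnihilate :
    Commute (alpha g χ 0 i : Module.End ℂ (Fock n d)) (bosAnnihilate v) := by
  refine hom_ext_ket fun s => ?_
  simp only [Module.End.mul_apply, alpha_zero_ket, bosAnnihilate_ket, map_smul]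
  rw [smul_comm, zeroMode_mk]

lemma alpha_zero_commute_ghCreate :
    Commute (alpha g χ 0 i : Module.End ℂ (Fock n d)) (ghCreate e) := by
  refine hom_ext_ket fun s => ?_
  simp only [Module.End.mul_apply, alpha_zero_ket, ghCreate_ket, map_smul]
  split_ifs
  · simp
  · rw [map_smul, alpha_zero_ket, smul_comm, zeroMode_mk]

lemma alpha_zero_commute_ghAnnihilate :
    Commute (alpha g χ 0 i : Module.End ℂ (Fock n d)) (ghAnnihilate e) := by
  refine hom_ext_ket fun s => ?_
  simp only [Module.End.mul_apply, alpha_zero_ket, ghAnnihilate_ket, map_smul]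
  split_ifs
  · rw [map_smul, alpha_zero_ket, smul_comm, zeroMode_mk]
  · simp

lemma alpha_zero_commute_alpha_zero :
    Commute (alpha g χ 0 i : Module.End ℂ (Fock n d)) (alpha g χ' 0 j) := by
  refine hom_ext_ket fun s => ?_
  simp only [Module.End.mul_apply, alpha_zero_ket, map_smul]
  rw [smul_comm]

lemma bosCreate_commute_ghCreate : Commute (bosCreate v : Module.End ℂ (Fock n d)) (ghCreate e) := by
  refine hom_ext_ket fun s => ?_
  simp only [Module.End.mul_apply, bosCreate_ket, ghCreate_ket]
  split_ifs <;> simp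

lemma bosCreate_commute_ghAnnihilate :
    Commute (bosCreate v : Module.End ℂ (Fock n d)) (ghAnnihilate e) := by
  refine hom_ext_ket fun s => ?_
  simp only [Module.End.mul_apply, bosCreate_ket, ghAnnihilate_ket]
  split_ifs <;> simp

lemma bosAnnihilate_commute_ghCreate :
    Commute (bosAnnihilate v : Module.End ℂ (Fock n d)) (ghCreate e) := by
  refine hom_ext_ket fun s => ?_
  simp only [Module.End.mul_apply, bosAnnihilate_ket, ghCreate_ket, map_smul]
  split_ifs
  · simp
  · rw [map_smul, bosAnnihilate_ket, smul_comm]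

lemma bosAnnihilate_commute_ghAnnihilate :
    Commute (bosAnnihilate v : Module.End ℂ (Fock n d)) (ghAnnihilate e) := by
  refine hom_ext_ket fun s => ?_
  simp only [Module.End.mul_apply, bosAnnihilate_ket, ghAnnihilate_ket, map_smul]
  split_ifs
  · rw [map_smul, bosAnnihilate_ket, smul_comm]
  · simp

/-- Matter oscillators commute with everything that commutes with their constituents. -/
lemma alpha_commute_of {A : Module.End ℂ (Fock n d)} (k : ℤ)
    (h0 : Commute (alpha g χ 0 i : Module.End ℂ (Fock n d)) A)
    (hc : ∀ m : ℕ+, k = -(m : ℤ) → Commute (bosCreate (χ, m, i)) A)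
    (ha : ∀ m : ℕ+, k = m → ∀ j, Commute (bosAnnihilate (χ, m, j)) A) :
    Commute (alpha g χ k i : Module.End ℂ (Fock n d)) A := by
  rcases int_trichotomy k with rfl | ⟨m, rfl⟩ | ⟨m, rfl⟩
  · exact h0
  · rw [alpha_pos]
    exact Commute.sum_left _ _ _ fun j _ => (ha m rfl j).smul_left _
  · rw [alpha_neg]
    exact hc m rfl

lemma alpha_commute_ghCreate (k : ℤ) :
    Commute (alpha g χ k i : Module.End ℂ (Fock n d)) (ghCreate e) :=
  alpha_commute_of g χ i k (alpha_zero_commute_ghCreate _ _ _ _)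
    (fun _ _ => bosCreate_commute_ghCreate _ _) fun _ _ _ => bosAnnihilate_commute_ghCreate _ _

lemma alpha_commute_ghAnnihilate (k : ℤ) :
    Commute (alpha g χ k i : Module.End ℂ (Fock n d)) (ghAnnihilate e) :=
  alpha_commute_of g χ i k (alpha_zero_commute_ghAnnihilate _ _ _ _)
    (fun _ _ => bosCreate_commute_ghAnnihilate _ _)
    fun _ _ _ => bosAnnihilate_commute_ghAnnihilate _ _

lemma alpha_commute_bOsc (k l : ℤ) :
    Commute (alpha g χ k i : Module.End ℂ (Fock n d)) (bOsc χ' l) := by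
  unfold bOsc
  split_ifs
  exacts [alpha_commute_ghAnnihilate _ _ _ _ _, alpha_commute_ghCreate _ _ _ _ _]

lemma alpha_commute_cOsc (k l : ℤ) :
    Commute (alpha g χ k i : Module.End ℂ (Fock n d)) (cOsc χ' l) := by
  unfold cOsc
  split_ifs
  exacts [alpha_commute_ghCreate _ _ _ _ _, alpha_commute_ghAnnihilate _ _ _ _ _]

lemma alpha_zero_commute_alpha (l : ℤ) :
    Commute (alpha g χ 0 i : Module.End ℂ (Fock n d)) (alpha g χ' l j) :=
  (alpha_commute_of g χ' j l (alpha_zero_commute_alpha_zero _ _ _ _ _)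
    (fun _ _ => (alpha_zero_commute_bosCreate _ _ _ _).symm)
    fun _ _ _ => (alpha_zero_commute_bosAnnihilate _ _ _ _).symm).symm

lemma invMetric_symm (hg : g.PosDef) : invMetric n g i j = invMetric n g j i := by
  have h : (metric n g).transpose = metric n g := by
    have := hg.isHermitian
    rw [Matrix.IsHermitian, Matrix.conjTranspose_eq_transpose_of_trivial] at this
    simp [metric, minkowski, Matrix.fromBlocks_transpose, this]
  have h2 : ((metric n g)⁻¹).transpose = (metric n g)⁻¹ := by
    rw [Matrix.transpose_nonsing_inv, h]
  unfold invMetric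
  rw [← Matrix.transpose_apply (metric n g)⁻¹, h2]

lemma metric_symm (hg : g.PosDef) : metric n g i j = metric n g j i := by
  have h : (metric n g).transpose = metric n g := by
    have := hg.isHermitian
    rw [Matrix.IsHermitian, Matrix.conjTranspose_eq_transpose_of_trivial] at this
    simp [metric, minkowski, Matrix.fromBlocks_transpose, this]
  rw [← Matrix.transpose_apply (metric n g), h]

lemma metric_mul_invMetric (hg : g.PosDef) :
    ∑ p, (metric n g i p : ℂ) * invMetric n g p j = if i = j then 1 else 0 := by
  have h : IsUnit (metric n g).det := by
    rw [metric, Matrix.det_fromBlocks_zero₂₁, minkowski, Matrix.det_diagonal, isUnit_iff_ne_zero]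
    refine mul_ne_zero (Finset.prod_ne_zero_iff.2 fun i _ => ?_) hg.det_pos.ne'
    split_ifs <;> norm_num
  have h2 := congrFun (congrFun (Matrix.mul_nonsing_inv _ h) i) j
  rw [Matrix.mul_apply, Matrix.one_apply] at h2
  unfold invMetric
  rw [← Complex.ofReal_inj] at h2
  push_cast at h2
  rw [h2]
  split_ifs <;> simp

lemma sum_smul_mul_eq {ι A : Type*} [Fintype ι] [Ring A] [Algebra ℂ A] (a : ι → ℂ) (x z : ι → A)
    (y : A) (h : ∀ p, x p * y = y * x p + z p) :
    (∑ p, a p • x p) * y = y * ∑ p, a p • x p + ∑ p, a p • z p := by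
  simp_rw [Finset.sum_mul, Finset.mul_sum, smul_mul_assoc, h, mul_smul_comm, smul_add,
    Finset.sum_add_distrib]

lemma alpha_pos_mul_alpha_neg (m q : ℕ+) :
    (alpha g χ (m : ℤ) i * alpha g χ' (-(q : ℤ)) j : Module.End ℂ (Fock n d)) =
      alpha g χ' (-(q : ℤ)) j * alpha g χ (m : ℤ) i +
      if χ = χ' ∧ m = q then ((m : ℂ) * invMetric n g i j) • 1 else 0 := by
  rw [alpha_pos, alpha_neg]
  refine (sum_smul_mul_eq (fun p => (m : ℂ) * invMetric n g i p)
    (fun p => (bosAnnihilate (χ, m, p) : Module.End ℂ (Fock n d)))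
    (fun p => if (χ, m, p) = (χ', q, j) then (1 : Module.End ℂ (Fock n d)) else 0)
    (bosCreate (χ', q, j)) fun p => bosAnnihilate_mul_bosCreate (χ, m, p) (χ', q, j)).trans ?_
  congr 1
  rw [Finset.sum_eq_single j]
  · by_cases h2 : χ = χ' <;> by_cases h3 : m = q <;> simp [h2, h3]
  · intro p _ h1
    simp [h1]
  · simp

lemma alpha_mul_alpha (hg : g.PosDef) (k l : ℤ) :
    (alpha g χ k i * alpha g χ' l j : Module.End ℂ (Fock n d)) = alpha g χ' l j * alpha g χ k i +
      if χ = χ' ∧ k + l = 0 then ((k : ℂ) * invMetric n g i j) • 1 else 0 := by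
  have hP (m q : ℕ+) : (m : ℤ) + -(q : ℤ) = 0 ↔ m = q := by
    rw [← sub_eq_add_neg, sub_eq_zero]; norm_cast
  rcases int_trichotomy k with rfl | ⟨m, rfl⟩ | ⟨m, rfl⟩
  · rw [(alpha_zero_commute_alpha g χ χ' i j l).eq]
    simp
  · rcases int_trichotomy l with rfl | ⟨q, rfl⟩ | ⟨q, rfl⟩
    · rw [(alpha_zero_commute_alpha g χ' χ j i _).eq]
      simp
    · rw [if_neg (by have := m.pos; have := q.pos; omega), add_zero, alpha_pos, alpha_pos]
      exact Commute.sum_left _ _ _ fun _ _ => Commute.sum_right _ _ _ fun _ _ =>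
        Commute.smul_left (Commute.smul_right (bosAnnihilate_mul_comm _ _) _) _
    · rw [alpha_pos_mul_alpha_neg]
      simp [hP]
  · rcases int_trichotomy l with rfl | ⟨q, rfl⟩ | ⟨q, rfl⟩
    · rw [(alpha_zero_commute_alpha g χ' χ j i _).eq]
      simp
    · rw [alpha_pos_mul_alpha_neg, add_assoc, invMetric_symm _ _ _ hg]
      have hP2 : -(m : ℤ) + q = 0 ↔ q = m := by rw [add_comm, hP]
      by_cases h1 : χ = χ'
      · by_cases h2 : q = m
        · subst h1 h2
          refine hom_ext_ket fun s => ?_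
          simp
        · simp [h2, hP2]
      · simp [h1, Ne.symm h1]
    · rw [if_neg (by have := m.pos; have := q.pos; omega), add_zero, alpha_neg, alpha_neg]
      exact bosCreate_mul_comm _ _

/-- The `b`'s that create carry labels with mode at least `2`, those that annihilate carry labels
with mode at most `1`, so they never contract. -/
lemma bOsc_anticomm (k l : ℤ) : (bOsc χ k * bOsc χ' l : Module.End ℂ (Fock n d)) +
    bOsc χ' l * bOsc χ k = 0 := by
  unfold bOsc
  split_ifs with h1 h2 h2
  · exact ghAnnihilate_anticomm _ _
  · rw [add_comm]
    refine (ghCreate_anticomm_ghAnnihilate _ _).trans (if_neg fun h => ?_)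
    have := congrArg (fun e => (ofLex e).1) h
    simp at this; omega
  · refine (ghCreate_anticomm_ghAnnihilate _ _).trans (if_neg fun h => ?_)
    have := congrArg (fun e => (ofLex e).1) h
    simp at this; omega
  · exact ghCreate_anticomm _ _

lemma cOsc_anticomm (k l : ℤ) : (cOsc χ k * cOsc χ' l : Module.End ℂ (Fock n d)) +
    cOsc χ' l * cOsc χ k = 0 := by
  unfold cOsc
  split_ifs with h1 h2 h2
  · exact ghCreate_anticomm _ _
  · refine (ghCreate_anticomm_ghAnnihilate _ _).trans (if_neg fun h => ?_)
    have := congrArg (fun e => (ofLex e).1) h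
    simp at this; omega
  · rw [add_comm]
    refine (ghCreate_anticomm_ghAnnihilate _ _).trans (if_neg fun h => ?_)
    have := congrArg (fun e => (ofLex e).1) h
    simp at this; omega
  · exact ghAnnihilate_anticomm _ _

lemma bOsc_anticomm_cOsc (k l : ℤ) : (bOsc χ k * cOsc χ' l : Module.End ℂ (Fock n d)) +
    cOsc χ' l * bOsc χ k = if χ = χ' ∧ k + l = 0 then 1 else 0 := by
  have key : (toLex (-k, χ) : ℤ ×ₗ Bool) = toLex (l, χ') ↔ χ = χ' ∧ k + l = 0 := by
    rw [toLex_inj, Prod.mk.injEq, and_comm]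
    exact and_congr_right fun _ => by omega
  unfold bOsc cOsc
  by_cases h1 : -1 ≤ k <;> by_cases h2 : l ≤ 1
  · rw [if_pos h1, if_pos h2, add_comm]
    refine (ghCreate_anticomm_ghAnnihilate _ _).trans (if_congr ?_ rfl rfl)
    rw [eq_comm, key]
  · rw [if_pos h1, if_neg h2, if_neg (by omega)]
    exact ghAnnihilate_anticomm _ _
  · rw [if_neg h1, if_pos h2, if_neg (by omega)]
    exact ghCreate_anticomm _ _
  · rw [if_neg h1, if_neg h2]
    exact (ghCreate_anticomm_ghAnnihilate _ _).trans (if_congr key rfl rfl)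

end

end ClosedString

namespace ClosedString

noncomputable section

/-! ### Locally finite sums of operators -/

section LocFin

variable {E : Type*} [AddCommGroup E] [Module ℂ E]

/-- A family of operators of which only finitely many act nontrivially on any given vector. -/
def LocFin (T : ℤ → Module.End ℂ E) : Prop := ∀ x, {m | T m x ≠ 0}.Finite

open scoped Classical in
/-- The sum of a locally finite family of operators. -/
def locSum (T : ℤ → Module.End ℂ E) : Module.End ℂ E :=
  if h : LocFin T then
    { toFun := fun x => ∑ᶠ m, T m x
      map_add' := fun x y => by
        simp_rw [map_add]
        exact finsum_add_distrib (h x) (h y)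
      map_smul' := fun c x => by
        simp_rw [map_smul]
        exact (smul_finsum' c (h x)).symm }
  else 0

variable {S T : ℤ → Module.End ℂ E}

lemma locSum_apply (h : LocFin T) (x : E) : locSum T x = ∑ᶠ m, T m x := by
  rw [locSum, dif_pos h]; rfl

lemma locSum_apply_eq_zero (x : E) (hx : ∀ m, T m x = 0) : locSum T x = 0 := by
  by_cases h : LocFin T
  · rw [locSum_apply h]
    simp [hx]
  · simp [locSum, h]

lemma LocFin.mul_left (h : LocFin T) (A : Module.End ℂ E) : LocFin fun m => A * T m :=
  fun x => (h x).subset fun m hm h0 => hm (by simp [Module.End.mul_apply, h0])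

lemma LocFin.mul_right (h : LocFin T) (A : Module.End ℂ E) : LocFin fun m => T m * A :=
  fun x => h (A x)

lemma LocFin.add (hS : LocFin S) (hT : LocFin T) : LocFin fun m => S m + T m :=
  fun x => ((hS x).union (hT x)).subset fun m hm => by
    by_contra h
    simp only [Set.mem_union, Set.mem_ofPred_eq, not_or, not_not] at h
    exact hm (by simp [h.1, h.2])

lemma LocFin.sub (hS : LocFin S) (hT : LocFin T) : LocFin fun m => S m - T m :=
  fun x => ((hS x).union (hT x)).subset fun m hm => by
    by_contra h
    simp only [Set.mem_union, Set.mem_ofPred_eq, not_or, not_not] at h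
    exact hm (by simp [h.1, h.2])

lemma LocFin.smul (hT : LocFin T) (c : ℂ) : LocFin fun m => c • T m :=
  fun x => (hT x).subset fun m hm h => hm (by simp [h])

lemma LocFin.comp_equiv (hT : LocFin T) (e : ℤ ≃ ℤ) : LocFin fun m => T (e m) :=
  fun x => (hT x).preimage e.injective.injOn

lemma locFin_single (k : ℤ) (A : Module.End ℂ E) : LocFin fun m => if m = k then A else 0 :=
  fun x => (Set.finite_singleton k).subset fun m hm => by
    by_contra h
    exact hm (by simp only [Set.mem_singleton_iff] at h; simp [h])

lemma locSum_single (k : ℤ) (A : Module.End ℂ E) :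
    locSum (fun m => if m = k then A else 0) = A := by
  ext x
  rw [locSum_apply (locFin_single k A), finsum_eq_single _ k fun m hm => by simp [hm]]
  simp

lemma mul_locSum (h : LocFin T) (A : Module.End ℂ E) :
    A * locSum T = locSum fun m => A * T m := by
  ext x
  rw [Module.End.mul_apply, locSum_apply h, locSum_apply (h.mul_left A)]
  exact A.toAddMonoidHom.map_finsum (h x)

lemma locSum_mul (h : LocFin T) (A : Module.End ℂ E) :
    locSum T * A = locSum fun m => T m * A := by
  ext x
  rw [Module.End.mul_apply, locSum_apply h, locSum_apply (h.mul_right A)]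
  rfl

lemma locSum_add (hS : LocFin S) (hT : LocFin T) :
    locSum (fun m => S m + T m) = locSum S + locSum T := by
  ext x
  rw [LinearMap.add_apply, locSum_apply hS, locSum_apply hT, locSum_apply (hS.add hT)]
  exact finsum_add_distrib (hS x) (hT x)

lemma locSum_sub (hS : LocFin S) (hT : LocFin T) :
    locSum (fun m => S m - T m) = locSum S - locSum T := by
  ext x
  rw [LinearMap.sub_apply, locSum_apply hS, locSum_apply hT, locSum_apply (hS.sub hT)]
  exact finsum_sub_distrib (hS x) (hT x)

lemma locSum_smul (hT : LocFin T) (c : ℂ) : locSum (fun m => c • T m) = c • locSum T := by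
  ext x
  rw [LinearMap.smul_apply, locSum_apply hT, locSum_apply (hT.smul c)]
  exact (smul_finsum' c (hT x)).symm

lemma locSum_comp_equiv (hT : LocFin T) (e : ℤ ≃ ℤ) : locSum (fun m => T (e m)) = locSum T := by
  ext x
  rw [locSum_apply hT, locSum_apply (hT.comp_equiv e)]
  exact finsum_comp_equiv e (f := fun m => T m x)

lemma locSum_eq_sum (hT : LocFin T) (x : E) (s : Finset ℤ) (hs : ∀ m ∉ s, T m x = 0) :
    locSum T x = ∑ m ∈ s, T m x := by
  rw [locSum_apply hT]
  refine finsum_eq_sum_of_support_subset _ fun m hm => ?_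
  by_contra h
  exact hm (hs m h)

lemma locFin_of_bound (h : ∀ x, ∃ M N : ℤ, ∀ m, m ≤ M ∨ N ≤ m → T m x = 0) : LocFin T := by
  intro x
  obtain ⟨M, N, hx⟩ := h x
  refine (Set.finite_Icc M N).subset fun m hm => ?_
  by_contra h
  refine hm (hx m ?_)
  rw [Set.mem_Icc] at h
  omega

lemma locSum_mul_sub_mul (h : LocFin T) (A : Module.End ℂ E) :
    locSum T * A - A * locSum T = locSum fun m => T m * A - A * T m := by
  rw [locSum_mul h, mul_locSum h, locSum_sub (h.mul_right A) (h.mul_left A)]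

lemma mul_sub_locSum_mul (h : LocFin T) (A : Module.End ℂ E) :
    A * locSum T - locSum T * A = locSum fun m => A * T m - T m * A := by
  rw [locSum_mul h, mul_locSum h, locSum_sub (h.mul_left A) (h.mul_right A)]

lemma commute_locSum (h : LocFin T) {A : Module.End ℂ E} (hA : ∀ m, Commute A (T m)) :
    Commute A (locSum T) := by
  rw [commute_iff_eq, mul_locSum h, locSum_mul h]
  exact congrArg _ (funext fun m => hA m)

end LocFin

/-- `opSum` is prescribed on basis states only, whereas `locSum` is a finite sum on every vector and
can be multiplied and commuted termwise. -/
lemma opSum_eq_locSum {n d : ℕ} {T : ℤ → Module.End ℂ (Fock n d)} (hT : LocFin T) :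
    opSum T = locSum T := by
  refine hom_ext_ket fun s => ?_
  rw [opSum, ofKet_ket, locSum_apply hT]

end

end ClosedString

namespace ClosedString

noncomputable section

/-! ### Matter oscillators and ghosts in an arbitrary representation -/

section Ring

variable {A : Type*} [Ring A]

lemma mul_mul_sub_mul_mul (x y z : A) :
    x * y * z - z * (x * y) = x * (y * z - z * y) + (x * z - z * x) * y := by noncomm_ring

lemma mul_mul_sub_mul_mul_eq_anti (x y z : A) :
    x * y * z - z * (x * y) = x * (y * z + z * y) - (x * z + z * x) * y := by noncomm_ring

end Ring

/-- A representation of the oscillators of the closed bosonic string that is generated by vectors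
which all annihilation oscillators kill. -/
structure OscillatorRep (ι E : Type*) [Fintype ι] [DecidableEq ι] [AddCommGroup E]
    [Module ℂ E] where
  G : ι → ι → ℂ
  Ginv : ι → ι → ℂ
  a : Bool → ℤ → ι → Module.End ℂ E
  b : Bool → ℤ → Module.End ℂ E
  c : Bool → ℤ → Module.End ℂ E
  vac : Set E
  G_symm : ∀ i j, G i j = G j i
  G_mul_Ginv : ∀ i j, ∑ p, G i p * Ginv p j = if i = j then 1 else 0
  aa : ∀ χ χ' k l i j, a χ k i * a χ' l j - a χ' l j * a χ k i =
    (if χ = χ' ∧ k + l = 0 then (k : ℂ) * Ginv i j else 0) • 1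
  ab : ∀ χ χ' k l i, a χ k i * b χ' l - b χ' l * a χ k i = 0
  ac : ∀ χ χ' k l i, a χ k i * c χ' l - c χ' l * a χ k i = 0
  bb : ∀ χ χ' k l, b χ k * b χ' l + b χ' l * b χ k = 0
  cc : ∀ χ χ' k l, c χ k * c χ' l + c χ' l * c χ k = 0
  bc : ∀ χ χ' k l, b χ k * c χ' l + c χ' l * b χ k =
    (if χ = χ' ∧ k + l = 0 then (1 : ℂ) else 0) • 1
  bounded : ∀ x, ∃ N : ℤ, ∀ χ k, N ≤ k → (∀ i, a χ k i x = 0) ∧ b χ k x = 0 ∧ c χ k x = 0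
  vac_a : ∀ v ∈ vac, ∀ χ k i, 0 < k → a χ k i v = 0
  vac_b : ∀ v ∈ vac, ∀ χ k, -1 ≤ k → b χ k v = 0
  vac_c : ∀ v ∈ vac, ∀ χ k, 2 ≤ k → c χ k v = 0
  generate : ∀ p : Submodule ℂ E, vac ⊆ p →
    (∀ x ∈ p, ∀ χ k, (∀ i, a χ k i x ∈ p) ∧ b χ k x ∈ p ∧ c χ k x ∈ p) → p = ⊤

namespace OscillatorRep

variable {ι E : Type*} [Fintype ι] [DecidableEq ι] [AddCommGroup E] [Module ℂ E]
  (R : OscillatorRep ι E)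

/-- The normal ordered product `:α_r^i α_s^j:`. -/
def normalAA (χ : Bool) (r s : ℤ) (i j : ι) : Module.End ℂ E :=
  if r ≤ s then R.a χ r i * R.a χ s j else R.a χ s j * R.a χ r i

/-- The normal ordered product `:b_r c_s:`. -/
def normalBC (χ : Bool) (r s : ℤ) : Module.End ℂ E :=
  if 2 ≤ s then R.b χ r * R.c χ s else -(R.c χ s * R.b χ r)

/-- The contraction `½ G_{ij} f^{ij}`. -/
def contract (f : ι → ι → Module.End ℂ E) : Module.End ℂ E :=
  (1 / 2 : ℂ) • ∑ i, ∑ j, R.G i j • f i j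

/-- The terms of the matter Virasoro generators. -/
def matterTerm (χ : Bool) (k m : ℤ) : Module.End ℂ E := R.contract (R.normalAA χ (k - m) m)

/-- The terms of the ghost Virasoro generators. -/
def ghostTerm (χ : Bool) (k m : ℤ) : Module.End ℂ E :=
  ((k + m : ℤ) : ℂ) • R.normalBC χ (k - m) m

/-- The matter Virasoro generators. -/
def Lm (χ : Bool) (k : ℤ) : Module.End ℂ E := locSum (R.matterTerm χ k)

/-- The ghost Virasoro generators. -/
def Lg (χ : Bool) (k : ℤ) : Module.End ℂ E := locSum (R.ghostTerm χ k)

/-- The total Virasoro generators. -/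
def L (χ : Bool) (k : ℤ) : Module.End ℂ E := R.Lm χ k + R.Lg χ k

/-- The Virasoro generators which enter the BRST charge. -/
def Y (χ : Bool) (k : ℤ) : Module.End ℂ E := R.Lm χ k + (1 / 2 : ℂ) • R.Lg χ k

/-- The terms of the BRST charge. -/
def chargeTerm (χ : Bool) (k : ℤ) : Module.End ℂ E :=
  if 2 ≤ -k then R.Y χ k * R.c χ (-k) else R.c χ (-k) * R.Y χ k

/-- A chiral half of the BRST charge. -/
def chiralCharge (χ : Bool) : Module.End ℂ E := locSum (R.chargeTerm χ)

/-- The BRST charge. -/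
def Q : Module.End ℂ E := R.chiralCharge false + R.chiralCharge true

/-! ### Local finiteness -/

/-- All oscillators with mode number at least `N` annihilate `x`. -/
def Bound (x : E) (N : ℤ) : Prop :=
  2 ≤ N ∧ ∀ χ k, N ≤ k → (∀ i, R.a χ k i x = 0) ∧ R.b χ k x = 0 ∧ R.c χ k x = 0

lemma exists_bound (x : E) : ∃ N, R.Bound x N := by
  obtain ⟨N, hN⟩ := R.bounded x
  exact ⟨max 2 N, le_max_left _ _, fun χ k hk => hN χ k ((le_max_right _ _).trans hk)⟩

variable {R} {x : E} {N : ℤ} (χ χ' : Bool)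

lemma normalAA_apply_eq_zero (r s : ℤ) (i j : ι) (h : ∀ k i, max r s ≤ k → R.a χ k i x = 0) :
    R.normalAA χ r s i j x = 0 := by
  unfold normalAA
  split_ifs with hrs
  · rw [Module.End.mul_apply, h s j (by simp [hrs]), map_zero]
  · rw [Module.End.mul_apply, h r i (by simp; omega), map_zero]

lemma contract_apply_eq_zero (f : ι → ι → Module.End ℂ E) (h : ∀ i j, f i j x = 0) :
    R.contract f x = 0 := by
  simp [contract, h]

lemma Bound.matterTerm (hx : R.Bound x N) (k m : ℤ) (hm : m ≤ k - N ∨ N ≤ m) :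
    R.matterTerm χ k m x = 0 :=
  contract_apply_eq_zero _ fun i j => normalAA_apply_eq_zero _ _ _ _ _ fun l i' hl =>
    (hx.2 χ l (by rw [max_le_iff] at hl; omega)).1 i'

lemma Bound.normalBC (hx : R.Bound x N) (r s : ℤ) (h : N ≤ r ∨ N ≤ s) :
    R.normalBC χ r s x = 0 := by
  have hN := hx.1
  unfold OscillatorRep.normalBC
  split_ifs with hs
  · rcases h with h | h
    · have h1 := R.bc χ χ r s
      rw [if_neg (by omega), zero_smul] at h1
      have h2 := congrArg (fun A : Module.End ℂ E => A x) h1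
      simpa [(hx.2 χ r h).2.1] using h2
    · simp [(hx.2 χ s h).2.2]
  · simp [(hx.2 χ r (by omega)).2.1]

lemma Bound.ghostTerm (hx : R.Bound x N) (k m : ℤ) (hm : m ≤ k - N ∨ N ≤ m) :
    R.ghostTerm χ k m x = 0 := by
  rw [OscillatorRep.ghostTerm, LinearMap.smul_apply, hx.normalBC _ _ _ (by omega), smul_zero]

variable (R)

lemma locFin_matterTerm (k : ℤ) : LocFin (R.matterTerm χ k) :=
  locFin_of_bound fun x => by
    obtain ⟨N, hN⟩ := R.exists_bound x
    exact ⟨_, _, hN.matterTerm χ k⟩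

lemma locFin_ghostTerm (k : ℤ) : LocFin (R.ghostTerm χ k) :=
  locFin_of_bound fun x => by
    obtain ⟨N, hN⟩ := R.exists_bound x
    exact ⟨_, _, hN.ghostTerm χ k⟩

variable {R}

lemma Bound.Lm (hx : R.Bound x N) (k : ℤ) (hk : 2 * N ≤ k) : R.Lm χ k x = 0 :=
  locSum_apply_eq_zero _ fun m => hx.matterTerm _ _ _ (by omega)

lemma Bound.Lg (hx : R.Bound x N) (k : ℤ) (hk : 2 * N ≤ k) : R.Lg χ k x = 0 :=
  locSum_apply_eq_zero _ fun m => hx.ghostTerm _ _ _ (by omega)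

lemma Bound.Y (hx : R.Bound x N) (k : ℤ) (hk : 2 * N ≤ k) : R.Y χ k x = 0 := by
  simp [OscillatorRep.Y, hx.Lm χ k hk, hx.Lg χ k hk]

variable (R)

lemma locFin_chargeTerm : LocFin (R.chargeTerm χ) :=
  locFin_of_bound fun x => by
    obtain ⟨N, hN⟩ := R.exists_bound x
    have h2 := hN.1
    refine ⟨-N, 2 * N, fun m hm => ?_⟩
    unfold chargeTerm
    rcases hm with hm | hm
    · rw [if_pos (by omega), Module.End.mul_apply, (hN.2 χ (-m) (by omega)).2.2, map_zero]
    · rw [if_neg (by omega), Module.End.mul_apply, hN.Y χ m hm, map_zero]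

/-! ### Commutators of the Virasoro generators with the oscillators -/

lemma contract_mul_sub (f : ι → ι → Module.End ℂ E) (A : Module.End ℂ E) :
    R.contract f * A - A * R.contract f = R.contract fun i j => f i j * A - A * f i j := by
  simp only [contract, smul_mul_assoc, mul_smul_comm, Finset.sum_mul, Finset.mul_sum, smul_sub,
    Finset.sum_sub_distrib]

lemma mul_sub_contract (f : ι → ι → Module.End ℂ E) (A : Module.End ℂ E) :
    A * R.contract f - R.contract f * A = R.contract fun i j => A * f i j - f i j * A := by
  simp only [contract, smul_mul_assoc, mul_smul_comm, Finset.sum_mul, Finset.mul_sum, smul_sub,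
    Finset.sum_sub_distrib]

/-- The two orderings differ by a scalar, so the commutator does not see the normal ordering. -/
lemma normalAA_mul_sub (r s l : ℤ) (i j p : ι) :
    R.normalAA χ r s i j * R.a χ' l p - R.a χ' l p * R.normalAA χ r s i j =
      (if χ = χ' ∧ s + l = 0 then (s : ℂ) * R.Ginv j p else 0) • R.a χ r i +
      (if χ = χ' ∧ r + l = 0 then (r : ℂ) * R.Ginv i p else 0) • R.a χ s j := by
  unfold normalAA
  by_cases h : r ≤ s
  · rw [if_pos h, mul_mul_sub_mul_mul, R.aa, R.aa, mul_smul_comm, smul_mul_assoc, mul_one, one_mul]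
  · rw [if_neg h, mul_mul_sub_mul_mul, R.aa, R.aa, mul_smul_comm, smul_mul_assoc, mul_one, one_mul,
      add_comm]

lemma contract_Ginv_right (f : ι → Module.End ℂ E) (p : ι) (t : ℂ) :
    R.contract (fun i j => (t * R.Ginv j p) • f i) = (t / 2) • f p := by
  unfold contract
  have : ∀ i, ∑ j, R.G i j • (t * R.Ginv j p) • f i = if i = p then t • f p else 0 := by
    intro i
    simp_rw [smul_smul, ← Finset.sum_smul, mul_left_comm _ t, ← Finset.mul_sum, R.G_mul_Ginv]
    split_ifs with h <;> simp [h]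
  simp_rw [this]
  rw [Finset.sum_ite_eq' _ p, if_pos (Finset.mem_univ _), smul_smul]
  ring_nf

lemma contract_Ginv_left (f : ι → Module.End ℂ E) (p : ι) (t : ℂ) :
    R.contract (fun i j => (t * R.Ginv i p) • f j) = (t / 2) • f p := by
  rw [← R.contract_Ginv_right]
  unfold contract
  rw [Finset.sum_comm]
  simp_rw [R.G_symm]

lemma contract_add (f h : ι → ι → Module.End ℂ E) :
    R.contract (fun i j => f i j + h i j) = R.contract f + R.contract h := by
  simp [contract, Finset.sum_add_distrib]

lemma contract_zero : R.contract (fun _ _ => 0) = 0 := by simp [contract]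

lemma contract_smul (f : ι → ι → Module.End ℂ E) (t : ℂ) :
    R.contract (fun i j => t • f i j) = t • R.contract f := by
  simp [contract, smul_comm _ t, ← Finset.smul_sum]

/-- Either factor of the normal ordered product can contract with `α_l`, which happens at `m = -l`
and at `m = k + l`. Each gives half of the commutator with `L_k`, also when the two values coincide.
-/
lemma matterTerm_mul_sub (k m l : ℤ) (p : ι) :
    R.matterTerm χ k m * R.a χ' l p - R.a χ' l p * R.matterTerm χ k m =
      (if m = -l then (if χ = χ' then (-l / 2 : ℂ) else 0) • R.a χ (k + l) p else 0) +
      (if m = k + l then (if χ = χ' then (-l / 2 : ℂ) else 0) • R.a χ (k + l) p else 0) := by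
  rw [matterTerm, contract_mul_sub]
  simp_rw [normalAA_mul_sub]
  rw [contract_add]
  by_cases h : χ = χ'
  · subst h
    simp only [true_and, if_true]
    congr 1
    · split_ifs with h1 h2 h2
      · rw [contract_Ginv_right _ (fun i => R.a χ (k - m) i), h2, sub_neg_eq_add]; simp
      · omega
      · omega
      · simp [contract_zero]
    · split_ifs with h1 h2 h2
      · rw [contract_Ginv_left _ (fun i => R.a χ m i), h2]; simp
      · omega
      · omega
      · simp [contract_zero]
  · simp [h, contract_zero]

lemma Lm_mul_a (k l : ℤ) (p : ι) : R.Lm χ k * R.a χ' l p - R.a χ' l p * R.Lm χ k =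
    (if χ = χ' then (-l : ℂ) else 0) • R.a χ (k + l) p := by
  rw [Lm, locSum_mul_sub_mul (R.locFin_matterTerm χ k)]
  simp_rw [matterTerm_mul_sub]
  rw [locSum_add (locFin_single _ _) (locFin_single _ _), locSum_single, locSum_single, ← add_smul]
  split_ifs <;> ring_nf

lemma commute_a_of_aux {A : Module.End ℂ E} (k : ℤ) (h : ∀ k i, Commute A (R.a χ k i)) :
    Commute A (R.Lm χ k) := by
  refine commute_locSum (R.locFin_matterTerm χ k) fun m => ?_
  refine Commute.smul_right (Commute.sum_right _ _ _ fun i _ => Commute.sum_right _ _ _ fun j _ =>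
    Commute.smul_right ?_ _) _
  unfold normalAA
  split_ifs
  exacts [(h _ _).mul_right (h _ _), (h _ _).mul_right (h _ _)]

lemma Lm_mul_b (k l : ℤ) : R.Lm χ k * R.b χ' l - R.b χ' l * R.Lm χ k = 0 :=
  sub_eq_zero.2 (R.commute_a_of_aux χ k fun _ _ => (sub_eq_zero.1 (R.ab _ _ _ _ _)).symm).eq.symm

lemma Lm_mul_c (k l : ℤ) : R.Lm χ k * R.c χ' l - R.c χ' l * R.Lm χ k = 0 :=
  sub_eq_zero.2 (R.commute_a_of_aux χ k fun _ _ => (sub_eq_zero.1 (R.ac _ _ _ _ _)).symm).eq.symm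

lemma normalBC_mul_b (r s l : ℤ) : R.normalBC χ r s * R.b χ' l - R.b χ' l * R.normalBC χ r s =
    (if χ = χ' ∧ s + l = 0 then (1 : ℂ) else 0) • R.b χ r := by
  have h1 : R.c χ s * R.b χ' l + R.b χ' l * R.c χ s =
      (if χ = χ' ∧ s + l = 0 then (1 : ℂ) else 0) • 1 := by
    rw [add_comm, R.bc]
    simp_rw [eq_comm (a := χ'), add_comm l]
  unfold normalBC
  split_ifs
  all_goals
    first
    | rw [mul_mul_sub_mul_mul_eq_anti, h1, R.bb]
    | rw [neg_mul, mul_neg, ← neg_sub', mul_mul_sub_mul_mul_eq_anti, h1, R.bb]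
    simp [*]

lemma normalBC_mul_c (r s l : ℤ) : R.normalBC χ r s * R.c χ' l - R.c χ' l * R.normalBC χ r s =
    -((if χ = χ' ∧ r + l = 0 then (1 : ℂ) else 0) • R.c χ s) := by
  unfold normalBC
  split_ifs
  all_goals
    first
    | rw [mul_mul_sub_mul_mul_eq_anti, R.cc, R.bc]
    | rw [neg_mul, mul_neg, ← neg_sub', mul_mul_sub_mul_mul_eq_anti, R.cc, R.bc]
    simp [*]

lemma Lg_mul_b (k l : ℤ) : R.Lg χ k * R.b χ' l - R.b χ' l * R.Lg χ k =
    (if χ = χ' then (k - l : ℂ) else 0) • R.b χ (k + l) := by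
  rw [Lg, locSum_mul_sub_mul (R.locFin_ghostTerm χ k),
    ← locSum_single (-l) ((if χ = χ' then (k - l : ℂ) else 0) • R.b χ (k + l))]
  congr 1
  funext m
  rw [ghostTerm, smul_mul_assoc, mul_smul_comm, ← smul_sub, normalBC_mul_b]
  by_cases h : χ = χ'
  · by_cases h2 : m = -l
    · subst h2; simp [h, sub_eq_add_neg]
    · have : ¬ m + l = 0 := by omega
      simp [h, h2, this]
  · simp [h]

lemma Lg_mul_c (k l : ℤ) : R.Lg χ k * R.c χ' l - R.c χ' l * R.Lg χ k =
    (if χ = χ' then (-(2 * k + l) : ℂ) else 0) • R.c χ (k + l) := by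
  rw [Lg, locSum_mul_sub_mul (R.locFin_ghostTerm χ k),
    ← locSum_single (k + l) ((if χ = χ' then (-(2 * k + l) : ℂ) else 0) • R.c χ (k + l))]
  congr 1
  funext m
  rw [ghostTerm, smul_mul_assoc, mul_smul_comm, ← smul_sub, normalBC_mul_c]
  by_cases h : χ = χ'
  · by_cases h2 : m = k + l
    · subst h2; simp [h]; rw [← neg_smul]; congr 1; ring
    · have : ¬ k - m + l = 0 := by omega
      simp [h, h2, this]
  · simp [h]

lemma commute_bc_of_aux {A : Module.End ℂ E} (k : ℤ) (h : ∀ k, Commute A (R.b χ k))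
    (h' : ∀ k, Commute A (R.c χ k)) : Commute A (R.Lg χ k) := by
  refine commute_locSum (R.locFin_ghostTerm χ k) fun m => ?_
  refine Commute.smul_right ?_ _
  unfold normalBC
  split_ifs
  exacts [(h _).mul_right (h' _), ((h' _).mul_right (h _)).neg_right]

lemma Lg_mul_a (k l : ℤ) (i : ι) : R.Lg χ k * R.a χ' l i - R.a χ' l i * R.Lg χ k = 0 :=
  sub_eq_zero.2 (R.commute_bc_of_aux χ k (fun _ => sub_eq_zero.1 (R.ab _ _ _ _ _))
    (fun _ => sub_eq_zero.1 (R.ac _ _ _ _ _))).eq.symm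

lemma L_mul_a (k l : ℤ) (i : ι) : R.L χ k * R.a χ' l i - R.a χ' l i * R.L χ k =
    (if χ = χ' then (-l : ℂ) else 0) • R.a χ (k + l) i := by
  rw [L, add_mul, mul_add, add_sub_add_comm, Lm_mul_a, Lg_mul_a, add_zero]

lemma L_mul_b (k l : ℤ) : R.L χ k * R.b χ' l - R.b χ' l * R.L χ k =
    (if χ = χ' then (k - l : ℂ) else 0) • R.b χ (k + l) := by
  rw [L, add_mul, mul_add, add_sub_add_comm, Lm_mul_b, Lg_mul_b, zero_add]

lemma L_mul_c (k l : ℤ) : R.L χ k * R.c χ' l - R.c χ' l * R.L χ k =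
    (if χ = χ' then (-(2 * k + l) : ℂ) else 0) • R.c χ (k + l) := by
  rw [L, add_mul, mul_add, add_sub_add_comm, Lm_mul_c, Lg_mul_c, zero_add]

end OscillatorRep

end

end ClosedString

namespace ClosedString

noncomputable section

namespace OscillatorRep

variable {ι E : Type*} [Fintype ι] [DecidableEq ι] [AddCommGroup E] [Module ℂ E]
  (R : OscillatorRep ι E) (χ χ' : Bool)

/-! ### The Virasoro algebra -/

/-- The kernel of `A` contains the vacua and is stable under all oscillators, so `generate` makes it
the whole space. -/
lemma eq_zero_of_commute {A : Module.End ℂ E} (ha : ∀ χ k i, Commute A (R.a χ k i))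
    (hb : ∀ χ k, Commute A (R.b χ k)) (hc : ∀ χ k, Commute A (R.c χ k))
    (hv : ∀ v ∈ R.vac, A v = 0) : A = 0 := by
  refine LinearMap.ker_eq_top.1 (R.generate _ hv fun x hx χ k => ?_)
  rw [LinearMap.mem_ker] at hx
  refine ⟨fun i => ?_, ?_, ?_⟩
  · rw [LinearMap.mem_ker, ← Module.End.mul_apply, (ha χ k i).eq, Module.End.mul_apply, hx, map_zero]
  · rw [LinearMap.mem_ker, ← Module.End.mul_apply, (hb χ k).eq, Module.End.mul_apply, hx, map_zero]
  · rw [LinearMap.mem_ker, ← Module.End.mul_apply, (hc χ k).eq, Module.End.mul_apply, hx, map_zero]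

lemma commute_L_of_ne (h : χ ≠ χ') (k l : ℤ) : Commute (R.L χ k) (R.L χ' l) := by
  refine Commute.add_right (R.commute_a_of_aux χ' l fun m i => ?_)
    (R.commute_bc_of_aux χ' l (fun m => ?_) fun m => ?_)
  · exact sub_eq_zero.1 ((R.L_mul_a χ χ' k m i).trans (by simp [h]))
  · exact sub_eq_zero.1 ((R.L_mul_b χ χ' k m).trans (by simp [h]))
  · exact sub_eq_zero.1 ((R.L_mul_c χ χ' k m).trans (by simp [h]))

/-- The deviation from the Witt algebra. -/
def anomaly (k l : ℤ) : Module.End ℂ E :=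
  R.L χ k * R.L χ l - R.L χ l * R.L χ k - (k - l : ℂ) • R.L χ (k + l)

lemma anomaly_swap (k l : ℤ) : R.anomaly χ k l = -R.anomaly χ l k := by
  unfold anomaly
  rw [add_comm l k, ← neg_sub (k : ℂ) l, neg_smul]
  abel

/-- By the Jacobi identity for commutators. The condition on `f` says that the modes `o p` span a
representation of the Witt algebra, so the commutator of two `L`'s and the expected single `L` act
on them alike. -/
lemma commute_anomaly (o : ℤ → Module.End ℂ E) (f : ℤ → ℤ → ℂ)
    (ho : ∀ k p, R.L χ k * o p - o p * R.L χ k = f k p • o (k + p))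
    (hf : ∀ k l p, f l p * f k (l + p) - f k p * f l (k + p) = (k - l) * f (k + l) p) (k l p : ℤ) :
    Commute (R.anomaly χ k l) (o p) := by
  rw [commute_iff_eq, ← sub_eq_zero]
  have key : ∀ X Y Z O : Module.End ℂ E, ∀ t : ℂ, (X * Y - Y * X - t • Z) * O - O * (X * Y - Y * X - t • Z)
      = (X * (Y * O - O * Y) - (Y * O - O * Y) * X) - (Y * (X * O - O * X) - (X * O - O * X) * Y)
        - t • (Z * O - O * Z) := by
    intro X Y Z O t
    simp only [sub_mul, mul_sub, smul_mul_assoc, mul_smul_comm, smul_sub, mul_assoc]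
    abel
  rw [anomaly, key, ho, ho, ho, mul_smul_comm, smul_mul_assoc, mul_smul_comm, smul_mul_assoc,
    ← smul_sub, ← smul_sub, ho, ho, smul_smul, smul_smul, smul_smul, add_left_comm l k p,
    ← add_assoc, ← sub_smul, ← sub_smul, hf, sub_self, zero_smul]

lemma commute_anomaly_of_commute (A : Module.End ℂ E) (hA : ∀ k, Commute (R.L χ k) A)
    (k l : ℤ) : Commute (R.anomaly χ k l) A :=
  (((hA k).mul_left (hA l)).sub_left ((hA l).mul_left (hA k))).sub_left ((hA _).smul_left _)

lemma anomaly_commute_a (k l p : ℤ) (i : ι) : Commute (R.anomaly χ k l) (R.a χ' p i) := by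
  by_cases h : χ = χ'
  · subst h
    exact R.commute_anomaly χ (fun p => R.a χ p i) (fun _ p => -p)
      (fun k p => (R.L_mul_a χ χ k p i).trans (by simp)) (fun k l p => by push_cast; ring) k l p
  · exact R.commute_anomaly_of_commute χ _
      (fun k => sub_eq_zero.1 ((R.L_mul_a χ χ' k _ i).trans (by simp [h]))) k l

lemma anomaly_commute_b (k l p : ℤ) : Commute (R.anomaly χ k l) (R.b χ' p) := by
  by_cases h : χ = χ'
  · subst h
    exact R.commute_anomaly χ (fun p => R.b χ p) (fun k p => k - p)
      (fun k p => (R.L_mul_b χ χ k p).trans (by simp)) (fun k l p => by push_cast; ring) k l p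
  · exact R.commute_anomaly_of_commute χ _
      (fun k => sub_eq_zero.1 ((R.L_mul_b χ χ' k _).trans (by simp [h]))) k l

lemma anomaly_commute_c (k l p : ℤ) : Commute (R.anomaly χ k l) (R.c χ' p) := by
  by_cases h : χ = χ'
  · subst h
    exact R.commute_anomaly χ (fun p => R.c χ p) (fun k p => -(2 * k + p))
      (fun k p => (R.L_mul_c χ χ k p).trans (by simp)) (fun k l p => by push_cast; ring) k l p
  · exact R.commute_anomaly_of_commute χ _
      (fun k => sub_eq_zero.1 ((R.L_mul_c χ χ' k _).trans (by simp [h]))) k l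

/-- Vectors killed by all annihilation oscillators. -/
def IsVacuum (v : E) : Prop := ∀ χ k,
  (∀ i, 0 < k → R.a χ k i v = 0) ∧ (-1 ≤ k → R.b χ k v = 0) ∧ (2 ≤ k → R.c χ k v = 0)

variable {R}

lemma isVacuum_of_mem {v : E} (hv : v ∈ R.vac) : R.IsVacuum v := fun χ k =>
  ⟨fun i hk => R.vac_a v hv χ k i hk, R.vac_b v hv χ k, R.vac_c v hv χ k⟩

/-- The image of a generating vacuum need not lie in `vac`; `IsVacuum` is the condition stable under
such operators, in particular under `anomaly`. -/
lemma IsVacuum.map {v : E} (hv : R.IsVacuum v) {A : Module.End ℂ E}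
    (ha : ∀ χ k i, Commute A (R.a χ k i)) (hb : ∀ χ k, Commute A (R.b χ k))
    (hc : ∀ χ k, Commute A (R.c χ k)) : R.IsVacuum (A v) := by
  refine fun χ k => ⟨fun i hk => ?_, fun hk => ?_, fun hk => ?_⟩
  · rw [← Module.End.mul_apply, ← (ha χ k i).eq, Module.End.mul_apply, (hv χ k).1 i hk, map_zero]
  · rw [← Module.End.mul_apply, ← (hb χ k).eq, Module.End.mul_apply, (hv χ k).2.1 hk, map_zero]
  · rw [← Module.End.mul_apply, ← (hc χ k).eq, Module.End.mul_apply, (hv χ k).2.2 hk, map_zero]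

lemma IsVacuum.normalBC {v : E} (hv : R.IsVacuum v) (r s : ℤ) (h : -1 ≤ r ∨ 2 ≤ s) :
    R.normalBC χ r s v = 0 := by
  unfold OscillatorRep.normalBC
  split_ifs with hs
  · simp [(hv χ s).2.2 hs]
  · simp [(hv χ r).2.1 (by omega)]

lemma IsVacuum.matterTerm {v : E} (hv : R.IsVacuum v) (k m : ℤ) (h : 0 < k - m ∨ 0 < m) :
    R.matterTerm χ k m v = 0 :=
  contract_apply_eq_zero _ fun i j => normalAA_apply_eq_zero _ _ _ _ _ fun l i' hl =>
    (hv χ l).1 i' (by rw [max_le_iff] at hl; omega)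

lemma IsVacuum.L_apply {v : E} (hv : R.IsVacuum v) (k : ℤ) (hk : 0 < k) : R.L χ k v = 0 := by
  have h1 : R.Lm χ k v = 0 := locSum_apply_eq_zero _ fun m => hv.matterTerm χ k m (by omega)
  have h2 : R.Lg χ k v = 0 := locSum_apply_eq_zero _ fun m => by
    rw [ghostTerm, LinearMap.smul_apply, hv.normalBC χ _ _ (by omega), smul_zero]
  simp [L, h1, h2]

/-- The zero mode part of `L_0`. -/
def zeroModePart (R : OscillatorRep ι E) (χ : Bool) : Module.End ℂ E :=
  R.contract fun i j => R.a χ 0 i * R.a χ 0 j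

lemma IsVacuum.L_zero_apply {v : E} (hv : R.IsVacuum v) : R.L χ 0 v = R.zeroModePart χ v := by
  have h2 : R.Lg χ 0 v = 0 := locSum_apply_eq_zero _ fun m => by
    rw [ghostTerm, LinearMap.smul_apply, hv.normalBC χ _ _ (by omega), smul_zero]
  have h1 : R.Lm χ 0 v = R.zeroModePart χ v := by
    rw [Lm, locSum_eq_sum (R.locFin_matterTerm χ 0) v {0} fun m hm =>
      hv.matterTerm χ 0 m (by rw [Finset.mem_singleton] at hm; omega), Finset.sum_singleton]
    rw [OscillatorRep.matterTerm, zeroModePart, sub_zero]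
    congr 2
  simp [L, h1, h2]

variable (R)

lemma commute_contract {A : Module.End ℂ E} {f : ι → ι → Module.End ℂ E}
    (h : ∀ i j, Commute A (f i j)) : Commute A (R.contract f) :=
  Commute.smul_right (Commute.sum_right _ _ _ fun i _ => Commute.sum_right _ _ _ fun j _ =>
    Commute.smul_right (h i j) _) _

lemma weight_mul (X A B : Module.End ℂ E) (s t : ℂ) (hA : X * A - A * X = s • A)
    (hB : X * B - B * X = t • B) : X * (A * B) - (A * B) * X = (s + t) • (A * B) := by
  have : X * (A * B) - (A * B) * X = (X * A - A * X) * B + A * (X * B - B * X) := by noncomm_ring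
  rw [this, hA, hB, smul_mul_assoc, mul_smul_comm, add_smul]

/-- `L_k` has weight `-k` under `L_0`. -/
lemma L_zero_mul_L (k : ℤ) : R.L χ 0 * R.L χ k - R.L χ k * R.L χ 0 = (-k : ℂ) • R.L χ k := by
  have ha (r : ℤ) (i : ι) : R.L χ 0 * R.a χ r i - R.a χ r i * R.L χ 0 = (-r : ℂ) • R.a χ r i := by
    rw [R.L_mul_a]; simp
  have hb (r : ℤ) : R.L χ 0 * R.b χ r - R.b χ r * R.L χ 0 = (-r : ℂ) • R.b χ r := by
    rw [R.L_mul_b]; simp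
  have hc (r : ℤ) : R.L χ 0 * R.c χ r - R.c χ r * R.L χ 0 = (-r : ℂ) • R.c χ r := by
    rw [R.L_mul_c]; simp
  have h1 : R.L χ 0 * R.Lm χ k - R.Lm χ k * R.L χ 0 = (-k : ℂ) • R.Lm χ k := by
    rw [Lm, mul_sub_locSum_mul (R.locFin_matterTerm χ k), ← locSum_smul (R.locFin_matterTerm χ k)]
    congr 1
    funext m
    rw [matterTerm, mul_sub_contract, ← contract_smul]
    congr 1
    funext i j
    unfold normalAA
    split_ifs
    · rw [weight_mul _ _ _ _ _ (ha _ _) (ha _ _)]; congr 1; push_cast; ring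
    · rw [weight_mul _ _ _ _ _ (ha _ _) (ha _ _)]; congr 1; push_cast; ring
  have h2 : R.L χ 0 * R.Lg χ k - R.Lg χ k * R.L χ 0 = (-k : ℂ) • R.Lg χ k := by
    rw [Lg, mul_sub_locSum_mul (R.locFin_ghostTerm χ k), ← locSum_smul (R.locFin_ghostTerm χ k)]
    congr 1
    funext m
    rw [ghostTerm, smul_mul_assoc, mul_smul_comm, ← smul_sub, smul_comm (-k : ℂ)]
    congr 1
    unfold normalBC
    split_ifs
    · rw [weight_mul _ _ _ _ _ (hb _) (hc _)]; congr 1; push_cast; ring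
    · rw [mul_neg, neg_mul, ← neg_sub', weight_mul _ _ _ _ _ (hc _) (hb _), smul_neg]
      congr 2; push_cast; ring
  have h3 : R.L χ 0 * R.L χ k - R.L χ k * R.L χ 0 = (R.L χ 0 * R.Lm χ k - R.Lm χ k * R.L χ 0) +
      (R.L χ 0 * R.Lg χ k - R.Lg χ k * R.L χ 0) := by
    rw [L.eq_def R χ k, mul_add, add_mul]; abel
  rw [h3, h1, h2, ← smul_add, L.eq_def R χ k]

lemma L_zero_mul_anomaly (k l : ℤ) :
    R.L χ 0 * R.anomaly χ k l - R.anomaly χ k l * R.L χ 0 = (-(k + l) : ℂ) • R.anomaly χ k l := by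
  have h1 := weight_mul _ _ _ _ _ (R.L_zero_mul_L χ k) (R.L_zero_mul_L χ l)
  have h2 := weight_mul _ _ _ _ _ (R.L_zero_mul_L χ l) (R.L_zero_mul_L χ k)
  have h3 := R.L_zero_mul_L χ (k + l)
  have h4 : R.L χ 0 * R.anomaly χ k l - R.anomaly χ k l * R.L χ 0 =
      (R.L χ 0 * (R.L χ k * R.L χ l) - (R.L χ k * R.L χ l) * R.L χ 0) -
      (R.L χ 0 * (R.L χ l * R.L χ k) - (R.L χ l * R.L χ k) * R.L χ 0) -
      (k - l : ℂ) • (R.L χ 0 * R.L χ (k + l) - R.L χ (k + l) * R.L χ 0) := by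
    unfold anomaly
    simp only [mul_sub, sub_mul, mul_smul_comm, smul_mul_assoc, smul_sub]
    abel
  rw [h4, h1, h2, h3, anomaly, smul_sub, smul_sub, smul_comm]
  have e1 : (-k + -l : ℂ) = -(k + l) := by ring
  have e2 : (-l + -k : ℂ) = -(k + l) := by ring
  rw [e1, e2, Int.cast_add]

/-- On vacua `L_0` is a function of the zero modes, with which the anomaly commutes. So its
commutator with `L_0` vanishes on `v`, although it is `-(k + l)` times the anomaly. -/
lemma anomaly_apply_of_ne {v : E} (hv : R.IsVacuum v) (k l : ℤ) (h : k + l ≠ 0) :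
    R.anomaly χ k l v = 0 := by
  have h1 := (hv.map (R.anomaly_commute_a χ · k l) (R.anomaly_commute_b χ · k l)
    (R.anomaly_commute_c χ · k l)).L_zero_apply χ
  have h2 : Commute (R.anomaly χ k l) (R.zeroModePart χ) := R.commute_contract fun i j =>
    (R.anomaly_commute_a χ χ k l 0 i).mul_right (R.anomaly_commute_a χ χ k l 0 j)
  have h3 := congrArg (fun A : Module.End ℂ E => A v) (R.L_zero_mul_anomaly χ k l)
  simp only [LinearMap.sub_apply, Module.End.mul_apply, LinearMap.smul_apply] at h3
  rw [h1, hv.L_zero_apply χ, ← Module.End.mul_apply, ← h2.eq, Module.End.mul_apply, sub_self] at h3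
  have h4 : (-(k + l) : ℂ) ≠ 0 := by
    rw [neg_ne_zero]; exact_mod_cast h
  exact (smul_eq_zero.1 h3.symm).resolve_left h4

end OscillatorRep

end

end ClosedString

namespace ClosedString

noncomputable section

namespace OscillatorRep

variable {ι E : Type*} [Fintype ι] [DecidableEq ι] [AddCommGroup E] [Module ℂ E]
  (R : OscillatorRep ι E) (χ χ' : Bool)

/-! ### The central charge in 26 dimensions -/

lemma contract_apply (f : ι → ι → Module.End ℂ E) (x : E) :
    R.contract f x = (1 / 2 : ℂ) • ∑ i, ∑ j, R.G i j • f i j x := by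
  simp [contract, LinearMap.sum_apply]

/-- The trace of the identity counts the matter fields; this is where the dimension enters. -/
lemma contract_Ginv : R.contract (fun i j => R.Ginv i j • 1) = (Fintype.card ι / 2 : ℂ) • 1 := by
  unfold contract
  rw [Finset.sum_comm]
  have : ∀ j, ∑ i, R.G i j • R.Ginv i j • (1 : Module.End ℂ E) = 1 := by
    intro j
    simp_rw [smul_smul, ← Finset.sum_smul, fun i => R.G_symm i j, R.G_mul_Ginv, if_true, one_smul]
  simp_rw [this]
  simp [← Nat.cast_smul_eq_nsmul ℂ, smul_smul, div_eq_inv_mul]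

lemma normalAA_of_ne (r s : ℤ) (i j : ι) (h : r + s ≠ 0) :
    R.normalAA χ r s i j = R.a χ r i * R.a χ s j := by
  unfold normalAA
  split_ifs with hrs
  · rfl
  · have := R.aa χ χ r s i j
    rw [if_neg (by simp [h]), zero_smul, sub_eq_zero] at this
    exact this.symm

variable {R}

/-- `L_K` kills `v`, so only its commutators with the two oscillators remain. They give zero modes
at the end points `q = 0`, `q = K` and otherwise a contraction, with coefficient `(K - q) q`. -/
lemma IsVacuum.L_mul_normalAA {v : E} (hv : R.IsVacuum v) (K : ℕ) (hK : 0 < K) (q : ℕ)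
    (hq : q ≤ K) (i j : ι) : R.L χ K (R.normalAA χ (-K + q) (-q) i j v) =
      ((if q = K then (K : ℂ) else 0) + if q = 0 then (K : ℂ) else 0) •
        R.a χ 0 i (R.a χ 0 j v) + ((K - q) * q : ℂ) • R.Ginv i j • v := by
  have e1 (x : E) (l : ℤ) (p : ι) :
      R.L χ K (R.a χ l p x) = R.a χ l p (R.L χ K x) + (-l : ℂ) • R.a χ (K + l) p x := by
    have := congrArg (fun A : Module.End ℂ E => A x) (R.L_mul_a χ χ K l p)
    simp only [LinearMap.sub_apply, Module.End.mul_apply, if_true, LinearMap.smul_apply] at this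
    rw [← this]; abel
  have e2 : R.a χ q i (R.a χ (-q) j v) =
      R.a χ (-q) j (R.a χ q i v) + ((q : ℂ) * R.Ginv i j) • v := by
    have := congrArg (fun A : Module.End ℂ E => A v) (R.aa χ χ q (-q) i j)
    simp only [LinearMap.sub_apply, Module.End.mul_apply, LinearMap.smul_apply,
      Module.End.one_apply, true_and, add_neg_cancel, if_true] at this
    rw [Int.cast_natCast] at this
    rw [← this]; abel
  rw [R.normalAA_of_ne _ _ _ _ _ (by omega), Module.End.mul_apply, e1, e1, hv.L_apply χ K (by omega),
    map_zero, zero_add, map_smul, ← add_assoc, add_neg_cancel, zero_add]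
  have h1 : (-((-q : ℤ) : ℂ)) • R.a χ (-K + q) i (R.a χ (K + -q) j v) =
      (if q = K then (K : ℂ) else 0) • R.a χ 0 i (R.a χ 0 j v) := by
    split_ifs with h
    · subst h; simp
    · rw [(hv χ _).1 j (by omega), map_zero, smul_zero, zero_smul]
  have h2 : (-((-K + q : ℤ) : ℂ)) • R.a χ q i (R.a χ (-q) j v) =
      (if q = 0 then (K : ℂ) else 0) • R.a χ 0 i (R.a χ 0 j v) +
        ((K - q) * q : ℂ) • R.Ginv i j • v := by
    split_ifs with h
    · subst h; simp
    · rw [e2, (hv χ _).1 i (by omega), map_zero, zero_add, zero_smul, zero_add, smul_smul, smul_smul]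
      congr 1; push_cast; ring
  rw [h1, h2, add_smul, add_assoc]

lemma IsVacuum.L_mul_matterTerm {v : E} (hv : R.IsVacuum v) (K : ℕ) (hK : 0 < K) (q : ℕ)
    (hq : q ≤ K) : R.L χ K (R.matterTerm χ (-K) (-q) v) =
      ((if q = K then (K : ℂ) else 0) + if q = 0 then (K : ℂ) else 0) • R.zeroModePart χ v +
        ((K - q) * q * (Fintype.card ι / 2) : ℂ) • v := by
  have h1 : ((K - q) * q * (Fintype.card ι / 2) : ℂ) • v = ((K - q) * q : ℂ) •
      R.contract (fun i j => R.Ginv i j • 1) v := by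
    rw [contract_Ginv]; simp [smul_smul]
  rw [h1, zeroModePart, OscillatorRep.matterTerm, contract_apply, contract_apply, contract_apply, map_smul,
    smul_comm _ (1 / 2 : ℂ), smul_comm _ (1 / 2 : ℂ), ← smul_add]
  congr 1
  simp_rw [map_sum, map_smul, sub_neg_eq_add, hv.L_mul_normalAA χ K hK q hq, Finset.smul_sum,
    ← Finset.sum_add_distrib]
  refine Finset.sum_congr rfl fun i _ => Finset.sum_congr rfl fun j _ => ?_
  rw [smul_add, smul_comm (R.G i j), smul_comm (R.G i j)]
  rfl

lemma IsVacuum.L_mul_ghostTerm {v : E} (hv : R.IsVacuum v) (K : ℕ) (q : ℕ)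
    (hq : q < K) : R.L χ K (R.ghostTerm χ (-K) (1 - q) v) =
      ((1 - q - K) * (2 * K + 1 - q) : ℂ) • v := by
  have hc (x : E) (l : ℤ) : R.L χ K (R.c χ l x) =
      R.c χ l (R.L χ K x) + (-(2 * K + l) : ℂ) • R.c χ (K + l) x := by
    have := congrArg (fun A : Module.End ℂ E => A x) (R.L_mul_c χ χ K l)
    simp only [LinearMap.sub_apply, Module.End.mul_apply, if_true, LinearMap.smul_apply] at this
    rw [Int.cast_natCast] at this
    rw [← this]; abel
  have hb (x : E) (l : ℤ) : R.L χ K (R.b χ l x) =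
      R.b χ l (R.L χ K x) + (K - l : ℂ) • R.b χ (K + l) x := by
    have := congrArg (fun A : Module.End ℂ E => A x) (R.L_mul_b χ χ K l)
    simp only [LinearMap.sub_apply, Module.End.mul_apply, if_true, LinearMap.smul_apply] at this
    rw [Int.cast_natCast] at this
    rw [← this]; abel
  have hcb : R.c χ (K + (1 - q)) (R.b χ (-K - (1 - q)) v) = v := by
    have := congrArg (fun A : Module.End ℂ E => A v) (R.bc χ χ (-K - (1 - q)) (K + (1 - q)))
    simp only [LinearMap.add_apply, Module.End.mul_apply, LinearMap.smul_apply,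
      Module.End.one_apply, true_and] at this
    rw [(hv χ _).2.2 (by omega), map_zero, zero_add, if_pos (by ring), one_smul] at this
    exact this
  rw [ghostTerm, OscillatorRep.normalBC, if_neg (by omega), LinearMap.smul_apply, LinearMap.neg_apply,
    Module.End.mul_apply, map_smul, map_neg, hc, hb, hv.L_apply χ K (by omega), map_zero, zero_add,
    map_smul, (hv χ (K + (-K - (1 - q)))).2.1 (by omega), map_zero, smul_zero, zero_add, hcb,
    ← neg_smul, smul_smul]
  congr 1
  push_cast
  ring

/-- Here 13 is half of 26. The matter sum is `26/12 (K³ - K)` and the ghost sum its negative. No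
term linear in `K` is left over, because the ordering refers to the `SL(2,ℂ)` invariant vacuum. -/
lemma sum_range_card_cast (K : ℕ) :
    ∑ q ∈ Finset.range (K + 1), ((K - q) * q * 13 : ℂ) +
      ∑ q ∈ Finset.range K, ((1 - q - K) * (2 * K + 1 - q) : ℂ) = 0 := by
  -- The parameter `k` is kept apart from the upper limit so that induction on the limit goes
  -- through.
  have h1 (N : ℕ) (k : ℂ) : ∑ q ∈ Finset.range N, ((k - q) * q * 13 : ℂ) =
      13 * (k * (N * (N - 1)) / 2 - (N - 1) * N * (2 * N - 1) / 6) := by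
    induction N with
    | zero => simp
    | succ N ih => rw [Finset.sum_range_succ, ih]; push_cast; ring
  have h2 (N : ℕ) (k : ℂ) : ∑ q ∈ Finset.range N, ((1 - q - k) * (2 * k + 1 - q) : ℂ) =
      N * (1 - k) * (2 * k + 1) - (2 + k) * (N * (N - 1)) / 2 +
        (N - 1) * N * (2 * N - 1) / 6 := by
    induction N with
    | zero => simp
    | succ N ih => rw [Finset.sum_range_succ, ih]; push_cast; ring
  rw [h1, h2]
  push_cast
  ring

lemma IsVacuum.L_mul_L {v : E} (hv : R.IsVacuum v) (hD : Fintype.card ι = 26) (K : ℕ)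
    (hK : 0 < K) : R.L χ K (R.L χ (-K) v) = (2 * K : ℂ) • R.zeroModePart χ v := by
  -- Outside this range one of the two oscillators annihilates the vacuum.
  have h1 : R.Lm χ (-K) v = ∑ q ∈ Finset.range (K + 1), R.matterTerm χ (-K) (-q) v := by
    rw [Lm, locSum_eq_sum (R.locFin_matterTerm χ (-K)) v
      ((Finset.range (K + 1)).map ⟨fun q : ℕ => -(q : ℤ), fun a b => by simp⟩), Finset.sum_map]
    · rfl
    · intro m hm
      refine hv.matterTerm χ _ m ?_
      by_contra h
      refine hm (Finset.mem_map.2 ⟨m.natAbs, ?_, ?_⟩)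
      · rw [Finset.mem_range]; omega
      · change -(m.natAbs : ℤ) = m
        omega
  have h2 : R.Lg χ (-K) v = ∑ q ∈ Finset.range K, R.ghostTerm χ (-K) (1 - q) v := by
    rw [Lg, locSum_eq_sum (R.locFin_ghostTerm χ (-K)) v
      ((Finset.range K).map ⟨fun q : ℕ => 1 - (q : ℤ), fun a b => by simp⟩), Finset.sum_map]
    · rfl
    · intro m hm
      rw [ghostTerm, LinearMap.smul_apply, hv.normalBC, smul_zero]
      by_contra h
      refine hm (Finset.mem_map.2 ⟨(1 - m).natAbs, ?_, ?_⟩)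
      · rw [Finset.mem_range]; omega
      · change 1 - ((1 - m).natAbs : ℤ) = m
        omega
  have h3 : R.L χ (-K) v = R.Lm χ (-K) v + R.Lg χ (-K) v := rfl
  rw [h3, h1, h2, map_add, map_sum, map_sum,
    Finset.sum_congr rfl fun q hq => hv.L_mul_matterTerm χ K hK q (by simp at hq; omega),
    Finset.sum_congr rfl fun q hq => hv.L_mul_ghostTerm χ K q (by simpa using hq),
    Finset.sum_add_distrib, ← Finset.sum_smul, ← Finset.sum_smul, ← Finset.sum_smul, hD, add_assoc,
    ← add_smul]
  have h4 := sum_range_card_cast K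
  norm_num at h4 ⊢
  rw [h4, zero_smul, add_zero, Finset.sum_add_distrib]
  simp [two_mul]

variable (R)

/-- The Virasoro algebra has vanishing central charge in the critical dimension. -/
lemma anomaly_eq_zero (hD : Fintype.card ι = 26) (k l : ℤ) : R.anomaly χ k l = 0 := by
  refine R.eq_zero_of_commute (R.anomaly_commute_a χ · k l) (R.anomaly_commute_b χ · k l)
    (R.anomaly_commute_c χ · k l) fun v hmem => ?_
  have hv := isVacuum_of_mem hmem
  by_cases h : k + l = 0
  · have key (K : ℕ) (hK : 0 < K) : R.anomaly χ K (-K) v = 0 := by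
      simp only [anomaly, LinearMap.sub_apply, Module.End.mul_apply, LinearMap.smul_apply]
      rw [hv.L_mul_L χ hD K hK, hv.L_apply χ K (by omega), map_zero, sub_zero, add_neg_cancel,
        hv.L_zero_apply, ← sub_smul]
      push_cast
      ring_nf
      simp
    rcases lt_trichotomy k 0 with hk | hk | hk
    · obtain ⟨K, rfl⟩ : ∃ K : ℕ, l = K := ⟨l.toNat, by omega⟩
      obtain rfl : k = -K := by omega
      rw [anomaly_swap, LinearMap.neg_apply, key K (by omega), neg_zero]
    · obtain rfl : l = 0 := by omega
      subst hk
      simp [anomaly]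
    · obtain ⟨K, rfl⟩ : ∃ K : ℕ, k = K := ⟨k.toNat, by omega⟩
      obtain rfl : l = -K := by omega
      exact key K (by omega)
  · exact R.anomaly_apply_of_ne χ hv k l h

/-! ### The BRST charge -/

lemma Y_mul_b (k l : ℤ) : R.Y χ k * R.b χ' l - R.b χ' l * R.Y χ k =
    (if χ = χ' then ((k - l) / 2 : ℂ) else 0) • R.b χ (k + l) := by
  rw [Y, add_mul, mul_add, add_sub_add_comm, Lm_mul_b, zero_add, smul_mul_assoc, mul_smul_comm,
    ← smul_sub, Lg_mul_b, smul_smul]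
  congr 1
  split_ifs <;> ring

/-- Contracting `c_{-k}` with `b_l` gives `Y_l`, and the commutator of `Y_k` with `b_l` gives half a
term of the ghost generator, so the sum over `k` raises the coefficient ½ in `Y` to 1. Both normal
orderings switch at the same mode of `c`, hence no constant appears. -/
lemma chargeTerm_mul_b (k l : ℤ) : R.chargeTerm χ k * R.b χ' l + R.b χ' l * R.chargeTerm χ k =
    (if k = l then (if χ = χ' then R.Y χ l else 0) else 0) +
      (if χ = χ' then (1 / 2 : ℂ) else 0) • R.ghostTerm χ l (-k) := by
  have e1 (X C B : Module.End ℂ E) :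
      X * C * B + B * (X * C) = X * (B * C + C * B) - (X * B - B * X) * C := by noncomm_ring
  have e2 (X C B : Module.End ℂ E) :
      C * X * B + B * (C * X) = (B * C + C * B) * X + C * (X * B - B * X) := by noncomm_ring
  by_cases h : χ = χ'
  · subst h
    rw [if_pos rfl, if_pos rfl, ghostTerm, normalBC, chargeTerm]
    by_cases hkl : k = l
    · subst hkl
      by_cases h2 : 2 ≤ -k
      · rw [if_pos h2, e1, R.bc, Y_mul_b]
        simp
      · rw [if_neg h2, e2, R.bc, Y_mul_b]
        simp
    · have hkl' : ¬(χ = χ ∧ l + -k = 0) := by rintro ⟨-, h⟩; omega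
      by_cases h2 : 2 ≤ -k
      · rw [if_pos h2, if_pos h2, e1, R.bc, Y_mul_b, if_neg hkl', if_neg hkl, if_pos rfl, zero_smul,
          mul_zero, zero_sub, zero_add, smul_mul_assoc, smul_smul, ← neg_smul, sub_neg_eq_add,
          add_comm l k]
        congr 1; push_cast; ring
      · rw [if_neg h2, if_neg h2, e2, R.bc, Y_mul_b, if_neg hkl', if_neg hkl, if_pos rfl, zero_smul,
          zero_mul, zero_add, zero_add, mul_smul_comm, smul_neg, smul_neg, smul_smul, ← neg_smul,
          sub_neg_eq_add, add_comm l k]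
        congr 1; push_cast; ring
  · have h' : χ' ≠ χ := Ne.symm h
    unfold chargeTerm
    by_cases h2 : 2 ≤ -k
    · rw [if_pos h2, e1, R.bc, Y_mul_b]; simp [h, h']
    · rw [if_neg h2, e2, R.bc, Y_mul_b]; simp [h, h']

lemma chiralCharge_mul_b (l : ℤ) : R.chiralCharge χ * R.b χ' l + R.b χ' l * R.chiralCharge χ =
    if χ = χ' then R.L χ l else 0 := by
  have hf := R.locFin_chargeTerm χ
  have hg : LocFin fun k => R.ghostTerm χ l (-k) := (R.locFin_ghostTerm χ l).comp_equiv (Equiv.neg ℤ)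
  rw [chiralCharge, locSum_mul hf, mul_locSum hf, ← locSum_add (hf.mul_right _) (hf.mul_left _)]
  simp_rw [chargeTerm_mul_b]
  rw [locSum_add (locFin_single _ _) (hg.smul _), locSum_single, locSum_smul hg,
    show locSum (fun k => R.ghostTerm χ l (-k)) = R.Lg χ l from
      locSum_comp_equiv (R.locFin_ghostTerm χ l) (Equiv.neg ℤ)]
  split_ifs
  · rw [Y, L, add_assoc, ← add_smul]
    norm_num
  · simp

lemma Q_mul_b (l : ℤ) : R.Q * R.b χ l + R.b χ l * R.Q = R.L χ l := by
  rw [Q, add_mul, mul_add, add_add_add_comm, chiralCharge_mul_b, chiralCharge_mul_b]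
  cases χ <;> simp

/-- By the graded Jacobi identity the anticommutator of `[Q, L_k]` with `b_l` is `[L_l, L_k]` plus
`L_{k+l}` with the Witt coefficient. These cancel because the anomaly vanishes. -/
lemma Q_lie_L_mul_b (hD : Fintype.card ι = 26) (k l : ℤ) :
    (R.Q * R.L χ k - R.L χ k * R.Q) * R.b χ' l =
      -(R.b χ' l * (R.Q * R.L χ k - R.L χ k * R.Q)) := by
  have e (q X B : Module.End ℂ E) : (q * X - X * q) * B + B * (q * X - X * q) =
      ((q * B + B * q) * X - X * (q * B + B * q)) +
        (q * (X * B - B * X) + (X * B - B * X) * q) := by noncomm_ring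
  rw [eq_neg_iff_add_eq_zero, e, Q_mul_b, L_mul_b, mul_smul_comm, smul_mul_assoc, ← smul_add,
    Q_mul_b]
  split_ifs with h
  · subst h
    have := R.anomaly_eq_zero χ hD l k
    rw [anomaly, sub_eq_zero] at this
    rw [this, add_comm l k, ← add_smul]
    simp
  · rw [zero_smul, add_zero, sub_eq_zero]
    exact R.commute_L_of_ne χ' χ (Ne.symm h) l k

lemma Q_sq_mul_b (l : ℤ) (h : R.Q * R.L χ l - R.L χ l * R.Q = 0) :
    R.Q * R.Q * R.b χ l = R.b χ l * (R.Q * R.Q) := by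
  have e (q B : Module.End ℂ E) : q * q * B - B * (q * q) =
      q * (q * B + B * q) - (q * B + B * q) * q := by noncomm_ring
  rw [← sub_eq_zero, e, Q_mul_b, h]

end OscillatorRep

end

end ClosedString

namespace ClosedString

noncomputable section

variable {n d : ℕ}

/-! ### The Fock space as a representation of the oscillators -/

lemma label_induction {P : FockLabel n d → Prop} (s : FockLabel n d)
    (vac : ∀ s : FockLabel n d, s.bos = 0 → s.gh = ∅ → P s)
    (bos : ∀ (s : FockLabel n d) v, P s → P { s with bos := s.bos + Finsupp.single v 1 })
    (gh : ∀ (s : FockLabel n d) e, e ∉ s.gh → P s → P { s with gh := insert e s.gh }) : P s := by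
  have h1 : ∀ (B : (Bool × ℕ+ × (Fin n ⊕ Fin d)) →₀ ℕ), P ⟨s.mom, s.tmom, s.wind, B, ∅⟩ := by
    intro B
    induction B using Finsupp.induction_linear with
    | zero => exact vac _ rfl rfl
    | add f h hf hh =>
      clear hf
      induction f using Finsupp.induction generalizing h with
      | zero => rwa [zero_add]
      | single_add v k f _ _ ih =>
        rw [add_assoc]
        have hk : ∀ k : ℕ, P ⟨s.mom, s.tmom, s.wind, Finsupp.single v k + (f + h), ∅⟩ := by
          intro k
          induction k with
          | zero => simpa using ih h hh
          | succ k ihk =>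
            have := bos _ v ihk
            simp only at this
            rwa [add_right_comm, ← Finsupp.single_add] at this
        exact hk k
    | single v k =>
      induction k with
      | zero => rw [Finsupp.single_zero]; exact vac _ rfl rfl
      | succ k ihk =>
        have := bos _ v ihk
        simp only at this
        rwa [← Finsupp.single_add] at this
  have h2 : ∀ S : Finset (ℤ ×ₗ Bool), P ⟨s.mom, s.tmom, s.wind, s.bos, S⟩ := by
    intro S
    induction S using Finset.induction_on with
    | empty => exact h1 _
    | insert e S he ih => exact gh _ e he ih
  exact h2 s.gh

lemma ket_insert (s : FockLabel n d) (e : ℤ ×ₗ Bool) (he : e ∉ s.gh) :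
    ket { s with gh := insert e s.gh } = ghSign s.gh e • ghCreate e (ket s) := by
  rw [ghCreate_ket, if_neg he, smul_smul, ghSign_mul_self, one_smul]

lemma ghCreate_eq (e : ℤ ×ₗ Bool) : (ghCreate e : Module.End ℂ (Fock n d)) =
    if (ofLex e).1 ≤ 1 then cOsc (ofLex e).2 (ofLex e).1 else bOsc (ofLex e).2 (-(ofLex e).1) := by
  split_ifs with h
  · rw [cOsc, if_pos h]; rfl
  · rw [bOsc, if_neg (by omega), neg_neg]; rfl

lemma fock_eq_top (p : Submodule ℂ (Fock n d)) (h : ∀ s, ket s ∈ p) : p = ⊤ :=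
  eq_top_iff.2 fun x _ => fock_induction x h p.zero_mem (fun _ _ => p.add_mem)
    fun c _ => p.smul_mem c

lemma exists_bound_ket (g : Matrix (Fin d) (Fin d) ℝ) (s : FockLabel n d) :
    ∃ N : ℤ, ∀ χ k, N ≤ k → (∀ i, alpha g χ k i (ket s) = 0) ∧ bOsc χ k (ket s) = 0 ∧
      cOsc χ k (ket s) = 0 := by
  obtain ⟨N, hN⟩ := (s.bos.support.image fun v => (v.2.1 : ℤ)).exists_le
  obtain ⟨M, hM⟩ := (s.gh.image fun e => |(ofLex e).1|).exists_le
  refine ⟨max 2 (max N M + 1), fun χ k hk => ?_⟩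
  have hk2 : 2 ≤ k := (le_max_left _ _).trans hk
  have hkN : N < k := by have := le_max_left N M; omega
  have hkM : M < k := by have := le_max_right N M; omega
  have hgh : ∀ e ∈ s.gh, |(ofLex e).1| < k := fun e he =>
    (hM _ (Finset.mem_image_of_mem _ he)).trans_lt hkM
  refine ⟨fun i => ?_, ?_, ?_⟩
  · rcases int_trichotomy k with rfl | ⟨m, rfl⟩ | ⟨m, rfl⟩
    · omega
    · rw [alpha_pos, LinearMap.sum_apply]
      refine Finset.sum_eq_zero fun j _ => ?_
      have : s.bos (χ, m, j) = 0 := by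
        by_contra h
        have := hN _ (Finset.mem_image_of_mem (fun v => (v.2.1 : ℤ)) (Finsupp.mem_support_iff.2 h))
        exact absurd hkN (not_lt.2 this)
      simp [this]
    · have := m.pos; omega
  · rw [bOsc, if_pos (by omega), ghAnnihilate_ket, if_neg]
    intro h
    have := hgh _ h
    simp only [ofLex_toLex, abs_neg] at this
    exact (le_abs_self k).not_gt this
  · rw [cOsc, if_neg (by omega), ghAnnihilate_ket, if_neg]
    intro h
    have := (le_abs_self _).trans_lt (hgh _ h)
    simp at this

/-- The Fock space as a representation of the oscillators. -/
def fockRep (n : ℕ) {d : ℕ} (g : Matrix (Fin d) (Fin d) ℝ) (hg : g.PosDef) :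
    OscillatorRep (Fin n ⊕ Fin d) (Fock n d) where
  G i j := (metric n g i j : ℂ)
  Ginv := invMetric n g
  a := alpha g
  b := bOsc
  c := cOsc
  vac := {v | ∃ s : FockLabel n d, s.bos = 0 ∧ s.gh = ∅ ∧ v = ket s}
  G_symm i j := by rw [metric_symm g i j hg]
  G_mul_Ginv i j := metric_mul_invMetric g i j hg
  aa χ χ' k l i j := by
    refine sub_eq_iff_eq_add'.2 ((alpha_mul_alpha g χ χ' i j hg k l).trans ?_)
    rw [ite_smul, zero_smul]
  ab χ χ' k l i := sub_eq_zero.2 (alpha_commute_bOsc g χ χ' i k l).eq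
  ac χ χ' k l i := sub_eq_zero.2 (alpha_commute_cOsc g χ χ' i k l).eq
  bb χ χ' k l := bOsc_anticomm χ χ' k l
  cc χ χ' k l := cOsc_anticomm χ χ' k l
  bc χ χ' k l := by
    refine (bOsc_anticomm_cOsc χ χ' k l).trans ?_
    rw [ite_smul, zero_smul, one_smul]
  bounded x := by
    refine fock_induction (p := fun x => ∃ N : ℤ, ∀ χ k, N ≤ k → (∀ i, alpha g χ k i x = 0) ∧
      bOsc χ k x = 0 ∧ cOsc χ k x = 0) x (exists_bound_ket g) ⟨0, fun χ k _ => by simp⟩ ?_ ?_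
    · rintro x y ⟨N, hN⟩ ⟨M, hM⟩
      refine ⟨max N M, fun χ k hk => ?_⟩
      obtain ⟨h1, h2, h3⟩ := hN χ k ((le_max_left _ _).trans hk)
      obtain ⟨h4, h5, h6⟩ := hM χ k ((le_max_right _ _).trans hk)
      simp [h1, h2, h3, h4, h5, h6]
    · rintro c x ⟨N, hN⟩
      refine ⟨N, fun χ k hk => ?_⟩
      obtain ⟨h1, h2, h3⟩ := hN χ k hk
      simp [h1, h2, h3]
  vac_a := by
    rintro _ ⟨s, hb, -, rfl⟩ χ k i hk
    rcases int_trichotomy k with rfl | ⟨m, rfl⟩ | ⟨m, rfl⟩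
    · omega
    · rw [alpha_pos, LinearMap.sum_apply]
      exact Finset.sum_eq_zero fun j _ => by simp [hb]
    · have := m.pos; omega
  vac_b := by
    rintro _ ⟨s, -, hgh, rfl⟩ χ k hk
    rw [bOsc, if_pos hk, ghAnnihilate_ket, if_neg (by simp [hgh])]
  vac_c := by
    rintro _ ⟨s, -, hgh, rfl⟩ χ k hk
    rw [cOsc, if_neg (by omega), ghAnnihilate_ket, if_neg (by simp [hgh])]
  generate p hv hp := by
    refine fock_eq_top p fun s => label_induction s (fun s h1 h2 => hv ⟨s, h1, h2, rfl⟩) ?_ ?_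
    · intro s v hs
      have := (hp _ hs v.1 (-(v.2.1 : ℤ))).1 v.2.2
      rwa [alpha_neg, bosCreate_ket] at this
    · intro s e he hs
      rw [ket_insert s e he, ghCreate_eq]
      refine p.smul_mem _ ?_
      split_ifs
      exacts [(hp _ hs _ _).2.2, (hp _ hs _ _).2.1]

variable (g : Matrix (Fin d) (Fin d) ℝ) (hg : g.PosDef) (χ χ' : Bool) (k l : ℤ)

lemma LMatter_eq : LMatter g χ k = (fockRep n g hg).Lm χ k :=
  opSum_eq_locSum ((fockRep n g hg).locFin_matterTerm χ k)

lemma LGhost_eq : (LGhost χ k : Module.End ℂ (Fock n d)) = (fockRep n g hg).Lg χ k :=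
  opSum_eq_locSum ((fockRep n g hg).locFin_ghostTerm χ k)

lemma Vir_eq : Vir g χ k = (fockRep n g hg).L χ k := by
  rw [Vir, LMatter_eq g hg, LGhost_eq g hg]; rfl

lemma chiralBRST_eq : chiralBRST g χ = (fockRep n g hg).chiralCharge χ := by
  rw [chiralBRST]
  simp_rw [LMatter_eq g hg, LGhost_eq g hg]
  exact opSum_eq_locSum ((fockRep n g hg).locFin_chargeTerm χ)

lemma QB_eq : QB n g = (fockRep n g hg).Q := by
  rw [QB, chiralBRST_eq g hg, chiralBRST_eq g hg]; rfl


end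

end ClosedString

namespace ClosedString

noncomputable section

variable {n d : ℕ}

/-! ### Weights and the spectrum of `L_0` -/

/-- `A` has weight `w` with respect to `X`, i.e. `[X, A] = w A`. -/
def HasWeight (X A : Fock n d →ₗ[ℂ] Fock n d) (w : ℂ) : Prop :=
  ∀ x, X (A x) = A (X x) + w • A x

section Weight

variable {X Y A B : Fock n d →ₗ[ℂ] Fock n d} {s t : ℂ}

lemma HasWeight.mul {A B : Module.End ℂ (Fock n d)} (hA : HasWeight X A s) (hB : HasWeight X B t) :
    HasWeight X (A * B) (s + t) := fun x => by
  rw [Module.End.mul_apply, hA, hB, map_add, map_smul, add_smul, add_assoc, Module.End.mul_apply,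
    add_comm (t • _)]

lemma HasWeight.smul (hA : HasWeight X A s) (c : ℂ) : HasWeight X (c • A) s := fun x => by
  simp [hA x, smul_comm s c]

lemma HasWeight.add (hA : HasWeight X A s) (hB : HasWeight X B s) : HasWeight X (A + B) s :=
  fun x => by simp only [LinearMap.add_apply, map_add, hA x, hB x, smul_add]; abel

lemma HasWeight.sub (hA : HasWeight X A s) (hB : HasWeight X B s) : HasWeight X (A - B) s :=
  fun x => by simp only [LinearMap.sub_apply, map_sub, hA x, hB x, smul_sub]; abel

lemma HasWeight.add_left (hX : HasWeight X A s) (hY : HasWeight Y A t) :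
    HasWeight (X + Y) A (s + t) :=
  fun x => by simp only [LinearMap.add_apply, map_add, hX x, hY x, add_smul]; abel

lemma HasWeight.sub_left (hX : HasWeight X A s) (hY : HasWeight Y A t) :
    HasWeight (X - Y) A (s - t) :=
  fun x => by simp only [LinearMap.sub_apply, map_sub, hX x, hY x, sub_smul]; abel

lemma hasWeight_one : HasWeight X (1 : Module.End ℂ (Fock n d)) 0 := fun x => by simp

lemma HasWeight.pow {A : Module.End ℂ (Fock n d)} (hA : HasWeight X A s) (m : ℕ) :
    HasWeight X (A ^ m) (m * s) := by
  induction m with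
  | zero => simpa using hasWeight_one
  | succ m ih =>
    rw [pow_succ, Nat.cast_succ, add_mul, one_mul]
    exact ih.mul hA

lemma hasWeight_list_prod {κ : Type*} (l : List κ) (f : κ → Module.End ℂ (Fock n d)) (w : κ → ℂ)
    (h : ∀ i, HasWeight X (f i) (w i)) : HasWeight X (l.map f).prod (l.map w).sum := by
  induction l with
  | nil => simpa using hasWeight_one
  | cons a l ih =>
    rw [List.map_cons, List.prod_cons, List.map_cons, List.sum_cons]
    exact (h a).mul ih

lemma HasWeight.of_mul_sub {X A : Module.End ℂ (Fock n d)} (h : X * A - A * X = s • A) :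
    HasWeight X A s := fun x => by
  have := congrArg (fun B : Module.End ℂ (Fock n d) => B x) h
  simp only [LinearMap.sub_apply, Module.End.mul_apply, LinearMap.smul_apply] at this
  rw [← this]; abel

end Weight

variable (g : Matrix (Fin d) (Fin d) ℝ) (hg : g.PosDef) (χ χ' : Bool)

include hg

lemma hasWeight_alpha (l : ℤ) (i : Fin n ⊕ Fin d) :
    HasWeight (Vir g χ 0) (alpha g χ' l i) (if χ = χ' then (-l : ℂ) else 0) := by
  rw [Vir_eq g hg]
  refine HasWeight.of_mul_sub (((fockRep n g hg).L_mul_a χ χ' 0 l i).trans ?_)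
  split_ifs with h
  · rw [h, zero_add]; rfl
  · rw [zero_smul, zero_smul]

lemma hasWeight_bOsc (l : ℤ) :
    HasWeight (Vir (n := n) g χ 0) (bOsc χ' l) (if χ = χ' then (-l : ℂ) else 0) := by
  rw [Vir_eq g hg]
  refine HasWeight.of_mul_sub (((fockRep n g hg).L_mul_b χ χ' 0 l).trans ?_)
  split_ifs with h
  · rw [h, zero_add, Int.cast_zero, zero_sub]; rfl
  · rw [zero_smul, zero_smul]

lemma hasWeight_cOsc (l : ℤ) :
    HasWeight (Vir (n := n) g χ 0) (cOsc χ' l) (if χ = χ' then (-l : ℂ) else 0) := by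
  rw [Vir_eq g hg]
  refine HasWeight.of_mul_sub (((fockRep n g hg).L_mul_c χ χ' 0 l).trans ?_)
  split_ifs with h
  · rw [h, zero_add, Int.cast_zero, mul_zero, zero_add]; rfl
  · rw [zero_smul, zero_smul]

omit hg

/-- The contribution of the zero modes to the eigenvalue of `L_0`. -/
def zeroModeEnergy (s : FockLabel n d) : ℂ :=
  (1 / 2 : ℂ) * ∑ i, ∑ j, (metric n g i j : ℂ) * ((zeroMode g χ s i : ℂ) * (zeroMode g χ s j : ℂ))

/-- The contribution of a matter excitation to the eigenvalue of `L_0`. -/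
def bosWeight (v : Bool × ℕ+ × (Fin n ⊕ Fin d)) : ℂ := if χ = v.1 then (v.2.1 : ℂ) else 0

/-- The contribution of a ghost excitation to the eigenvalue of `L_0`. -/
def ghWeight (e : ℤ ×ₗ Bool) : ℂ :=
  if χ = (ofLex e).2 then (if (ofLex e).1 ≤ 1 then -((ofLex e).1 : ℂ) else ((ofLex e).1 : ℂ)) else 0

/-- The contribution of the excitations to the eigenvalue of `L_0`. -/
def level (s : FockLabel n d) : ℂ :=
  (s.bos.sum fun v m => (m : ℂ) * bosWeight χ v) + ∑ e ∈ s.gh, ghWeight χ e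

/-- The eigenvalue of `L_0` at a basis state. -/
def virEntry (s : FockLabel n d) : ℂ := zeroModeEnergy g χ s + level χ s

include hg

/-- On a vacuum only the zero modes contribute, without an ordering constant, and every creation
oscillator adds its own weight. -/
lemma Vir_zero_ket (s : FockLabel n d) : Vir g χ 0 (ket s) = virEntry g χ s • ket s := by
  refine label_induction (P := fun s => Vir g χ 0 (ket s) = virEntry g χ s • ket s) s ?_ ?_ ?_
  · intro s h1 h2
    have hv : (fockRep n g hg).IsVacuum (ket s) :=
      OscillatorRep.isVacuum_of_mem ⟨s, h1, h2, rfl⟩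
    rw [Vir_eq g hg]
    refine (hv.L_zero_apply χ).trans ?_
    rw [OscillatorRep.zeroModePart, OscillatorRep.contract_apply]
    have e : ∀ i j, (fockRep n g hg).a χ 0 i ((fockRep n g hg).a χ 0 j (ket s)) =
        ((zeroMode g χ s i : ℂ) * (zeroMode g χ s j : ℂ)) • ket s := by
      intro i j
      change alpha g χ 0 i (alpha g χ 0 j (ket s)) = _
      rw [alpha_zero_ket, map_smul, alpha_zero_ket, smul_smul, mul_comm]
    simp_rw [Module.End.mul_apply, e, smul_smul, ← Finset.sum_smul, smul_smul]
    simp only [virEntry, level, h1, h2, Finsupp.sum_zero_index, Finset.sum_empty, add_zero]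
    rfl
  · intro s v hs
    have h1 := hasWeight_alpha g hg χ v.1 (-(v.2.1 : ℤ)) v.2.2 (ket s)
    rw [alpha_neg, bosCreate_ket, hs, map_smul, bosCreate_ket, ← add_smul] at h1
    refine h1.trans ?_
    congr 1
    simp only [virEntry, level, zeroModeEnergy, zeroMode_mk]
    rw [Finsupp.sum_add_index' (by simp) (by intros; push_cast; ring),
      Finsupp.sum_single_index (by simp), bosWeight]
    push_cast
    split_ifs <;> ring
  · intro s e he hs
    have h1 : HasWeight (Vir (n := n) g χ 0) (ghCreate e) (ghWeight χ e) := by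
      rw [ghCreate_eq, ghWeight]
      by_cases h3 : (ofLex e).1 ≤ 1
      · rw [if_pos h3, if_pos h3]
        exact hasWeight_cOsc g hg χ (ofLex e).2 (ofLex e).1
      · rw [if_neg h3, if_neg h3]
        simpa using hasWeight_bOsc (n := n) g hg χ (ofLex e).2 (-(ofLex e).1)
    rw [ket_insert s e he, map_smul, h1, hs, map_smul, ← add_smul, smul_comm]
    congr 1
    simp only [virEntry, level, zeroModeEnergy, zeroMode_mk]
    rw [Finset.sum_insert he]
    ring

omit hg

/-- The eigenvalue of `L_0^+` at a basis state. -/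
def plusEntry (s : FockLabel n d) : ℂ := virEntry g false s + virEntry g true s

include hg

lemma LPlus_ket (s : FockLabel n d) : LPlus n g (ket s) = plusEntry g s • ket s := by
  rw [LPlus, LinearMap.add_apply, Vir_zero_ket g hg, Vir_zero_ket g hg, ← add_smul, plusEntry]

lemma LPlusEntry_eq (s : FockLabel n d) : LPlusEntry n g s = plusEntry g s := by
  rw [LPlusEntry, LPlus_ket g hg]
  simp [ket]

omit hg

/-! ### Diagonal operators -/

/-- The operator that is diagonal in the Fock space basis with the given eigenvalues. -/
def diag (f : FockLabel n d → ℂ) : Fock n d →ₗ[ℂ] Fock n d := ofKet fun s => f s • ket s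

lemma diag_ket (f : FockLabel n d → ℂ) (s : FockLabel n d) : diag f (ket s) = f s • ket s :=
  ofKet_ket _ _

lemma diag_apply (f : FockLabel n d → ℂ) (x : Fock n d) (s : FockLabel n d) :
    diag f x s = f s * x s := by
  classical
  refine fock_induction (p := fun x => diag f x s = f s * x s) x (fun t => ?_) (by simp)
    (fun x y hx hy => by simp [hx, hy, mul_add]) fun c x hx => by simp [hx, mul_left_comm]
  rw [diag_ket]
  by_cases h : t = s
  · simp [h]
  · simp [ket, h]

lemma diag_diag (f h : FockLabel n d → ℂ) (x : Fock n d) :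
    diag f (diag h x) = diag (fun s => f s * h s) x := by
  ext s
  simp only [diag_apply, mul_assoc]

/-- An operator that commutes with a diagonal operator commutes with functions of it. -/
lemma diag_comp_comm {f : FockLabel n d → ℂ} {A : Fock n d →ₗ[ℂ] Fock n d}
    (hA : HasWeight (diag f) A 0) (φ : ℂ → ℂ) (x : Fock n d) :
    diag (fun s => φ (f s)) (A x) = A (diag (fun s => φ (f s)) x) := by
  have : diag (fun s => φ (f s)) ∘ₗ A = A ∘ₗ diag (fun s => φ (f s)) := by
    refine hom_ext_ket fun s => ?_
    rw [LinearMap.comp_apply, LinearMap.comp_apply, diag_ket, map_smul]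
    have h1 := hA (ket s)
    rw [diag_ket, map_smul, zero_smul, add_zero] at h1
    ext t
    have h2 := DFunLike.congr_fun h1 t
    rw [diag_apply, Finsupp.smul_apply, smul_eq_mul] at h2
    rw [diag_apply, Finsupp.smul_apply, smul_eq_mul]
    -- A nonzero matrix element of `A` between `s` and `t` forces `f s = f t`, hence equality of all
    -- functions of these eigenvalues.
    by_cases h3 : A (ket s) t = 0
    · rw [h3, mul_zero, mul_zero]
    · rw [mul_right_cancel₀ h3 h2]
  exact DFunLike.congr_fun this x

/-- The part of the identity on the kernel of a diagonal operator. -/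
def kerIndicator (z : ℂ) : ℂ := open scoped Classical in if z = 0 then 1 else 0

lemma LPlus_eq_diag (hg : g.PosDef) : LPlus n g = diag (plusEntry g) :=
  hom_ext_ket fun s => by rw [LPlus_ket g hg, diag_ket]

lemma projKer_eq_diag (hg : g.PosDef) :
    projKer n g = diag fun s => kerIndicator (plusEntry g s) :=
  hom_ext_ket fun s => by
    have h : ket s ≠ 0 := by simp [ket]
    rw [projKer, ofKet_ket, diag_ket, LPlus_ket g hg, kerIndicator]
    by_cases h2 : plusEntry g s = 0
    · simp [h2]
    · simp [h2, h]

lemma LPlusInv_eq_diag (hg : g.PosDef) : LPlusInv n g = diag fun s => (plusEntry g s)⁻¹ :=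
  hom_ext_ket fun s => by rw [LPlusInv, ofKet_ket, diag_ket, LPlusEntry_eq g hg]

/-- `(L_0^+)⁻¹ (1 - Π)`. -/
def partialInv (n : ℕ) {d : ℕ} (g : Matrix (Fin d) (Fin d) ℝ) : Fock n d →ₗ[ℂ] Fock n d :=
  diag fun s => (plusEntry g s)⁻¹

/-- Since `0⁻¹ = 0`, the diagonal inverse already kills the kernel and absorbs `1 - Π`. -/
lemma siegelG_apply (hg : g.PosDef) (x : Fock n d) : siegelG n g x = bPlus n d (partialInv n g x) := by
  rw [siegelG, LinearMap.comp_apply, LinearMap.comp_apply, LPlusInv_eq_diag g hg,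
    projKer_eq_diag g hg, partialInv]
  congr 1
  ext s
  simp only [diag_apply, LinearMap.sub_apply, LinearMap.id_apply, Finsupp.sub_apply, kerIndicator]
  by_cases h : plusEntry g s = 0 <;> simp [h]

lemma partialInv_LPlus (hg : g.PosDef) (x : Fock n d) :
    partialInv n g (LPlus n g x) = x - projKer n g x := by
  rw [LPlus_eq_diag g hg, projKer_eq_diag g hg, partialInv]
  ext s
  simp only [diag_apply, Finsupp.sub_apply, kerIndicator]
  by_cases h : plusEntry g s = 0 <;> simp [h]

end

end ClosedString

namespace ClosedString

noncomputable section

variable {n d : ℕ}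

/-! ### The grading by ghost number -/

/-- `A` has degree `j`. -/
def HasDegree (A : Fock n d →ₗ[ℂ] Fock n d) (j : ℤ) : Prop :=
  ∀ k, ∀ x ∈ degPart n d k, A x ∈ degPart n d (k + j)

lemma ket_mem_degPart (s : FockLabel n d) : ket s ∈ degPart n d (2 - ghostNumber s) :=
  Finsupp.single_mem_supported ℂ _ rfl

lemma mem_degPart_iff {x : Fock n d} {k : ℤ} :
    x ∈ degPart n d k ↔ ∀ s, x s ≠ 0 → 2 - ghostNumber s = k := by
  rw [degPart, Finsupp.mem_supported]
  refine ⟨fun h s hs => h (Finsupp.mem_support_iff.2 hs), fun h s hs => ?_⟩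
  exact h s (Finsupp.mem_support_iff.1 hs)

section Degree

variable {A B : Fock n d →ₗ[ℂ] Fock n d} {i j : ℤ}

lemma hasDegree_of_ket (h : ∀ s, A (ket s) ∈ degPart n d (2 - ghostNumber s + j)) :
    HasDegree A j := by
  intro k x hx
  have h1 : x = ∑ s ∈ x.support, x s • ket s := by
    conv_lhs => rw [← Finsupp.sum_single x]
    simp [Finsupp.sum, ket]
  rw [h1, map_sum]
  refine Submodule.sum_mem _ fun s hs => ?_
  rw [map_smul, ← mem_degPart_iff.1 hx s (Finsupp.mem_support_iff.1 hs)]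
  exact Submodule.smul_mem _ _ (h s)

lemma HasDegree.comp (hA : HasDegree A i) (hB : HasDegree B j) : HasDegree (A ∘ₗ B) (j + i) :=
  fun k x hx => by
    rw [← add_assoc]
    exact hA _ _ (hB _ _ hx)

lemma HasDegree.add (hA : HasDegree A i) (hB : HasDegree B i) : HasDegree (A + B) i :=
  fun k x hx => Submodule.add_mem _ (hA k x hx) (hB k x hx)

lemma HasDegree.sub (hA : HasDegree A i) (hB : HasDegree B i) : HasDegree (A - B) i :=
  fun k x hx => Submodule.sub_mem _ (hA k x hx) (hB k x hx)

lemma HasDegree.neg (hA : HasDegree A i) : HasDegree (-A) i :=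
  fun k x hx => Submodule.neg_mem _ (hA k x hx)

lemma HasDegree.smul (hA : HasDegree A i) (c : ℂ) : HasDegree (c • A) i :=
  fun k x hx => Submodule.smul_mem _ c (hA k x hx)

lemma HasDegree.sum {κ : Type*} (S : Finset κ) (f : κ → Fock n d →ₗ[ℂ] Fock n d)
    (h : ∀ a, HasDegree (f a) i) : HasDegree (∑ a ∈ S, f a) i := fun k x hx => by
  rw [LinearMap.sum_apply]
  exact Submodule.sum_mem _ fun a _ => h a k x hx

lemma hasDegree_opSum {T : ℤ → (Fock n d →ₗ[ℂ] Fock n d)} (h : ∀ m, HasDegree (T m) i) :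
    HasDegree (opSum T) i := hasDegree_of_ket fun s => by
  rw [opSum, ofKet_ket]
  exact finsum_induction (· ∈ degPart n d _) (Submodule.zero_mem _)
    (fun _ _ => Submodule.add_mem _) fun m => h m _ _ (ket_mem_degPart s)

lemma hasDegree_diag (f : FockLabel n d → ℂ) : HasDegree (diag f) 0 := hasDegree_of_ket fun s => by
  rw [diag_ket, add_zero]
  exact Submodule.smul_mem _ _ (ket_mem_degPart s)

end Degree

/-- The ghost number of a ghost excitation. -/
def excitationNumber (e : ℤ ×ₗ Bool) : ℤ := if (ofLex e).1 ≤ 1 then 1 else -1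

lemma hasDegree_ghCreate (e : ℤ ×ₗ Bool) :
    HasDegree (n := n) (d := d) (ghCreate e) (-excitationNumber e) := hasDegree_of_ket fun s => by
  rw [ghCreate_ket]
  split_ifs with he
  · exact Submodule.zero_mem _
  · refine Submodule.smul_mem _ _ ?_
    convert ket_mem_degPart _ using 2
    simp only [ghostNumber, Finset.sum_insert he, excitationNumber]
    ring

lemma hasDegree_ghAnnihilate (e : ℤ ×ₗ Bool) :
    HasDegree (n := n) (d := d) (ghAnnihilate e) (excitationNumber e) :=
  hasDegree_of_ket fun s => by
  rw [ghAnnihilate_ket]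
  split_ifs with he
  · refine Submodule.smul_mem _ _ ?_
    convert ket_mem_degPart _ using 2
    simp only [ghostNumber, ← Finset.add_sum_erase _ _ he, excitationNumber]
    ring
  · exact Submodule.zero_mem _

lemma hasDegree_bOsc (χ : Bool) (k : ℤ) : HasDegree (n := n) (d := d) (bOsc χ k) 1 := by
  unfold bOsc
  split_ifs with h
  · convert hasDegree_ghAnnihilate (n := n) (d := d) (toLex (-k, χ))
    rw [excitationNumber, if_pos]
    simp only [ofLex_toLex]
    omega
  · convert hasDegree_ghCreate (n := n) (d := d) (toLex (-k, χ))
    rw [excitationNumber, if_neg, neg_neg]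
    simp only [ofLex_toLex]
    omega

lemma hasDegree_cOsc (χ : Bool) (k : ℤ) : HasDegree (n := n) (d := d) (cOsc χ k) (-1) := by
  unfold cOsc
  split_ifs with h
  · convert hasDegree_ghCreate (n := n) (d := d) (toLex (k, χ))
    rw [excitationNumber, if_pos]
    simpa using h
  · convert hasDegree_ghAnnihilate (n := n) (d := d) (toLex (k, χ))
    rw [excitationNumber, if_neg]
    simpa using h

variable (g : Matrix (Fin d) (Fin d) ℝ) (hg : g.PosDef) (χ χ' : Bool)

lemma hasDegree_alpha (k : ℤ) (i : Fin n ⊕ Fin d) : HasDegree (alpha g χ k i) 0 :=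
  hasDegree_of_ket fun s => by
  rw [add_zero, alpha, ofKet_ket]
  split_ifs
  · exact ket_mem_degPart _
  · exact Submodule.smul_mem _ _ (ket_mem_degPart s)
  · exact Submodule.sum_mem _ fun j _ => Submodule.smul_mem _ _ (ket_mem_degPart _)

lemma hasDegree_LMatter (k : ℤ) : HasDegree (n := n) (LMatter g χ k) 0 := by
  refine hasDegree_opSum fun m => HasDegree.smul (HasDegree.sum _ _ fun i => HasDegree.sum _ _
    fun j => HasDegree.smul ?_ _) _
  unfold normalAlphaAlpha
  split_ifs
  exacts [(hasDegree_alpha g χ _ _).comp (hasDegree_alpha g χ _ _),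
    (hasDegree_alpha g χ _ _).comp (hasDegree_alpha g χ _ _)]

lemma hasDegree_LGhost (k : ℤ) : HasDegree (n := n) (d := d) (LGhost χ k) 0 := by
  refine hasDegree_opSum fun m => HasDegree.smul ?_ _
  unfold normalBC
  split_ifs
  exacts [(hasDegree_bOsc χ _).comp (hasDegree_cOsc χ _),
    ((hasDegree_cOsc χ _).comp (hasDegree_bOsc χ _)).neg]

lemma hasDegree_Vir (k : ℤ) : HasDegree (n := n) (Vir g χ k) 0 :=
  (hasDegree_LMatter g χ k).add (hasDegree_LGhost χ k)

lemma hasDegree_chiralBRST : HasDegree (n := n) (chiralBRST g χ) (-1) := by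
  refine hasDegree_opSum fun k => ?_
  have h : HasDegree (n := n) (LMatter g χ k + (1 / 2 : ℂ) • LGhost χ k) 0 :=
    (hasDegree_LMatter g χ k).add ((hasDegree_LGhost χ k).smul _)
  unfold normalC
  split_ifs
  exacts [h.comp (hasDegree_cOsc χ _), (hasDegree_cOsc χ _).comp h]

lemma hasDegree_QB : HasDegree (QB n g) (-1) :=
  (hasDegree_chiralBRST g _).add (hasDegree_chiralBRST g _)

lemma hasDegree_siegelG (hg : g.PosDef) : HasDegree (siegelG n g) 1 := fun k x hx => by
  rw [siegelG_apply g hg]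
  have h := hasDegree_diag (fun s => (plusEntry g s)⁻¹) k x hx
  rw [add_zero] at h
  exact ((hasDegree_bOsc false 0).add (hasDegree_bOsc true 0)) k _ h

/-! ### Operators that commute with all antighost oscillators -/

lemma ghCreate_ghAnnihilate (e : ℤ ×ₗ Bool) (x : Fock n d) :
    ghCreate e (ghAnnihilate e x) = diag (fun s => if e ∈ s.gh then 1 else 0) x := by
  have : ghCreate e ∘ₗ ghAnnihilate e =
      (diag (fun s => if e ∈ s.gh then 1 else 0) : Fock n d →ₗ[ℂ] Fock n d) := by
    refine hom_ext_ket fun s => ?_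
    rw [LinearMap.comp_apply, ghAnnihilate_ket, diag_ket]
    split_ifs with h
    · simp [ghCreate_ket, ghSign_erase, h, smul_smul, ghSign_mul_self]
    · simp
  exact DFunLike.congr_fun this x

lemma ghAnnihilate_eq (e : ℤ ×ₗ Bool) (he : (ofLex e).1 ≤ 1) :
    (ghAnnihilate e : Fock n d →ₗ[ℂ] Fock n d) = bOsc (ofLex e).2 (-(ofLex e).1) := by
  rw [bOsc, if_pos (by omega), neg_neg]
  rfl

/-- An operator that raises the ghost number and commutes or anticommutes with all antighost
oscillators vanishes. -/
lemma eq_zero_of_commute_bOsc {A : Fock n d →ₗ[ℂ] Fock n d} {j : ℤ} (hj : j < 0)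
    (hA : HasDegree A j) {ε : ℂ} (hε : ε ≠ 0)
    (hb : ∀ χ l x, A (bOsc χ l x) = ε • bOsc χ l (A x)) : A = 0 := by
  have key : ∀ (N : ℕ) (s : FockLabel n d), s.gh.card = N → A (ket s) = 0 := by
    intro N
    induction N using Nat.strong_induction_on with
    | _ N ih =>
    intro s hs
    -- Induction on the number of ghost excitations: a creation oscillator of type `b` can be pulled
    -- through `A`.
    by_cases h1 : ∃ e ∈ s.gh, ¬(ofLex e).1 ≤ 1
    · obtain ⟨e, he, he1⟩ := h1
      have h2 := ket_insert { s with gh := s.gh.erase e } e (by simp)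
      rw [Finset.insert_erase he] at h2
      refine (congrArg A h2).trans ?_
      rw [map_smul, ghCreate_eq, if_neg he1, hb, ih (s.gh.erase e).card ?_ _ rfl]
      · simp
      · rw [← hs]
        exact Finset.card_erase_lt_of_mem he
    · push Not at h1
      -- Only `c` excitations are left. Each `b` that removes one lowers their number, so by
      -- induction all these `b`'s annihilate `A (ket s)`.
      have h2 : ∀ e : ℤ ×ₗ Bool, (ofLex e).1 ≤ 1 → ghAnnihilate e (A (ket s)) = 0 := by
        intro e he
        have h3 := hb (ofLex e).2 (-(ofLex e).1) (ket s)
        rw [← ghAnnihilate_eq e he] at h3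
        refine (smul_eq_zero.1 (h3.symm.trans ?_)).resolve_left hε
        rw [ghAnnihilate_ket]
        split_ifs with he2
        · rw [map_smul, ih (s.gh.erase e).card ?_ _ rfl, smul_zero]
          rw [← hs]
          exact Finset.card_erase_lt_of_mem he2
        · exact map_zero A
      ext t
      by_contra ht
      -- A component `t` of the image has positive ghost number, since `s` contains only `c`'s and
      -- `A` raises the number. So `t` contains some `c`, which contradicts `h2`.
      have h3 := mem_degPart_iff.1 (hA _ _ (ket_mem_degPart s)) t ht
      have h4 : 0 ≤ ghostNumber s := Finset.sum_nonneg fun e he => by rw [if_pos (h1 e he)]; simp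
      obtain ⟨e, he, he1⟩ : ∃ e ∈ t.gh, (ofLex e).1 ≤ 1 := by
        by_contra h5
        push Not at h5
        have : ghostNumber t ≤ 0 := Finset.sum_nonpos fun e he => by
          rw [if_neg (by have := h5 e he; omega)]; simp
        omega
      have h5 := DFunLike.congr_fun (ghCreate_ghAnnihilate e (A (ket s))) t
      rw [h2 e he1, map_zero, diag_apply, if_pos he, one_mul] at h5
      exact ht h5.symm
  exact hom_ext_ket fun s => by rw [key _ s rfl, LinearMap.zero_apply]

/-! ### The BRST charge -/

include hg

lemma QB_bOsc (l : ℤ) (x : Fock n d) :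
    QB n g (bOsc χ l x) + bOsc χ l (QB n g x) = Vir g χ l x := by
  rw [QB_eq g hg, Vir_eq g hg]
  exact DFunLike.congr_fun ((fockRep n g hg).Q_mul_b χ l) x

lemma QB_Vir (hdim : n + d = 26) (l : ℤ) (x : Fock n d) :
    QB n g (Vir g χ l x) = Vir g χ l (QB n g x) := by
  have hcard : Fintype.card (Fin n ⊕ Fin d) = 26 := by simpa using hdim
  have h : QB n g ∘ₗ Vir g χ l - Vir g χ l ∘ₗ QB n g = 0 := by
    refine eq_zero_of_commute_bOsc (j := -1) (by norm_num) ?_ (ε := -1) (by norm_num) ?_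
    · exact ((hasDegree_QB g).comp (hasDegree_Vir g χ l)).sub
        ((hasDegree_Vir g χ l).comp (hasDegree_QB g))
    · intro χ' m x
      rw [QB_eq g hg, Vir_eq g hg, neg_one_smul]
      exact DFunLike.congr_fun ((fockRep n g hg).Q_lie_L_mul_b χ χ' hcard l m) x
  exact sub_eq_zero.1 (DFunLike.congr_fun h x)

lemma QB_QB (hdim : n + d = 26) : QB n g ∘ₗ QB n g = 0 := by
  refine eq_zero_of_commute_bOsc (j := -1 + -1) (by norm_num) ((hasDegree_QB g).comp (hasDegree_QB g))
    one_ne_zero fun χ l x => ?_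
  have h : (fockRep n g hg).Q * (fockRep n g hg).L χ l -
      (fockRep n g hg).L χ l * (fockRep n g hg).Q = 0 := by
    refine LinearMap.ext fun x => ?_
    have := QB_Vir g hg χ hdim l x
    rw [QB_eq g hg, Vir_eq g hg] at this
    exact sub_eq_zero.2 this
  rw [one_smul, QB_eq g hg]
  exact DFunLike.congr_fun ((fockRep n g hg).Q_sq_mul_b χ l h) x

omit hg

lemma bOsc_bOsc (k l : ℤ) (x : Fock n d) : bOsc χ k (bOsc χ' l x) + bOsc χ' l (bOsc χ k x) = 0 :=
  DFunLike.congr_fun (bOsc_anticomm χ χ' k l) x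

lemma bPlus_bPlus (x : Fock n d) : bPlus n d (bPlus n d x) = 0 := by
  have h1 := bOsc_bOsc false false 0 0 x
  have h2 := bOsc_bOsc true true 0 0 x
  have h3 := bOsc_bOsc false true 0 0 x
  rw [← two_smul ℂ] at h1 h2
  have h1' := (smul_eq_zero.1 h1).resolve_left two_ne_zero
  have h2' := (smul_eq_zero.1 h2).resolve_left two_ne_zero
  simp only [bPlus, LinearMap.add_apply, map_add, h1', h2', zero_add, add_zero]
  rwa [add_comm] at h3

lemma bMinus_bPlus (x : Fock n d) : bMinus n d (bPlus n d x) = -bPlus n d (bMinus n d x) := by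
  have h1 := bOsc_bOsc false false 0 0 x
  have h2 := bOsc_bOsc true true 0 0 x
  rw [eq_neg_iff_add_eq_zero]
  simp only [bPlus, bMinus, LinearMap.add_apply, LinearMap.sub_apply, map_add, map_sub]
  refine Eq.trans ?_ (sub_eq_zero.2 (h1.trans h2.symm))
  abel

include hg

lemma QB_bPlus (x : Fock n d) : bPlus n d (QB n g x) + QB n g (bPlus n d x) = LPlus n g x := by
  have h1 := QB_bOsc g hg false 0 x
  have h2 := QB_bOsc g hg true 0 x
  simp only [bPlus, LPlus, LinearMap.add_apply, map_add, ← h1, ← h2]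
  abel

lemma QB_bMinus (x : Fock n d) : bMinus n d (QB n g x) + QB n g (bMinus n d x) = LMinus n g x := by
  have h1 := QB_bOsc g hg false 0 x
  have h2 := QB_bOsc g hg true 0 x
  simp only [bMinus, LMinus, LinearMap.sub_apply, map_sub, ← h1, ← h2]
  abel

omit hg

end

end ClosedString

namespace ClosedString

noncomputable section

variable {n d : ℕ}

/-! ### Homogeneous subspaces -/

/-- The projection onto the states of degree `k`. -/
def degProj (n d : ℕ) (k : ℤ) : Fock n d →ₗ[ℂ] Fock n d :=
  diag fun s => if 2 - ghostNumber s = k then 1 else 0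

lemma degProj_of_mem {x : Fock n d} {j : ℤ} (hx : x ∈ degPart n d j) (k : ℤ) :
    degProj n d k x = if j = k then x else 0 := by
  ext s
  rw [degProj, diag_apply]
  by_cases hs : x s = 0
  · split_ifs <;> simp [hs]
  · rw [mem_degPart_iff.1 hx s hs]
    split_ifs <;> simp

lemma degProj_mem (x : Fock n d) (k : ℤ) : degProj n d k x ∈ degPart n d k := by
  rw [mem_degPart_iff]
  intro s hs
  rw [degProj, diag_apply] at hs
  by_contra h
  exact hs (by rw [if_neg h, zero_mul])

lemma HasDegree.degProj_comm {A : Fock n d →ₗ[ℂ] Fock n d} {j : ℤ} (hA : HasDegree A j) (k : ℤ)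
    (x : Fock n d) : degProj n d (k + j) (A x) = A (degProj n d k x) := by
  have : degProj n d (k + j) ∘ₗ A = A ∘ₗ degProj n d k := by
    refine hom_ext_ket fun s => ?_
    have hs := ket_mem_degPart s
    rw [LinearMap.comp_apply, LinearMap.comp_apply, degProj_of_mem hs,
      degProj_of_mem (hA _ _ hs)]
    simp only [add_left_inj]
    split_ifs <;> simp
  exact DFunLike.congr_fun this x

lemma sum_degProj (x : Fock n d) :
    ∑ k ∈ x.support.image (fun s => 2 - ghostNumber s), degProj n d k x = x := by
  ext s
  rw [Finsupp.finsetSum_apply]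
  simp only [degProj, diag_apply, ite_mul, one_mul, zero_mul]
  rw [Finset.sum_ite_eq]
  split_ifs with h
  · rfl
  · by_contra h2
    exact h (Finset.mem_image_of_mem _ (Finsupp.mem_support_iff.2 (Ne.symm h2)))

lemma isInternal_of_projections {V : Type*} [AddCommGroup V] [Module ℂ V]
    (𝒱 : ℤ → Submodule ℂ V) (P : ℤ → V →ₗ[ℂ] V) (h1 : ∀ i, ∀ x ∈ 𝒱 i, P i x = x)
    (h2 : ∀ i j, j ≠ i → ∀ x ∈ 𝒱 j, P i x = 0) (h3 : ∀ x, x ∈ ⨆ k, 𝒱 k) :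
    DirectSum.IsInternal 𝒱 := by
  refine DirectSum.isInternal_submodule_of_iSupIndep_of_iSup_eq_top (fun i => ?_)
    (eq_top_iff.2 fun x _ => h3 x)
  rw [Submodule.disjoint_def]
  intro x hx hx2
  have h : (⨆ j, ⨆ (_ : j ≠ i), 𝒱 j) ≤ LinearMap.ker (P i) :=
    iSup₂_le fun j hj y hy => h2 i j hj y hy
  rw [← h1 i x hx]
  exact h hx2

lemma isInternal_gradingOn (U : Submodule ℂ (Fock n d))
    (hU : ∀ k, ∀ x ∈ U, degProj n d k x ∈ U) : DirectSum.IsInternal (gradingOn U) := by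
  have h3 : ∀ x : U, x ∈ ⨆ k, gradingOn U k := fun x => by
    have h : x = ∑ k ∈ (x : Fock n d).support.image (fun s => 2 - ghostNumber s),
        (⟨degProj n d k x, hU k x x.2⟩ : U) := by
      refine Subtype.ext ?_
      rw [AddSubmonoidClass.coe_finsetSum]
      exact (sum_degProj (x : Fock n d)).symm
    rw [h]
    exact Submodule.sum_mem _ fun k _ => Submodule.mem_iSup_of_mem k (degProj_mem _ k)
  let P : ℤ → U →ₗ[ℂ] U := fun k =>
    { toFun := fun x => ⟨degProj n d k x, hU k x x.2⟩
      map_add' := fun x y => Subtype.ext (map_add (degProj n d k) _ _)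
      map_smul' := fun c x => Subtype.ext (map_smul (degProj n d k) _ _) }
  have h1 : ∀ i, ∀ x ∈ gradingOn U i, P i x = x := fun i x hx =>
    Subtype.ext ((degProj_of_mem (x := (x : Fock n d)) hx i).trans (if_pos rfl))
  have h2 : ∀ i j, j ≠ i → ∀ x ∈ gradingOn U j, P i x = 0 := fun i j hj x hx =>
    Subtype.ext ((degProj_of_mem (x := (x : Fock n d)) hx i).trans (if_neg hj))
  have h := isInternal_of_projections (V := U) (gradingOn U) P
  have h' := h h1 h2 h3
  exact h'

lemma degProj_mem_ker {A : Fock n d →ₗ[ℂ] Fock n d} {j : ℤ} (hA : HasDegree A j) (k : ℤ)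
    {x : Fock n d} (hx : x ∈ LinearMap.ker A) : degProj n d k x ∈ LinearMap.ker A := by
  rw [LinearMap.mem_ker] at hx ⊢
  rw [← hA.degProj_comm, hx, map_zero]

variable (g : Matrix (Fin d) (Fin d) ℝ) (hg : g.PosDef)

lemma degProj_mem_stringFields (k : ℤ) {x : Fock n d} (hx : x ∈ StringFields n g) :
    degProj n d k x ∈ StringFields n g :=
  ⟨degProj_mem_ker ((hasDegree_Vir g false 0).sub (hasDegree_Vir g true 0)) k hx.1,
    degProj_mem_ker ((hasDegree_bOsc false 0).sub (hasDegree_bOsc true 0)) k hx.2⟩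

lemma isInternal_stringFields : DirectSum.IsInternal (gradingOn (StringFields n g)) :=
  isInternal_gradingOn _ fun k _ => degProj_mem_stringFields g k

lemma isInternal_kerLPlus : DirectSum.IsInternal (gradingOn (kerLPlus n g)) :=
  isInternal_gradingOn _ fun k _ hx => ⟨degProj_mem_stringFields g k hx.1,
    degProj_mem_ker ((hasDegree_Vir g false 0).add (hasDegree_Vir g true 0)) k hx.2⟩

/-! ### The homotopy relation -/

include hg

lemma hasWeight_LPlus_bOsc (χ : Bool) : HasWeight (diag (n := n) (plusEntry g)) (bOsc χ 0) 0 := by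
  rw [← LPlus_eq_diag g hg, LPlus]
  simpa using (hasWeight_bOsc g hg false χ 0).add_left (hasWeight_bOsc g hg true χ 0)

lemma hasWeight_LPlus_cOsc (χ : Bool) : HasWeight (diag (n := n) (plusEntry g)) (cOsc χ 0) 0 := by
  rw [← LPlus_eq_diag g hg, LPlus]
  simpa using (hasWeight_cOsc g hg false χ 0).add_left (hasWeight_cOsc g hg true χ 0)

lemma hasWeight_LMinus_bOsc (χ : Bool) : HasWeight (LMinus n g) (bOsc χ 0) 0 := by
  rw [LMinus]
  simpa using (hasWeight_bOsc g hg false χ 0).sub_left (hasWeight_bOsc g hg true χ 0)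

lemma diag_bPlus (φ : ℂ → ℂ) (x : Fock n d) : diag (fun s => φ (plusEntry g s)) (bPlus n d x) =
    bPlus n d (diag (fun s => φ (plusEntry g s)) x) :=
  diag_comp_comm ((hasWeight_LPlus_bOsc g hg false).add (hasWeight_LPlus_bOsc g hg true)) φ x

lemma diag_bMinus (φ : ℂ → ℂ) (x : Fock n d) : diag (fun s => φ (plusEntry g s)) (bMinus n d x) =
    bMinus n d (diag (fun s => φ (plusEntry g s)) x) :=
  diag_comp_comm ((hasWeight_LPlus_bOsc g hg false).sub (hasWeight_LPlus_bOsc g hg true)) φ x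

lemma diag_cMinus (φ : ℂ → ℂ) (x : Fock n d) : diag (fun s => φ (plusEntry g s)) (cMinus n d x) =
    cMinus n d (diag (fun s => φ (plusEntry g s)) x) :=
  diag_comp_comm (((hasWeight_LPlus_cOsc g hg false).sub
    (hasWeight_LPlus_cOsc g hg true)).smul _) φ x

lemma diag_QB (hdim : n + d = 26) (φ : ℂ → ℂ) (x : Fock n d) :
    diag (fun s => φ (plusEntry g s)) (QB n g x) =
      QB n g (diag (fun s => φ (plusEntry g s)) x) := by
  refine diag_comp_comm (fun x => ?_) φ x
  rw [← LPlus_eq_diag g hg, zero_smul, add_zero]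
  simp only [LPlus, LinearMap.add_apply, map_add, QB_Vir g hg _ hdim]

lemma LMinus_eq_diag : LMinus n g = diag fun s => virEntry g false s - virEntry g true s :=
  hom_ext_ket fun s => by
    rw [LMinus, LinearMap.sub_apply, Vir_zero_ket g hg, Vir_zero_ket g hg, diag_ket, sub_smul]

lemma LMinus_diag (f : FockLabel n d → ℂ) (x : Fock n d) :
    LMinus n g (diag f x) = diag f (LMinus n g x) := by
  rw [LMinus_eq_diag g hg, diag_diag, diag_diag]
  simp_rw [mul_comm]

lemma QB_mem_stringFields (hdim : n + d = 26) {x : Fock n d} (hx : x ∈ StringFields n g) :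
    QB n g x ∈ StringFields n g := by
  obtain ⟨h1, h2⟩ := hx
  rw [SetLike.mem_coe, LinearMap.mem_ker] at h1 h2
  refine ⟨?_, ?_⟩ <;> rw [SetLike.mem_coe, LinearMap.mem_ker]
  · have : LMinus n g (QB n g x) = QB n g (LMinus n g x) := by
      simp only [LMinus, LinearMap.sub_apply, map_sub, QB_Vir g hg _ hdim]
    rw [this, h1, map_zero]
  · have := QB_bMinus g hg x
    rwa [h1, h2, map_zero, add_zero] at this

lemma diag_mem_stringFields (φ : ℂ → ℂ) {x : Fock n d} (hx : x ∈ StringFields n g) :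
    diag (fun s => φ (plusEntry g s)) x ∈ StringFields n g := by
  obtain ⟨h1, h2⟩ := hx
  rw [SetLike.mem_coe, LinearMap.mem_ker] at h1 h2
  refine ⟨?_, ?_⟩ <;> rw [SetLike.mem_coe, LinearMap.mem_ker]
  · rw [LMinus_diag g hg, h1, map_zero]
  · rw [← diag_bMinus g hg, h2, map_zero]

lemma siegelG_mem_stringFields {x : Fock n d} (hx : x ∈ StringFields n g) :
    siegelG n g x ∈ StringFields n g := by
  rw [siegelG_apply g hg]
  obtain ⟨h1, h2⟩ := diag_mem_stringFields g hg (fun z => z⁻¹) hx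
  rw [SetLike.mem_coe, LinearMap.mem_ker] at h1 h2
  refine ⟨?_, ?_⟩ <;> rw [SetLike.mem_coe, LinearMap.mem_ker]
  · have h := ((hasWeight_LMinus_bOsc g hg false).add (hasWeight_LMinus_bOsc g hg true))
      (partialInv n g x)
    rw [zero_smul, add_zero] at h
    refine h.trans ?_
    rw [partialInv, h1, map_zero]
  · rw [bMinus_bPlus, partialInv, h2, map_zero, neg_zero]

lemma LPlus_projKer (x : Fock n d) : LPlus n g (projKer n g x) = 0 := by
  rw [LPlus_eq_diag g hg, projKer_eq_diag g hg]
  ext s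
  simp only [diag_apply, kerIndicator, Finsupp.zero_apply]
  by_cases h : plusEntry g s = 0 <;> simp [h]

lemma projKer_eq_self {x : Fock n d} (hx : LPlus n g x = 0) : projKer n g x = x := by
  have h := partialInv_LPlus g hg x
  rw [hx, map_zero] at h
  exact (sub_eq_zero.1 h.symm).symm

lemma projKer_mem_kerLPlus {x : Fock n d} (hx : x ∈ StringFields n g) :
    projKer n g x ∈ kerLPlus n g := by
  refine ⟨?_, LPlus_projKer g hg x⟩
  rw [projKer_eq_diag g hg]
  exact diag_mem_stringFields g hg _ hx

/-- `Q_B` commutes with functions of `L_0^+`, so the anticommutator of `G` with `Q_B` is `{b_0^+,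
Q_B} = L_0^+` times its partial inverse, which is `1 - Π`. -/
lemma homotopy_relation (hdim : n + d = 26) (x : Fock n d) :
    projKer n g x = x + (-siegelG n g) (QB n g x) + QB n g ((-siegelG n g) x) := by
  have h1 : siegelG n g (QB n g x) + QB n g (siegelG n g x) = x - projKer n g x := by
    rw [siegelG_apply g hg, siegelG_apply g hg, partialInv, diag_QB g hg hdim (fun z => z⁻¹),
      QB_bPlus g hg, ← partialInv_LPlus g hg, LPlus_eq_diag g hg, partialInv, diag_diag, diag_diag]
    simp_rw [mul_comm]
  rw [LinearMap.neg_apply, LinearMap.neg_apply, map_neg, add_assoc, ← neg_add, h1]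
  abel

lemma siegelG_siegelG (x : Fock n d) : siegelG n g (siegelG n g x) = 0 := by
  rw [siegelG_apply g hg, siegelG_apply g hg, partialInv, diag_bPlus g hg (fun z => z⁻¹),
    bPlus_bPlus]

lemma partialInv_projKer (x : Fock n d) : partialInv n g (projKer n g x) = 0 := by
  rw [projKer_eq_diag g hg, partialInv]
  ext s
  simp only [diag_apply, kerIndicator, Finsupp.zero_apply]
  by_cases h : plusEntry g s = 0 <;> simp [h]

lemma siegelG_projKer (x : Fock n d) : siegelG n g (projKer n g x) = 0 := by
  rw [siegelG_apply g hg, partialInv_projKer g hg, map_zero]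

lemma projKer_siegelG (x : Fock n d) : projKer n g (siegelG n g x) = 0 := by
  have h := partialInv_projKer g hg x
  rw [siegelG_apply g hg, projKer_eq_diag g hg, diag_bPlus g hg kerIndicator]
  rw [projKer_eq_diag g hg, partialInv, diag_diag] at h
  rw [partialInv, diag_diag]
  simp_rw [mul_comm] at h ⊢
  rw [h, map_zero]

end

end ClosedString

namespace ClosedString

noncomputable section

variable {n d : ℕ}

/-! ### BPZ conjugation -/

section

variable (g : Matrix (Fin d) (Fin d) ℝ) (hg : g.PosDef) (χ : Bool)

include hg

lemma hasWeight_ghTranspose (e : ℤ ×ₗ Bool) :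
    HasWeight (Vir (n := n) g χ 0) (ghTranspose e) (-ghWeight χ e) := by
  unfold ghTranspose ghWeight
  by_cases h : (ofLex e).1 ≤ 1
  · rw [if_pos h, if_pos h]
    convert (hasWeight_cOsc (n := n) g hg χ (ofLex e).2 (-(ofLex e).1)).smul _ using 1
    split_ifs <;> simp
  · rw [if_neg h, if_neg h]
    convert (hasWeight_bOsc (n := n) g hg χ (ofLex e).2 (ofLex e).1).smul _ using 1
    split_ifs <;> simp

lemma hasWeight_bosTranspose (v : Bool × ℕ+ × (Fin n ⊕ Fin d)) :
    HasWeight (Vir g χ 0) (bosTranspose g v) (-bosWeight χ v) := by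
  unfold bosTranspose bosWeight
  convert (hasWeight_alpha g hg χ v.1 (v.2.1 : ℤ) v.2.2).smul _ using 1
  split_ifs <;> simp

lemma hasWeight_labelTranspose (s : FockLabel n d) :
    HasWeight (Vir g χ 0) (labelTranspose g s) (-level χ s) := by
  have h1 := hasWeight_list_prod (s.gh.sort (· ≤ ·)) ghTranspose (fun e => -ghWeight χ e)
    (hasWeight_ghTranspose (n := n) g hg χ)
  have h2 := hasWeight_list_prod s.bos.support.toList (fun v => bosTranspose g v ^ s.bos v)
    (fun v => (s.bos v : ℂ) * -bosWeight χ v) fun v => (hasWeight_bosTranspose g hg χ v).pow _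
  have h3 := h1.mul h2
  change HasWeight _ (labelTranspose g s) _ at h3
  convert h3 using 1
  unfold level
  rw [neg_add, add_comm]
  congr 1
  · rw [← Finset.sum_neg_distrib]
    have : ((s.gh.sort (· ≤ ·)).map fun e => -ghWeight χ e).sum =
        (((s.gh.sort (· ≤ ·) : List (ℤ ×ₗ Bool)) : Multiset (ℤ ×ₗ Bool)).map
          fun e => -ghWeight χ e).sum := by
      rw [Multiset.map_coe, Multiset.sum_coe]
    rw [this, Finset.sort_eq]
    rfl
  · rw [Finset.sum_map_toList, Finsupp.sum, ← Finset.sum_neg_distrib]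
    exact Finset.sum_congr rfl fun v _ => by ring

omit hg

/-- The label of the basis state that pairs with the dual vacuum. -/
def braLabel (p : Fin n → ℝ) (q w : Fin d → ℤ) : FockLabel n d :=
  { mom := p, tmom := q, wind := w, bos := 0,
    gh := ((Finset.Icc (-1 : ℤ) 1) ×ˢ (Finset.univ : Finset Bool)).map toLex.toEmbedding }

lemma bra_apply (p : Fin n → ℝ) (q w : Fin d → ℤ) (x : Fock n d) :
    bra p q w x = (-2 * (2 * (Real.pi : ℂ)) ^ (n + 2 * d)) * x (braLabel p q w) := rfl

lemma level_braLabel (p : Fin n → ℝ) (q w : Fin d → ℤ) : level χ (braLabel p q w) = 0 := by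
  have h : Finset.Icc (-1 : ℤ) 1 = {-1, 0, 1} := by decide
  simp only [level, braLabel, Finsupp.sum_zero_index, zero_add, Finset.sum_map, Finset.sum_product, h]
  cases χ <;> simp [ghWeight]

lemma zeroMode_neg (s : FockLabel n d) (i : Fin n ⊕ Fin d) :
    zeroMode g χ (braLabel (-s.mom) (-s.tmom) (-s.wind)) i = -zeroMode g χ s i := by
  cases i
  · simp [zeroMode, braLabel]
  · simp [zeroMode, braLabel]
    ring

lemma virEntry_braLabel (s : FockLabel n d) :
    virEntry g χ (braLabel (-s.mom) (-s.tmom) (-s.wind)) = zeroModeEnergy g χ s := by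
  rw [virEntry, level_braLabel, add_zero, zeroModeEnergy, zeroModeEnergy]
  simp [zeroMode_neg]

lemma reflector_ket (s : FockLabel n d) (y : Fock n d) : reflector n g (ket s) y =
    (-1 : ℂ) ^ (∑ a, s.tmom a * s.wind a) *
      bra (-s.mom) (-s.tmom) (-s.wind) (labelTranspose g s y) := by
  rw [reflector, ofKet_ket]
  rfl

include hg

/-- The transposed oscillators lower the weight by the level of `s`, while the state seen by the
dual vacuum has level zero and, the zero mode energy being even in momentum and winding, the same
zero mode energy as `s`. -/
lemma reflector_ket_LPlus (s : FockLabel n d) (y : Fock n d) :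
    reflector n g (ket s) (LPlus n g y) = plusEntry g s * reflector n g (ket s) y := by
  have h := (hasWeight_labelTranspose g hg false s).add_left (hasWeight_labelTranspose g hg true s) y
  change LPlus n g _ = labelTranspose g s (LPlus n g y) + _ at h
  rw [reflector_ket, reflector_ket, ← sub_eq_iff_eq_add.2 h, map_sub, map_smul, bra_apply,
    LPlus_eq_diag g hg, diag_apply, bra_apply, plusEntry, plusEntry, virEntry_braLabel,
    virEntry_braLabel, virEntry, virEntry, smul_eq_mul]
  ring

/-- Two basis states pair to something nonzero only if their `L_0^+` eigenvalues agree, so every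
function of the eigenvalue moves across. -/
lemma reflector_diag (φ : ℂ → ℂ) (x y : Fock n d) :
    reflector n g (diag (fun s => φ (plusEntry g s)) x) y =
      reflector n g x (diag (fun s => φ (plusEntry g s)) y) := by
  have h : reflector n g ∘ₗ diag (fun s => φ (plusEntry g s)) =
      (reflector n g).compl₂ (diag (fun s => φ (plusEntry g s))) := by
    refine hom_ext_ket fun s => hom_ext_ket fun t => ?_
    rw [LinearMap.comp_apply, LinearMap.compl₂_apply, diag_ket, diag_ket, map_smul, map_smul,
      LinearMap.smul_apply, smul_eq_mul, smul_eq_mul]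
    have h1 := reflector_ket_LPlus g hg s (ket t)
    rw [LPlus_ket g hg, map_smul, smul_eq_mul] at h1
    by_cases h2 : reflector n g (ket s) (ket t) = 0
    · rw [h2, mul_zero, mul_zero]
    · rw [mul_right_cancel₀ h2 h1]
  exact DFunLike.congr_fun (DFunLike.congr_fun h x) y

lemma kappa_projKer (x y : Fock n d) : kappa n g (projKer n g x) y = kappa n g x (projKer n g y) := by
  rw [kappa, LinearMap.compl₂_apply, LinearMap.compl₂_apply, projKer_eq_diag g hg,
    reflector_diag g hg kerIndicator, diag_cMinus g hg kerIndicator]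

omit hg

/-! ### BPZ conjugation of the antighost zero modes -/

lemma ghTranspose_mul_bOsc (e : ℤ ×ₗ Bool) (he : e ≠ toLex (0, χ)) (x : Fock n d) :
    ghTranspose e (bOsc χ 0 x) = -bOsc χ 0 (ghTranspose e x) := by
  unfold ghTranspose
  split_ifs with h
  · have h1 := DFunLike.congr_fun (bOsc_anticomm_cOsc (n := n) (d := d) χ (ofLex e).2 0 (-(ofLex e).1)) x
    rw [if_neg] at h1
    · rw [LinearMap.smul_apply, LinearMap.smul_apply, map_smul, ← smul_neg]
      congr 1
      rw [eq_neg_iff_add_eq_zero, add_comm]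
      exact h1
    · rintro ⟨h2, h3⟩
      refine he ?_
      rw [← toLex_ofLex e]
      congr 1
      exact Prod.ext (by simpa using h3) h2.symm
  · rw [LinearMap.smul_apply, LinearMap.smul_apply, map_smul, ← smul_neg]
    congr 1
    rw [eq_neg_iff_add_eq_zero]
    exact bOsc_bOsc _ _ _ _ _

lemma ghTranspose_zero_mul_bOsc (x : Fock n d) :
    ghTranspose (toLex (0, χ)) (bOsc χ 0 x) = -x - bOsc χ 0 (ghTranspose (toLex (0, χ)) x) := by
  have h1 := DFunLike.congr_fun (bOsc_anticomm_cOsc (n := n) (d := d) χ χ 0 0) x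
  rw [if_pos ⟨rfl, rfl⟩] at h1
  have h2 : (ghTranspose (toLex (0, χ)) : Module.End ℂ (Fock n d)) = -cOsc χ 0 := by
    refine LinearMap.ext fun y => ?_
    simp [ghTranspose]
  rw [h2, LinearMap.neg_apply, LinearMap.neg_apply, map_neg]
  have h3 : bOsc χ 0 (cOsc χ 0 x) + cOsc χ 0 (bOsc χ 0 x) = x := h1
  nth_rewrite 2 [← h3]
  abel

/-- `b_0` anticommutes with every factor except the transpose of `c_0`. Strict order means that this
factor occurs at most once and that `countP` gives its position. -/
lemma list_ghTranspose_mul_bOsc (l : List (ℤ ×ₗ Bool)) (hl : l.Pairwise (· < ·)) (x : Fock n d) :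
    (l.map ghTranspose).prod (bOsc χ 0 x) =
      (-1 : ℂ) ^ l.length • bOsc χ 0 ((l.map ghTranspose).prod x) +
      if toLex (0, χ) ∈ l then ((-1 : ℂ) ^ l.length * (-1) ^ l.countP (· < toLex (0, χ))) •
        ((l.erase (toLex (0, χ))).map ghTranspose).prod x else 0 := by
  induction l with
  | nil => simp
  | cons a l ih =>
    rw [List.pairwise_cons] at hl
    rw [List.map_cons, List.prod_cons, Module.End.mul_apply, Module.End.mul_apply, ih hl.2, map_add,
      map_smul]
    by_cases ha : a = toLex (0, χ)
    · subst ha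
      have h1 : toLex (0, χ) ∉ l := fun h => lt_irrefl _ (hl.1 _ h)
      have h2 : l.countP (· < toLex (0, χ)) = 0 := by
        rw [List.countP_eq_zero]
        intro b hb
        simpa using (hl.1 b hb).le
      rw [if_neg h1, map_zero, add_zero, ghTranspose_zero_mul_bOsc, if_pos (by simp),
        List.erase_cons_head, List.countP_cons_of_neg (by simp), h2, List.length_cons, pow_succ]
      module
    · have h3 : toLex (0, χ) ∈ a :: l ↔ toLex (0, χ) ∈ l := by
        rw [List.mem_cons]
        exact or_iff_right (Ne.symm ha)
      rw [ghTranspose_mul_bOsc χ a ha, List.length_cons, pow_succ]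
      simp only [h3]
      split_ifs with h4
      · rw [map_smul, List.erase_cons_tail (by simpa using ha), List.map_cons, List.prod_cons,
          Module.End.mul_apply, List.countP_cons_of_pos (by simpa using hl.1 _ h4), pow_succ]
        module
      · rw [map_zero]
        module

lemma bosPart_bOsc (s : FockLabel n d) (k : ℤ) (x : Fock n d) :
    (s.bos.support.toList.map fun v => bosTranspose g v ^ s.bos v).prod (bOsc χ k x) =
      bOsc χ k ((s.bos.support.toList.map fun v => bosTranspose g v ^ s.bos v).prod x) := by
  have h : Commute (bOsc χ k : Module.End ℂ (Fock n d))
      (s.bos.support.toList.map fun v => bosTranspose g v ^ s.bos v).prod := by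
    refine Commute.list_prod_right _ _ fun A hA => ?_
    obtain ⟨v, -, rfl⟩ := List.mem_map.1 hA
    exact (Commute.smul_right (alpha_commute_bOsc _ _ _ _ _ _).symm _).pow_right _
  exact (DFunLike.congr_fun h.eq x).symm

lemma ghAnnihilate_apply_of_mem (e : ℤ ×ₗ Bool) (t : FockLabel n d) (ht : e ∈ t.gh)
    (x : Fock n d) : ghAnnihilate e x t = 0 := by
  refine fock_induction (p := fun x => ghAnnihilate e x t = 0) x (fun s => ?_) (by simp)
    (fun x y hx hy => by simp [hx, hy]) fun c x hx => by simp [hx]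
  classical
  rw [ghAnnihilate_ket]
  split_ifs
  · rw [Finsupp.smul_apply, ket, Finsupp.single_apply, if_neg, smul_zero]
    rintro rfl
    simp at ht
  · rfl

lemma bOsc_zero_eq : (bOsc χ 0 : Fock n d →ₗ[ℂ] Fock n d) = ghAnnihilate (toLex (0, χ)) := by
  rw [bOsc, if_pos (by norm_num), neg_zero]

/-- The dual vacuum reads off a state in which both `c_0` modes are occupied, and `b_0` leaves its
mode empty. -/
lemma bra_bOsc (p : Fin n → ℝ) (q w : Fin d → ℤ) (x : Fock n d) : bra p q w (bOsc χ 0 x) = 0 := by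
  rw [bra_apply, bOsc_zero_eq, ghAnnihilate_apply_of_mem, mul_zero]
  cases χ <;> simp [braLabel]

lemma ghSign_eq_countP (S : Finset (ℤ ×ₗ Bool)) (e : ℤ ×ₗ Bool) :
    ghSign S e = (-1) ^ (S.sort (· ≤ ·)).countP (· < e) := by
  rw [ghSign, ← Multiset.coe_countP, Finset.sort_eq, Multiset.countP_eq_card_filter]
  rfl

lemma sort_erase (S : Finset (ℤ ×ₗ Bool)) (e : ℤ ×ₗ Bool) :
    (S.erase e).sort (· ≤ ·) = (S.sort (· ≤ ·)).erase e := by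
  have hn := Finset.sort_nodup S (· ≤ ·)
  refine List.Perm.eq_of_pairwise' (r := (· ≤ ·)) (Finset.pairwise_sort _ _)
    ((Finset.pairwise_sort S (· ≤ ·)).sublist List.erase_sublist) ?_
  refine (List.perm_ext_iff_of_nodup (Finset.sort_nodup _ _) (hn.erase e)).2 fun a => ?_
  rw [hn.mem_erase_iff, Finset.mem_sort, Finset.mem_sort, Finset.mem_erase]

/-- Moving `b_0` through the transposes, the term in which it reaches the dual vacuum drops out, and
the contraction deletes `c_0` from `s`, as `b_0` acting on the ket does. The sign does not depend on
the chirality, so the rule extends to `b_0^+`. -/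
lemma reflector_bOsc_ket (s : FockLabel n d) (y : Fock n d) :
    reflector n g (bOsc χ 0 (ket s)) y =
      (-1 : ℂ) ^ s.gh.card * reflector n g (ket s) (bOsc χ 0 y) := by
  have hsort : (s.gh.sort (· ≤ ·)).Pairwise (· < ·) :=
    ((Finset.pairwise_sort s.gh (· ≤ ·)).and (Finset.sort_nodup s.gh (· ≤ ·))).imp
      fun h => lt_of_le_of_ne h.1 h.2
  have h1 := list_ghTranspose_mul_bOsc χ (s.gh.sort (· ≤ ·)) hsort
    ((s.bos.support.toList.map fun v => bosTranspose g v ^ s.bos v).prod y)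
  rw [← bosPart_bOsc, ← Module.End.mul_apply] at h1
  change labelTranspose g s (bOsc χ 0 y) = _ at h1
  rw [Finset.length_sort] at h1
  rw [reflector_ket, h1, map_add, map_smul, bra_bOsc, smul_zero, zero_add]
  rw [bOsc_zero_eq, ghAnnihilate_ket]
  simp only [Finset.mem_sort]
  split_ifs with h
  · rw [map_smul, LinearMap.smul_apply, reflector_ket, map_smul, smul_eq_mul, smul_eq_mul,
      labelTranspose, sort_erase, ghSign_eq_countP]
    have h2 : ((-1 : ℂ) ^ s.gh.card) * (-1) ^ s.gh.card = 1 := by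
      rw [← mul_pow]; simp
    rw [Module.End.mul_apply]
    linear_combination (-((-1 : ℂ) ^ (s.gh.sort (· ≤ ·)).countP (· < toLex (0, χ)) *
      ((-1 : ℂ) ^ (∑ a, s.tmom a * s.wind a)) * bra (-s.mom) (-s.tmom) (-s.wind)
        ((((s.gh.sort (· ≤ ·)).erase (toLex (0, χ))).map ghTranspose).prod
          ((s.bos.support.toList.map fun v => bosTranspose g v ^ s.bos v).prod y)))) * h2
  · simp

lemma reflector_bPlus (x y : Fock n d) (hy : bPlus n d y = 0) :
    reflector n g (bPlus n d x) y = 0 := by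
  refine fock_induction (p := fun x => reflector n g (bPlus n d x) y = 0) x (fun s => ?_) (by simp)
    (fun x y hx hy => by simp [hx, hy]) fun c x hx => by simp [hx]
  rw [bPlus, LinearMap.add_apply, map_add, LinearMap.add_apply, reflector_bOsc_ket,
    reflector_bOsc_ket, ← mul_add, ← map_add]
  change _ * reflector n g (ket s) (bPlus n d y) = 0
  rw [hy, map_zero, mul_zero]

/-- The contractions of the two chiralities enter with opposite signs and cancel. -/
lemma bPlus_cMinus (x : Fock n d) : bPlus n d (cMinus n d x) = -cMinus n d (bPlus n d x) := by
  have h (χ χ' : Bool) : bOsc χ 0 (cOsc χ' 0 x) + cOsc χ' 0 (bOsc χ 0 x) =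
      if χ = χ' then x else 0 := by
    refine (DFunLike.congr_fun (bOsc_anticomm_cOsc (n := n) (d := d) χ χ' 0 0) x).trans ?_
    split_ifs with h1 h2 h2
    · rfl
    · exact absurd h1.1 h2
    · exact absurd ⟨h2, rfl⟩ h1
    · rfl
  have h1 := h false false
  have h2 := h false true
  have h3 := h true false
  have h4 := h true true
  simp only [if_true, Bool.false_eq_true, Bool.true_eq_false, if_false] at h1 h2 h3 h4
  rw [eq_neg_iff_add_eq_zero]
  simp only [bPlus, cMinus, LinearMap.add_apply, LinearMap.smul_apply, LinearMap.sub_apply,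
    map_add, map_sub, map_smul, ← smul_add]
  refine smul_eq_zero_of_right _ ?_
  have h5 := congr_arg₂ (· + ·) (congr_arg₂ (· - ·) h1 h2) (congr_arg₂ (· - ·) h3 h4)
  simp only [sub_zero, zero_sub, add_neg_cancel] at h5
  rw [← h5]
  abel

/-- The `b_0^+` of the first propagator moves to the second slot, past `c_0^-`, and meets the
`b_0^+` of the other propagator. -/
lemma kappa_siegelG (hg : g.PosDef) (x y : Fock n d) :
    kappa n g (siegelG n g x) (siegelG n g y) = 0 := by
  rw [kappa, LinearMap.compl₂_apply, siegelG_apply g hg, siegelG_apply g hg]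
  refine reflector_bPlus g _ _ ?_
  rw [bPlus_cMinus, bPlus_bPlus, map_zero, neg_zero]

end

end

end ClosedString

namespace LInfty

variable {V W : Type*} [AddCommGroup V] [Module ℂ V] [AddCommGroup W] [Module ℂ W]

lemma IsTransferDatum.exists_parityProj {𝒱 : ℤ → Submodule ℂ V} {𝒲 : ℤ → Submodule ℂ W}
    {κ : V →ₗ[ℂ] V →ₗ[ℂ] ℂ} {b : Multi V V} {ι : W →ₗ[ℂ] V} {π : V →ₗ[ℂ] W} {h D : V →ₗ[ℂ] V}
    (H : IsTransferDatum 𝒱 𝒲 κ b ι π h D) : ∃ pr, IsParityProj 𝒲 pr :=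
  exists_isParityProj H.internal

end LInfty

namespace ClosedString

noncomputable section

/-! ### The Siegel gauge contraction as a transfer datum -/

lemma isHomotopy_siegelG (n d : ℕ) (hdim : n + d = 26) (g : Matrix (Fin d) (Fin d) ℝ)
    (hg : g.PosDef) : IsHomotopy (StringFields n g) (kerLPlus n g) (QB n g) (projKer n g)
      (-siegelG n g) where
  mapsTo_D _ := QB_mem_stringFields g hg hdim
  mapsTo_h _ hx := Submodule.neg_mem _ (siegelG_mem_stringFields g hg hx)
  range_P := by
    refine le_antisymm ?_ fun y hy => ⟨y, hy.1, projKer_eq_self g hg hy.2⟩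
    rintro _ ⟨x, hx, rfl⟩
    exact projKer_mem_kerLPlus g hg hx
  idem x _ := projKer_eq_self g hg (LPlus_projKer g hg x)
  homotopy x _ := homotopy_relation g hg hdim x

lemma sideConditions_siegelG (n d : ℕ) (g : Matrix (Fin d) (Fin d) ℝ) (hg : g.PosDef) :
    SideConditions (StringFields n g) (projKer n g) (-siegelG n g) where
  hh x _ := by simp [siegelG_siegelG g hg]
  hP x _ := by simp [siegelG_projKer g hg]
  Ph x _ := by simp [projKer_siegelG g hg]

lemma orthogonality_siegelG (n d : ℕ) (g : Matrix (Fin d) (Fin d) ℝ) (hg : g.PosDef) :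
    Orthogonality (StringFields n g) (kappa n g) (projKer n g) (-siegelG n g) where
  proj x _ y _ := by
    rw [kappa_projKer g hg, map_sub, projKer_eq_self g hg (LPlus_projKer g hg y), sub_self, map_zero]
  homotopy x _ y _ := by simp [kappa_siegelG g hg]

variable {n d : ℕ} (g : Matrix (Fin d) (Fin d) ℝ) (hg : g.PosDef) (hdim : n + d = 26)

/-- The BRST charge on the space of closed string fields. -/
def fieldCharge : StringFields n g →ₗ[ℂ] StringFields n g :=
  (QB n g).restrict fun _ => QB_mem_stringFields g hg hdim

/-- The contracting homotopy `-G` on the space of closed string fields. -/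
def fieldHomotopy : StringFields n g →ₗ[ℂ] StringFields n g :=
  (-siegelG n g).restrict (isHomotopy_siegelG n d hdim g hg).mapsTo_h

/-- The projection `Π` of the closed string fields to the kernel of `L_0^+`. -/
def fieldProj : StringFields n g →ₗ[ℂ] kerLPlus n g :=
  (projKer n g).restrict fun _ => projKer_mem_kerLPlus g hg

/-- The inclusion of the kernel of `L_0^+`. -/
def fieldIncl (n : ℕ) {d : ℕ} (g : Matrix (Fin d) (Fin d) ℝ) : kerLPlus n g →ₗ[ℂ] StringFields n g :=
  Submodule.inclusion inf_le_left

lemma isTransferDatum {b : Multi (StringFields n g) (StringFields n g)}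
    (hb : IsCyclicLInfty (gradingOn (StringFields n g))
      ((kappa n g).domRestrict₁₂ (StringFields n g) (StringFields n g)) b)
    (hQ : ∀ x : StringFields n g, (b 1 ![x] : Fock n d) = QB n g x) :
    IsTransferDatum (V := StringFields n g) (W := kerLPlus n g) (gradingOn (StringFields n g)) (gradingOn (kerLPlus n g))
      ((kappa n g).domRestrict₁₂ (StringFields n g) (StringFields n g)) b (fieldIncl n g)
      (fieldProj g hg) (fieldHomotopy g hg hdim) (fieldCharge g hg hdim) where
  cyc := hb
  unary x := Subtype.ext (hQ x)
  internal := isInternal_kerLPlus g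
  proj_incl y := Subtype.ext (projKer_eq_self g hg y.2.2)
  DD x := Subtype.ext (DFunLike.congr_fun (QB_QB g hg hdim) (x : Fock n d))
  homotopy x := Subtype.ext (homotopy_relation g hg hdim (x : Fock n d))
  hh x := Subtype.ext ((sideConditions_siegelG n d g hg).hh x x.2)
  proj_h x := Subtype.ext ((sideConditions_siegelG n d g hg).Ph x x.2)
  incl_mem _ _ hy := hy
  proj_mem p x hx := by
    have h := hasDegree_diag (fun s => kerIndicator (plusEntry g s)) p (x : Fock n d) hx
    rw [add_zero, ← projKer_eq_diag g hg] at h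
    exact h
  h_mem p x hx := (hasDegree_siegelG g hg).neg p (x : Fock n d) hx
  orth x y := (orthogonality_siegelG n d g hg).proj x x.2 y y.2
  orth' x y := by
    change kappa n g (x - projKer n g x) (projKer n g y) = 0
    rw [← kappa_projKer g hg, map_sub, projKer_eq_self g hg (LPlus_projKer g hg _), sub_self,
      map_zero, LinearMap.zero_apply]
  orth_h x y := (orthogonality_siegelG n d g hg).homotopy x x.2 y y.2

end

end ClosedString

theorem mainTheorem3 (n d : ℕ) (hdim : n + d = 26) (g : Matrix (Fin d) (Fin d) ℝ)
    (hg : g.PosDef) :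
    -- `L_0^+` is diagonal in the Fock space basis
    (∀ s : FockLabel n d, LPlus n g (ket s) = LPlusEntry n g s • ket s) ∧
    -- `{b_0^+, Q_B} = L_0^+`, `(b_0^+)² = 0`, `(Q_B)² = 0`
    bPlus n d ∘ₗ QB n g + QB n g ∘ₗ bPlus n d = LPlus n g ∧
    bPlus n d ∘ₗ bPlus n d = 0 ∧
    QB n g ∘ₗ QB n g = 0 ∧
    -- `X` and `ker L_0^+` are graded subspaces, `Q_B` has degree `-1` and `G` has degree `+1`
    DirectSum.IsInternal (gradingOn (StringFields n g)) ∧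
    DirectSum.IsInternal (gradingOn (kerLPlus n g)) ∧
    (∀ (k : ℤ) (x : Fock n d), x ∈ degPart n d k →
      QB n g x ∈ degPart n d (k - 1) ∧ siegelG n g x ∈ degPart n d (k + 1)) ∧
    -- `-G` is a homotopy on `X` from the identity to the projector `Π` onto `ker L_0^+`
    IsHomotopy (StringFields n g) (kerLPlus n g) (QB n g) (projKer n g) (-siegelG n g) ∧
    -- side conditions and orthogonality conditions
    SideConditions (StringFields n g) (projKer n g) (-siegelG n g) ∧
    Orthogonality (StringFields n g) (kappa n g) (projKer n g) (-siegelG n g) ∧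
    -- every cyclic `L∞`-structure on `(X, κ)` with 1-bracket `Q_B` is transferred to a cyclic
    -- `L∞`-structure on `(ker L_0^+, κ)`
    (∀ b : Multi (StringFields n g) (StringFields n g),
      IsCyclicLInfty (gradingOn (StringFields n g))
        ((kappa n g).domRestrict₁₂ (StringFields n g) (StringFields n g)) b →
      (∀ x : StringFields n g, (b 1 ![x] : Fock n d) = QB n g x) →
      ∃ (bY : Multi (kerLPlus n g) (kerLPlus n g)) (E : Multi (kerLPlus n g) (StringFields n g)),
        IsTransfer (gradingOn (kerLPlus n g)) (projKer n g) (-siegelG n g) b bY E ∧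
        IsCyclicLInfty (gradingOn (kerLPlus n g))
          ((kappa n g).domRestrict₁₂ (kerLPlus n g) (kerLPlus n g)) bY ∧
        IsMorphism (gradingOn (kerLPlus n g)) bY (gradingOn (StringFields n g)) b E) := by
  refine ⟨fun s => ?_, LinearMap.ext (QB_bPlus g hg), LinearMap.ext bPlus_bPlus, QB_QB g hg hdim,
    isInternal_stringFields g, isInternal_kerLPlus g,
    fun k x hx => ⟨hasDegree_QB g k x hx, hasDegree_siegelG g hg k x hx⟩,
    isHomotopy_siegelG n d hdim g hg, sideConditions_siegelG n d g hg,
    orthogonality_siegelG n d g hg, fun b hb hQ => ?_⟩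
  · rw [LPlus_ket g hg, LPlusEntry_eq g hg]
  · have H := isTransferDatum g hg hdim hb hQ
    obtain ⟨pr, hpr⟩ := H.exists_parityProj
    refine ⟨H.bracket pr, transferMap pr b (fieldIncl n g) (fieldHomotopy g hg hdim), ?_,
      H.isCyclicLInfty hpr fun x y => rfl, H.isMorphism hpr⟩
    refine ⟨fun y => ?_, fun y => ?_, fun m p y hm hy => ?_, fun m p y hm hy => ?_⟩
    · rw [IsTransferDatum.transferMap_one]; rfl
    · rw [H.bracket_one, IsTransferDatum.transferMap_one, H.unary]
      -- The transferred one-bracket is `π D ι`. Since `ι π` commutes with `D` and fixes the image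
      -- of `ι`, it is the restriction of `D`.
      have h := H.D_incl_proj (fieldIncl n g y)
      rw [H.proj_incl] at h
      exact congrArg Subtype.val h.symm
    · rw [IsTransferDatum.transferMap_apply_of_two_le hpr hm hy]; rfl
    · rw [H.bracket_apply_of_two_le hpr hm hy]; rfl
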